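/- Let $C$ be an ordered field. A $2$-ordered $C$-vector space is a $C$-vector space $G$ with two total orderings $<_0,<_1$, each making $G$ an ordered $C$-vector space (translation invariant, and $\lambda>0$, $x>_i0$ imply $\lambda x>_i0$). Put $G_\infty=G\cup\{\infty\}$ with $G<_i\infty$ for $i=0,1$. A *Hamel valuation* on $G$ is a map $v:G\to G_\infty$, extended by $v(\infty)=\infty$, such that for all $x,y\in G$ and $\lambda\in C^\times$: $v(x)=\infty$ iff $x=0$; $v(x+y)\ge_0\min_0(v(x),v(y))$; $v(\lambda x)=v(x)$; $0<_1x<_1y$ implies $v(x)\ge_0v(y)$; $v(v(x))=v(x)$; and $v(x)>_10$. A *Hamel space* over $C$ is such a pair $(G,v)$. It is *independent* if, for any set of distinct orderings $<_i$ ($i\in\{0,1\}$) and any $a_i<_ib_i$ in $G\cup\{-\infty,\infty\}$, the intervals $(a_i,b_i)_i$ have a common point in $G$; it is *dense* if for all $a<_0b$ in $G$ there is $c\in G$ with $a<_0v(c)<_0b$. Regard $(G,v)$ as a structure with underlying set $G_\infty$ in the language $\{0,+,(\lambda_c)_{c\in C},<_0,<_1,v,\infty\}$, where $g+\infty=\infty+g=\infty+\infty=\lambda_c(\infty)=v(\infty)=\infty$.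 Let $T_{\mathrm{Ham}}$ be the theory of the independent, dense Hamel spaces over $C$. A complete theory $T$ is *distal* if in its models (equivalently, in a monster model) the following holds for every set $A$ of parameters and every $\emptyset$-indiscernible sequence $(a_i)_{i\in I}$ of finite tuples, with $I=I_1+(c)+I_2$ and $I_1,I_2$ infinite: if $(a_i)_{i\in I_1+I_2}$ is $A$-indiscernible, then $(a_i)_{i\in I}$ is $A$-indiscernible. A structure has a *distal expansion* if it has an expansion, on the same underlying set, whose complete theory is distal. **Theorem.** (1) For every ordered field $C$, the theory $T_{\mathrm{Ham}}$ is complete (in particular consistent) and distal. (2) If $H\subseteq\mathbb R$ is a basis of $\mathbb R$ as a vector space over $\mathbb Q$ and is dense in $\mathbb R$, then $(\mathbb R;+,<,H)$ has a distal expansion. (3) The dense pair $(\mathbb R;+,<,\mathbb Q)$ has a distal expansion. -/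

import Mathlib

universe u v w

open FirstOrder

namespace Hamel

/-! ### Indiscernible sequences, distality, distal expansions -/

section ModelTheory

variable {L : FirstOrder.Language.{u, v}}

/-- A sequence `(a i)_{i ∈ I}` of `n`-tuples of an `L`-structure `M` is `A`-indiscernible if any two
increasing subsequences of the same finite length satisfy the same `L`-formulas with parameters
from `A`. -/
def Indiscernible (L : FirstOrder.Language.{u, v}) {M : Type*} [L.Structure M] (A : Set M)
    {I : Type*} [LinearOrder I] {n : ℕ} (a : I → Fin n → M) : Prop :=
  ∀ (k : ℕ) (φ : L.Formula (A ⊕ (Fin k × Fin n))) (s t : Fin k ↪o I),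
    φ.Realize (Sum.elim (fun x : A => (x : M)) fun p => a (s p.1) p.2) ↔
      φ.Realize (Sum.elim (fun x : A => (x : M)) fun p => a (t p.1) p.2)

/-- Distality of a theory `T`, tested in every model. In an index set `I = I₁ + (c) + I₂` the parts
`I₁` and `I₂` are the elements below and above `c`.

Indiscernibility is a condition on finitely many terms and parameters at a time, and is preserved by
elementary extension. So, for complete `T`, testing in all models (equivalently, those in the
universe of the language) is the same as testing in one monster model. -/
def IsDistal (T : L.Theory) : Prop :=
  ∀ (M : Type (max u v)) [L.Structure M] [Nonempty M] [M ⊨ T] (A : Set M) (n : ℕ)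
    (I : Type (max u v)) [LinearOrder I] (c : I) (a : I → Fin n → M),
    (Set.Iio c).Infinite → (Set.Ioi c).Infinite →
    Indiscernible L ∅ a →
    Indiscernible L A (fun i : {i : I // i ≠ c} => a i) →
    Indiscernible L A a

/-- The `L`-structure `M` has a distal expansion: `M` can be expanded, on the same underlying set,
to a structure in a larger language whose complete theory is distal. -/
def HasDistalExpansion (L : FirstOrder.Language.{u, v}) (M : Type w) [L.Structure M] : Prop :=
  ∃ (L' : FirstOrder.Language.{u, v}) (ι : L →ᴸ L') (_ : L'.Structure M),
    ι.Injective ∧ ι.IsExpansionOn M ∧ IsDistal (L'.completeTheory M)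

end ModelTheory

/-! ### Ordered vector spaces -/

section OrderedSpaces

/-- A strict order `<` on `S`, extended to `S ∪ {∞}` by `S < ∞`. -/
def ltTop {S : Type*} (lt : S → S → Prop) : WithTop S → WithTop S → Prop
  | some x, some y => lt x y
  | some _, none => True
  | none, _ => False

/-- A strict order `<` on `S`, extended to `S ∪ {-∞}` by `-∞ < S`. -/
def ltBot {S : Type*} (lt : S → S → Prop) : WithBot S → WithBot S → Prop
  | some x, some y => lt x y
  | none, some _ => True
  | _, none => False

/-- The non-strict order on `S ∪ {∞}`. -/
def leTop {S : Type*} (lt : S → S → Prop) (x y : WithTop S) : Prop :=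
  x = y ∨ ltTop lt x y

/-- A strict order `<` on `S`, extended to `S ∪ {-∞, ∞}` by `-∞ < S < ∞`. -/
def ltExt {S : Type*} (lt : S → S → Prop) : WithBot (WithTop S) → WithBot (WithTop S) → Prop :=
  ltBot (ltTop lt)

variable (C : Type*) [Field C] [LinearOrder C] [IsStrictOrderedRing C]
variable (I : Type*) (G : Type*) [AddCommGroup G] [Module C G]

/-- The relation `lt` is a (total, strict) ordering on `G` making it an ordered `C`-vector space. -/
structure IsVectorSpaceOrder {G : Type*} [AddCommGroup G] [Module C G]
    (lt : G → G → Prop) : Prop where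
  irrefl : ∀ x, ¬ lt x x
  trans : ∀ x y z, lt x y → lt y z → lt x z
  total : ∀ x y, x ≠ y → lt x y ∨ lt y x
  add_left : ∀ x y z, lt x y → lt (z + x) (z + y)
  smul_pos : ∀ (r : C) (x : G), 0 < r → lt 0 x → lt 0 (r • x)

/-- An `I`-ordered `C`-vector space structure on the `C`-vector space `G`. -/
structure OrderedSpace where
  lt : I → G → G → Prop
  isOrder : ∀ i, IsVectorSpaceOrder C (lt i)

variable {C I G}

/-- The orderings are independent: finitely many intervals `(a i, b i)` with `a i < b i`,
endpoints in `G ∪ {-∞, ∞}`, taken with respect to distinct orderings, have a common point in `G`. -/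
def OrderedSpace.Independent (S : OrderedSpace C I G) : Prop :=
  ∀ (s : Finset I) (a b : I → WithBot (WithTop G)),
    (∀ i ∈ s, ltExt (S.lt i) (a i) (b i)) →
    ∃ z : G, ∀ i ∈ s, ltExt (S.lt i) (a i) (z : WithTop G) ∧ ltExt (S.lt i) (z : WithTop G) (b i)

end OrderedSpaces

/-! ### Hamel spaces -/

section HamelSpaces

/-- A map `v : G → G ∪ {∞}`, extended to `G ∪ {∞}` by `v ∞ = ∞`. -/
def extendTop {G : Type*} (v : G → WithTop G) : WithTop G → WithTop G
  | some x => v x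
  | none => ⊤

/-- A Hamel space over `C` on the `C`-vector space `G`: a `2`-ordered `C`-vector space with a Hamel
valuation `v`. Here `lt 0` is the original and `lt 1` the auxiliary ordering. -/
structure HamelSpace (C : Type*) [Field C] [LinearOrder C] [IsStrictOrderedRing C]
    (G : Type*) [AddCommGroup G] [Module C G] extends OrderedSpace C (Fin 2) G where
  v : G → WithTop G
  v_eq_top_iff : ∀ x, v x = ⊤ ↔ x = 0
  /-- `v (x + y) ≥ min (v x) (v y)` -/
  min_le_v_add : ∀ x y, leTop (lt 0) (v x) (v (x + y)) ∨ leTop (lt 0) (v y) (v (x + y))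
  v_smul : ∀ (r : C) (x : G), r ≠ 0 → v (r • x) = v x
  convex : ∀ x y, lt 1 0 x → lt 1 x y → leTop (lt 0) (v y) (v x)
  idempotent : ∀ x, v x = extendTop v (v x)
  positive : ∀ x, ltTop (lt 1) (0 : G) (v x)

/-- The Hamel space is dense: values of `v` lie `lt 0`-densely in `G`. -/
def HamelSpace.Dense {C : Type*} [Field C] [LinearOrder C] [IsStrictOrderedRing C]
    {G : Type*} [AddCommGroup G] [Module C G] (S : HamelSpace C G) : Prop :=
  ∀ a b : G, S.lt 0 a b → ∃ c : G, ltTop (S.lt 0) a (S.v c) ∧ ltTop (S.lt 0) (S.v c) b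

/-- Function symbols `0`, `∞`, `+`, `λ_c` (for `c ∈ C`), `v`. -/
inductive HamelFunc (C : Type u) : ℕ → Type u
  | zero : HamelFunc C 0
  | infty : HamelFunc C 0
  | add : HamelFunc C 2
  | smul (c : C) : HamelFunc C 1
  | val : HamelFunc C 1

/-- Relation symbols `<₀`, `<₁`. -/
inductive HamelRel : ℕ → Type
  | lt (i : Fin 2) : HamelRel 2

/-- The language of Hamel spaces over `C`. -/
def hamelLang (C : Type u) : FirstOrder.Language.{u, 0} := ⟨HamelFunc C, HamelRel⟩

/-- A Hamel space on `G`, as a first-order structure with underlying set `G ∪ {∞}`. -/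
abbrev HamelSpace.toStructure {C : Type u} [Field C] [LinearOrder C] [IsStrictOrderedRing C]
    {G : Type w} [AddCommGroup G] [Module C G] (S : HamelSpace C G) :
    (hamelLang C).Structure (WithTop G) where
  funMap := fun {_} f => match f with
    | .zero => fun _ => ((0 : G) : WithTop G)
    | .infty => fun _ => ⊤
    | .add => fun x => x 0 + x 1
    | .smul c => fun x => (x 0).map (c • ·)
    | .val => fun x => extendTop S.v (x 0)
  RelMap := fun {_} R => match R with
    | .lt i => fun x => ltTop (S.lt i) (x 0) (x 1)

/-- The theory of the independent, dense Hamel spaces over `C`: the sentences true in all of them.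
The clauses defining these spaces are first-order conditions on the structure with underlying set
`G ∪ {∞}`, so up to logical equivalence this is the theory whose models are exactly (the structures
isomorphic to) the independent, dense Hamel spaces. -/
def THam (C : Type u) [Field C] [LinearOrder C] [IsStrictOrderedRing C] :
    (hamelLang C).Theory :=
  {φ | ∀ (G : Type u) [AddCommGroup G] [Module C G] (S : HamelSpace C G),
    S.Independent → S.Dense →
      letI := S.toStructure
      FirstOrder.Language.Sentence.Realize (WithTop G) φ}

end HamelSpaces

/-! ### The real line with a distinguished subset -/

section RealPairs

inductive PairFunc : ℕ → Type
  | add : PairFunc 2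

inductive PairRel : ℕ → Type
  | mem : PairRel 1
  | lt : PairRel 2

/-- The language `{+, <, P}` with `P` a unary relation symbol. -/
def pairLang : FirstOrder.Language.{0, 0} := ⟨PairFunc, PairRel⟩

/-- The structure `(ℝ; +, <, P)`. -/
abbrev realPair (P : Set ℝ) : pairLang.Structure ℝ where
  funMap := fun {_} f => match f with
    | .add => fun x => x 0 + x 1
  RelMap := fun {_} R => match R with
    | .mem => fun x => x 0 ∈ P
    | .lt => fun x => x 0 < x 1

/-- `H` is a Hamel basis of `ℝ`, that is, a basis of `ℝ` as a vector space over `ℚ`. -/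
def IsHamelBasis (H : Set ℝ) : Prop :=
  LinearIndepOn ℚ id H ∧ Submodule.span ℚ H = ⊤

end RealPairs

end Hamel

namespace Hamel

/-! ### Quantifier elimination from a back-and-forth property -/

section QuantifierElimination

open FirstOrder.Language

variable {L : FirstOrder.Language.{u, v}}

/-! Hamel spaces and the pair (ℝ, ℚ) are treated together as `BiorderedSpace`s: a vector space with
an order `<₀`, a second order or preorder `<₁`, and a map `val`. In a Hamel space `val` is the
valuation, with `val 0 = 0` instead of `∞`. For (ℝ, H), `<₁` is lexicographic in the coordinates
over `H` and `val x` is the least basis vector in the support of `x`, so `H` is the set of nonzero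
fixed points of `val`. For (ℝ, ℚ), `val` is zero and `<₁` is pulled back from an order on ℝ/ℚ, so
that ℚ is its kernel. A `Carrier` links such a space to a first-order structure; its flag says
whether `∞` is an extra point or, as on the underlying set ℝ, merely another name for `0`.

Quantifier elimination. By compactness it suffices to transfer one quantifier-free formula about one
new element `b` (`BackAndForth`), so no saturation is needed. Such a formula involves finitely many
signs and values, hence it is enough to extend a partial embedding to a linear map respecting a
finite set (`HasExtension`). In a Hamel space the needed values are adjoined first. A new value `h`
is placed by density, and the `<₁`-sign and the value of `y + c • h` are those of the dominant
summand. Afterwards `b` looks, for `<₁` and `val`, like a point `p` already present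
(`exists_center`), and independence provides an element in the right `<₀`-interval and in a very
small `<₁`-interval around the image of `p`. Completeness follows, since quantifier-free sentences
have the same truth value in all models and a model exists (`exists_hamelSpace`).

Distality. A finite version suffices (`LocallyDistal`): the middle term `d 0` of a long finite
sequence must satisfy the same formulas over `A` as `d 1`. By quantifier elimination only signs of
terms matter. Near the middle a term over `A` has the form `x j + g`, with `g` constant and `x j` a
term in `d j` and in far members of the sequence (`exists_represented`). Since `x` is indiscernible
at `0` too, it is monotone or constant for either order, and the sign of `x j + g` cannot jump at
`0`. The form survives sums and scalars trivially, and `val` by `HasValueDichotomy`: the values of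
`x j + g` are the distances from `x j` to a far member of the sequence, or constant. -/

/-- This is compactness, after the free variables have been replaced by new constants. -/
theorem exists_finset_of_consequence (T : L.Theory) {β : Type w} (S : Set (L.Formula β))
    (φ : L.Formula β)
    (h : ∀ (M : Type (max u v w)) [L.Structure M] [Nonempty M] [M ⊨ T] (a : β → M),
      (∀ ψ ∈ S, ψ.Realize a) → φ.Realize a) :
    ∃ S₀ : Finset (L.Formula β), (S₀ : Set (L.Formula β)) ⊆ S ∧
      ∀ (M : Type (max u v w)) [L.Structure M] [Nonempty M] [M ⊨ T] (a : β → M),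
        (∀ ψ ∈ S₀, ψ.Realize a) → φ.Realize a := by
  classical
  have h1 : (L.lhomWithConstants β).onTheory T ∪ Formula.equivSentence '' S ⊨ᵇ
      Formula.equivSentence φ := by
    refine Theory.models_sentence_iff.2 fun M => ?_
    let := (L.lhomWithConstants β).reduct M
    have hM := M.is_model
    rw [Theory.model_union_iff] at hM
    have : M ⊨ T := (LHom.onTheory_model _ _).1 hM.1
    rw [Formula.realize_equivSentence]
    refine h M _ fun ψ hψ => ?_
    rw [← Formula.realize_equivSentence]
    exact hM.2.realize_of_mem _ ⟨ψ, hψ, rfl⟩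
  obtain ⟨T₀, hT₀, h2⟩ := Theory.models_iff_finset_models.1 h1
  -- The finite subset `T₀` may also contain axioms of `T`; these hold in `M` anyway and are
  -- filtered out.
  refine ⟨(T₀.image Formula.equivSentence.symm).filter (· ∈ S), fun ψ hψ => by simp_all, ?_⟩
  intro M _ _ _ a ha
  let : (constantsOn β).Structure M := constantsOn.structure a
  have hM : M ⊨ (T₀ : L[[β]].Theory) := by
    refine ⟨fun θ hθ => ?_⟩
    rcases hT₀ hθ with h3 | ⟨ψ, hψ, rfl⟩
    · have : M ⊨ (L.lhomWithConstants β).onTheory T :=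
        (LHom.onTheory_model _ _).2 inferInstance
      exact this.realize_of_mem _ h3
    · rw [Formula.realize_equivSentence]
      refine ha ψ ?_
      simp only [Finset.mem_filter, Finset.mem_image]
      exact ⟨⟨_, hθ, by simp⟩, hψ⟩
  exact (Formula.realize_equivSentence _ _).1 (h2.realize_sentence M)

theorem realize_list_inf {β : Type w} {M : Type*} [L.Structure M] (l : List (L.Formula β))
    (a : β → M) : Formula.Realize (l.foldr (· ⊓ ·) ⊤) a ↔ ∀ ψ ∈ l, ψ.Realize a :=
  BoundedFormula.realize_foldr_inf l a default

theorem isQF_list_inf {β : Type w} (l : List (L.Formula β))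
    (h : ∀ ψ ∈ l, BoundedFormula.IsQF ψ) :
    BoundedFormula.IsQF (l.foldr (· ⊓ ·) ⊤ : L.Formula β) := by
  induction l with
  | nil => exact BoundedFormula.IsQF.top
  | cons ψ l ih =>
    exact (h ψ (by simp)).inf (ih fun θ hθ => h θ (by simp [hθ]))

/-- Two tuples have the same quantifier-free type. -/
def SameQFType (L : FirstOrder.Language.{u, v}) {β M N : Type*} [L.Structure M] [L.Structure N]
    (a : β → M) (b : β → N) : Prop :=
  ∀ ψ : L.Formula β, BoundedFormula.IsQF ψ → (ψ.Realize a ↔ ψ.Realize b)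

/-- Over `T`, a formula that depends only on quantifier-free types is quantifier-free. -/
theorem exists_isQF_iff (T : L.Theory) {β : Type w} (φ : L.Formula β)
    (h : ∀ (M N : Type (max u v w)) [L.Structure M] [L.Structure N] [Nonempty M] [Nonempty N]
      [M ⊨ T] [N ⊨ T] (a : β → M) (b : β → N), SameQFType L a b → φ.Realize a → φ.Realize b) :
    ∃ ψ : L.Formula β, BoundedFormula.IsQF ψ ∧
      ∀ (M : Type (max u v w)) [L.Structure M] [Nonempty M] [M ⊨ T] (a : β → M),
        φ.Realize a ↔ ψ.Realize a := by
  -- `S` consists of the quantifier-free consequences of `φ`. Once `S` is known to imply `φ`,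
  -- finitely many of its members do, and their conjunction is equivalent to `φ`.
  let S : Set (L.Formula β) := {ψ | BoundedFormula.IsQF ψ ∧
    ∀ (M : Type (max u v w)) [L.Structure M] [Nonempty M] [M ⊨ T] (a : β → M),
      φ.Realize a → ψ.Realize a}
  obtain ⟨S₀, hS₀, h1⟩ := exists_finset_of_consequence T S φ (by
    intro M _ _ _ a ha
    by_contra hφ
    obtain ⟨S₁, hS₁, h2⟩ := exists_finset_of_consequence T
      {ψ | BoundedFormula.IsQF ψ ∧ ψ.Realize a} φ.not (by
        intro N _ _ _ b hb
        rw [Formula.realize_not]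
        intro hφb
        refine hφ (h N M b a (fun ψ hψ => ⟨fun h3 => ?_, fun h3 => hb ψ ⟨hψ, h3⟩⟩) hφb)
        by_contra h4
        exact hb ψ.not ⟨hψ.not, h4⟩ h3)
    -- A tuple `a` that satisfies `S` but not `φ` has a quantifier-free type implying `¬ φ`. A
    -- finite part of the type does so already, and the negation of its conjunction lies in `S`,
    -- although `a` violates it.
    have h3 : (Formula.not (S₁.toList.foldr (· ⊓ ·) ⊤ : L.Formula β)) ∈ S := by
      refine ⟨(isQF_list_inf _ fun ψ hψ => (hS₁ (by simpa using hψ)).1).not, ?_⟩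
      intro N _ _ _ b hb
      rw [Formula.realize_not, realize_list_inf]
      intro h4
      exact h2 N b (fun ψ hψ => h4 ψ (by simpa using hψ)) hb
    have h4 := ha _ h3
    rw [Formula.realize_not, realize_list_inf] at h4
    exact h4 fun ψ hψ => (hS₁ (by simpa using hψ)).2)
  refine ⟨(S₀.toList.foldr (· ⊓ ·) ⊤ : L.Formula β),
    isQF_list_inf _ fun ψ hψ => (hS₀ (by simpa using hψ)).1, ?_⟩
  intro M _ _ _ a
  rw [realize_list_inf]
  exact ⟨fun hφ ψ hψ => (hS₀ (by simpa using hψ)).2 M a hφ,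
    fun h2 => h1 M a fun ψ hψ => h2 ψ (by simpa using hψ)⟩

theorem isQF_toFormula {α : Type w} {n : ℕ} {φ : L.BoundedFormula α n} (h : φ.IsQF) :
    BoundedFormula.IsQF φ.toFormula := by
  induction h with
  | falsum => exact BoundedFormula.IsQF.falsum
  | of_isAtomic h =>
    cases h with
    | equal t₁ t₂ => exact (BoundedFormula.IsAtomic.equal _ _).isQF
    | rel R ts => exact (BoundedFormula.IsAtomic.rel _ _).isQF
  | imp _ _ h1 h2 => exact h1.imp h2

/-- The back-and-forth property: quantifier-free conditions on one new element over tuples of the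
same quantifier-free type can be transferred. -/
def BackAndForth (T : L.Theory) : Prop :=
  ∀ (M N : Type (max u v w)) [L.Structure M] [L.Structure N] [Nonempty M] [Nonempty N]
    [M ⊨ T] [N ⊨ T] (β : Type w) (a : β → M) (b : β → N), SameQFType L a b → ∀ (x : M)
    (ψ : L.Formula (Option β)), BoundedFormula.IsQF ψ → ψ.Realize (fun o => o.elim x a) →
    ∃ y : N, ψ.Realize fun o => o.elim y b

/-- Only the universal quantifier needs work. If `ψ` is quantifier-free, a counterexample to `∀ x,
ψ` over one tuple transfers to any tuple of the same quantifier-free type, so `∀ x, ψ` depends only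
on that type. -/
theorem BackAndForth.quantifierElimination {T : L.Theory}
    (hT : BackAndForth.{u, v, w} T) {α : Type w} {n : ℕ} (φ : L.BoundedFormula α n) :
    ∃ ψ : L.BoundedFormula α n, ψ.IsQF ∧
      ∀ (M : Type (max u v w)) [L.Structure M] [Nonempty M] [M ⊨ T] (a : α → M) (xs : Fin n → M),
        φ.Realize a xs ↔ ψ.Realize a xs := by
  induction φ with
  | falsum => exact ⟨_, BoundedFormula.IsQF.falsum, fun _ _ _ _ _ _ => Iff.rfl⟩
  | equal t₁ t₂ => exact ⟨_, (BoundedFormula.IsAtomic.equal t₁ t₂).isQF, fun _ _ _ _ _ _ => Iff.rfl⟩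
  | rel R ts => exact ⟨_, (BoundedFormula.IsAtomic.rel R ts).isQF, fun _ _ _ _ _ _ => Iff.rfl⟩
  | imp _ _ h1 h2 =>
    obtain ⟨ψ₁, hψ₁, e₁⟩ := h1
    obtain ⟨ψ₂, hψ₂, e₂⟩ := h2
    refine ⟨_, hψ₁.imp hψ₂, fun M _ _ _ a xs => ?_⟩
    rw [BoundedFormula.realize_imp, BoundedFormula.realize_imp, e₁ M, e₂ M]
  | @all n φ h =>
    obtain ⟨ψ, hψ, e⟩ := h
    -- The quantified variable of `¬ ψ` is renamed to `none`, and the others are placed under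
    -- `some`, to match the form of `BackAndForth`.
    have key : ∀ (M : Type (max u v w)) [L.Structure M] (a : α ⊕ Fin n → M) (x : M),
        (Formula.relabel (Sum.elim (some ∘ Sum.inl)
          (Fin.snoc (α := fun _ => Option (α ⊕ Fin n)) (some ∘ Sum.inr) none))
          ψ.not.toFormula).Realize (fun o => o.elim x a) ↔
        ¬ ψ.Realize (a ∘ Sum.inl) (Fin.snoc (a ∘ Sum.inr) x) := by
      intro M _ a x
      rw [Formula.realize_relabel, BoundedFormula.realize_toFormula, BoundedFormula.realize_not]
      apply not_congr
      rw [iff_eq_eq]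
      congr 1
      funext i
      refine Fin.lastCases ?_ (fun i => ?_) i <;> simp [Fin.snoc_last, Fin.snoc_castSucc]
    obtain ⟨θ, hθ, eθ⟩ := exists_isQF_iff T ψ.all.toFormula (by
      intro M N _ _ _ _ _ _ a b hab h1
      rw [BoundedFormula.realize_toFormula, BoundedFormula.realize_all] at h1 ⊢
      intro y
      by_contra hy
      obtain ⟨x, hx⟩ := hT N M _ b a (fun ψ hψ => (hab ψ hψ).symm) y _
        ((isQF_toFormula hψ.not).relabel _) ((key N b y).2 hy)
      exact (key M a x).1 hx (h1 x))
    refine ⟨BoundedFormula.relabel id θ, hθ.relabel _, fun M _ _ _ a xs => ?_⟩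
    have h1 := eθ M (Sum.elim a xs)
    rw [BoundedFormula.realize_toFormula] at h1
    have h2 : (BoundedFormula.relabel id θ).Realize a xs ↔ θ.Realize (Sum.elim a xs) := by
      rw [BoundedFormula.realize_relabel, Formula.Realize, iff_eq_eq]
      congr 1
      exact Subsingleton.elim _ _
    rw [h2, ← h1]
    simp only [BoundedFormula.realize_all, Sum.elim_comp_inl, Sum.elim_comp_inr]
    exact forall_congr' fun x => e M a _

end QuantifierElimination

end Hamel

namespace Hamel

/-! ### Distality from a condition on long finite sequences -/

section LocalDistality

open FirstOrder.Language

variable {L : FirstOrder.Language.{u, v}} {M : Type*} [L.Structure M]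

/-- Indiscernibility of a family of tuples, restricted to the set `J` of indices. -/
def IndiscernibleOn (L : FirstOrder.Language.{u, v}) {M : Type*} [L.Structure M] (A : Set M)
    {I : Type*} [LinearOrder I] (J : Set I) {V : Type*} (d : I → V → M) : Prop :=
  ∀ (k : ℕ) (φ : L.Formula (A ⊕ (Fin k × V))) (s t : Fin k → I), StrictMono s → StrictMono t →
    (∀ i, s i ∈ J) → (∀ i, t i ∈ J) →
    (φ.Realize (Sum.elim (fun x : A => (x : M)) fun p => d (s p.1) p.2) ↔
      φ.Realize (Sum.elim (fun x : A => (x : M)) fun p => d (t p.1) p.2))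

/-- Index families with repetitions and in arbitrary order reduce to increasing ones: `f` factors
through the increasing enumeration of its image, and `g` through the same pattern. -/
theorem IndiscernibleOn.realize_iff {A : Set M} {I : Type*} [LinearOrder I] {J : Set I}
    {V : Type*} {d : I → V → M} (h : IndiscernibleOn L A J d) {W : Type*} [Finite W] (f g : W → I)
    (hfg : ∀ x y, f x < f y ↔ g x < g y) (hf : ∀ x, f x ∈ J) (hg : ∀ x, g x ∈ J)
    (φ : L.Formula (A ⊕ (W × V))) :
    φ.Realize (Sum.elim (fun x : A => (x : M)) fun p => d (f p.1) p.2) ↔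
      φ.Realize (Sum.elim (fun x : A => (x : M)) fun p => d (g p.1) p.2) := by
  classical
  have := Fintype.ofFinite W
  let F : Finset I := Finset.univ.image f
  let s : Fin F.card ↪o I := F.orderEmbOfFin rfl
  have h1 : ∀ x, ∃ i, s i = f x := fun x => by
    have : f x ∈ Set.range s := by simp [s, F]
    exact this
  have h2 : ∀ i, ∃ x, f x = s i := fun i => by
    have : s i ∈ F := F.orderEmbOfFin_mem rfl i
    simpa [F] using this
  choose c hc using h1
  choose r hr using h2
  have hmono : StrictMono fun i => g (r i) := fun i j hij => by
    beta_reduce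
    rw [← hfg, hr, hr]
    exact s.strictMono hij
  have ht : ∀ x, g (r (c x)) = g x := by
    intro x
    have h3 : f (r (c x)) = f x := by rw [hr, hc]
    refine le_antisymm (not_lt.1 fun h4 => ?_) (not_lt.1 fun h4 => ?_) <;>
    exact absurd ((hfg _ _).2 h4) (by rw [h3]; exact lt_irrefl _)
  have := h F.card (φ.relabel (Sum.map id (Prod.map c id))) s (fun i => g (r i)) s.strictMono hmono
    (fun i => hr i ▸ hf _) fun i => hg _
  rw [Formula.realize_relabel, Formula.realize_relabel] at this
  convert this using 2 <;>
  · funext p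
    rcases p with p | p
    · simp
    · simp [hc, ht]

theorem Indiscernible.realize_iff {A : Set M} {I : Type*} [LinearOrder I] {n : ℕ}
    {a : I → Fin n → M} (h : Indiscernible L A a) {W : Type} [Finite W] (f g : W → I)
    (hfg : ∀ x y, f x < f y ↔ g x < g y) (φ : L.Formula (A ⊕ (W × Fin n))) :
    φ.Realize (Sum.elim (fun x : A => (x : M)) fun p => a (f p.1) p.2) ↔
      φ.Realize (Sum.elim (fun x : A => (x : M)) fun p => a (g p.1) p.2) :=
  IndiscernibleOn.realize_iff (J := Set.univ) (fun k φ s t hs ht _ _ =>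
    h k φ (OrderEmbedding.ofStrictMono s hs) (OrderEmbedding.ofStrictMono t ht)) f g hfg
    (fun _ => trivial) (fun _ => trivial) φ

/-- The finite tuple `s` cuts `I` into finitely many pieces, so by the pigeonhole principle one of
them contains infinitely many points of `J`, and hence a copy of every finite order. -/
theorem exists_gap {I : Type*} [LinearOrder I] {k : ℕ} (s : Fin k → I) {J : Set I}
    (hJ : J.Infinite) {X : Type*} [LinearOrder X] (F : Finset X) :
    ∃ (i : I) (e : X → I), i ∈ J ∧ (∀ p, s p ≠ i) ∧ StrictMonoOn e F ∧
      ∀ x ∈ F, e x ∈ J ∧ ∀ p, s p ≠ e x ∧ (s p < e x ↔ s p < i) := by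
  classical
  have h1 : (J \ Set.range s).Infinite := hJ.sdiff (Set.finite_range s)
  have := h1.to_subtype
  obtain ⟨D, hD⟩ := Finite.exists_infinite_fiber
    (fun i : ↥(J \ Set.range s) => (Finset.univ.filter fun p => s p < i : Finset (Fin k)))
  have h2 := Set.infinite_coe_iff.1 hD
  have h2 := h2.image (f := Subtype.val) Subtype.val_injective.injOn
  set G := Subtype.val '' ((fun i : ↥(J \ Set.range s) =>
    (Finset.univ.filter fun p => s p < i : Finset (Fin k))) ⁻¹' {D}) with hG
  have hG' : ∀ x ∈ G, x ∈ J ∧ (∀ p, s p ≠ x) ∧ ∀ p, s p < x ↔ p ∈ D := by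
    rintro x ⟨⟨y, hy⟩, hyD, rfl⟩
    simp only [Set.mem_preimage, Set.mem_singleton_iff] at hyD
    refine ⟨hy.1, fun p hp => hy.2 ⟨p, hp⟩, fun p => ?_⟩
    rw [← hyD]
    simp
  obtain ⟨i, hi⟩ := h2.nonempty
  obtain ⟨E, hE, hEc⟩ := h2.exists_subset_card_eq F.card
  refine ⟨i, fun x => if h : x ∈ F then
    E.orderEmbOfFin hEc ((F.orderIsoOfFin rfl).symm ⟨x, h⟩) else i,
    (hG' i hi).1, (hG' i hi).2.1, ?_, ?_⟩
  · intro x hx y hy hxy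
    simp only [Finset.mem_coe.1 hx, Finset.mem_coe.1 hy, dite_true]
    refine (E.orderEmbOfFin hEc).strictMono ((F.orderIsoOfFin rfl).symm.strictMono ?_)
    exact hxy
  · intro x hx
    simp only [hx, dite_true]
    have h3 := hG' _ (hE (E.orderEmbOfFin_mem hEc ((F.orderIsoOfFin rfl).symm ⟨x, hx⟩)))
    refine ⟨h3.1, fun p => ⟨h3.2.1 p, ?_⟩⟩
    rw [h3.2.2, (hG' i hi).2.2]

/-- A tuple `s` containing `c` is the middle term of a finite family of tuples avoiding `c`
otherwise, any two of which are in the same relative position. -/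
theorem exists_block_family {I : Type*} [LinearOrder I] {k : ℕ} {s : Fin k → I}
    (hs : StrictMono s) {c : I} (hc : ∃ p, s p = c) (h₁ : (Set.Iio c).Infinite)
    (h₂ : (Set.Ioi c).Infinite) (N : ℕ) :
    ∃ (u : ℤ → Fin k → I) (B : Fin k → Prop), u 0 = s ∧
      (∀ j ∈ Set.Icc (-N : ℤ) N, j ≠ 0 → ∀ p, u j p ≠ c) ∧
      ∀ j ∈ Set.Icc (-N : ℤ) N, ∀ j' ∈ Set.Icc (-N : ℤ) N, ∀ p q,
        (u j p < u j' q ↔ (B p ∧ B q ∧ (j < j' ∨ j = j' ∧ p < q)) ∨ (¬ (B p ∧ B q) ∧ p < q)) := by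
  classical
  -- The entries of the new tuples are ordered by the number `j` of the tuple first, and by the
  -- position in the tuple second.
  let F : Finset (ℤ ×ₗ Fin k) := ((Finset.Icc (-N : ℤ) N) ×ˢ Finset.univ).map toLex.toEmbedding
  have hF : ∀ j ∈ Set.Icc (-N : ℤ) N, ∀ p, toLex (j, p) ∈ F := fun j hj p => by
    simpa [F] using hj
  obtain ⟨i₁, e₁, hi₁, hs₁, m₁, g₁⟩ := exists_gap s h₁ F
  obtain ⟨i₂, e₂, hi₂, hs₂, m₂, g₂⟩ := exists_gap s h₂ F
  -- Moving `c` alone may be impossible, as there may be no room between `c` and its neighbours in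
  -- `s`. Hence the whole block of entries between the gaps around `i₁ < c` and `i₂ > c` is moved:
  -- into the left gap for `j < 0`, into the right gap for `j > 0`.
  let B : Fin k → Prop := fun p => i₁ < s p ∧ s p < i₂
  let u : ℤ → Fin k → I := fun j p =>
    if B p then (if j < 0 then e₁ (toLex (j, p)) else if j = 0 then s p else e₂ (toLex (j, p)))
    else s p
  have un : ∀ j p, ¬ B p → u j p = s p := fun j p hp => by simp [u, hp]
  have u0 : ∀ p, u 0 p = s p := fun p => by simp [u]
  have uneg : ∀ j p, B p → j < 0 → u j p = e₁ (toLex (j, p)) := fun j p hp hj => by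
    simp [u, hp, hj]
  have upos : ∀ j p, B p → 0 < j → u j p = e₂ (toLex (j, p)) := fun j p hp hj => by
    simp [u, hp, hj.not_gt, hj.ne']
  have hlex : ∀ (j j' : ℤ) (p q : Fin k), toLex (j, p) < toLex (j', q) ↔
      (j < j' ∨ j = j' ∧ p < q) := fun j j' p q => Prod.Lex.toLex_lt_toLex
  have hBc : ∀ p, s p = c → B p := fun p hp => by
    subst hp
    exact ⟨hi₁, hi₂⟩
  have cross : ∀ j ∈ Set.Icc (-N : ℤ) N, ∀ p q, B p → ¬ B q →
      (s q < u j p ↔ q < p) ∧ (u j p < s q ↔ p < q) := by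
    intro j hj p q hp hq
    have hqc : s q < i₁ ∨ i₂ < s q := by
      by_contra! h
      exact hq ⟨lt_of_le_of_ne h.1 (hs₁ q).symm, lt_of_le_of_ne h.2 (hs₂ q)⟩
    have hqp : (s q < i₁ ∧ q < p) ∨ (i₂ < s q ∧ p < q) := by
      rcases hqc with h | h
      · exact Or.inl ⟨h, hs.lt_iff_lt.1 (h.trans hp.1)⟩
      · exact Or.inr ⟨h, hs.lt_iff_lt.1 (hp.2.trans h)⟩
    have h12 : i₁ < i₂ := hi₁.trans hi₂
    have hu : (s q < i₁ → s q < u j p) ∧ (i₂ < s q → u j p < s q) := by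
      rcases lt_trichotomy j 0 with h | h | h
      · rw [uneg j p hp h]
        have := (g₁ _ (hF j hj p)).2 q
        refine ⟨this.2.2, fun h' => lt_of_le_of_ne (not_lt.1 fun h3 => ?_) this.1.symm⟩
        exact absurd (this.2.1 h3) (h12.trans h').not_gt
      · subst h
        rw [u0]
        exact ⟨fun h => h.trans hp.1, fun h => hp.2.trans h⟩
      · rw [upos j p hp h]
        have := (g₂ _ (hF j hj p)).2 q
        refine ⟨fun h' => this.2.2 (h'.trans h12),
          fun h' => lt_of_le_of_ne (not_lt.1 fun h3 => ?_) this.1.symm⟩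
        exact absurd (this.2.1 h3) h'.not_gt
    rcases hqp with ⟨h, h'⟩ | ⟨h, h'⟩
    · exact ⟨iff_of_true (hu.1 h) h', iff_of_false (hu.1 h).not_gt h'.not_gt⟩
    · exact ⟨iff_of_false (hu.2 h).not_gt h'.not_gt, iff_of_true (hu.2 h) h'⟩
  refine ⟨u, B, funext u0, ?_, ?_⟩
  · intro j hj hj0 p hp
    by_cases hB : B p
    · rcases lt_or_gt_of_ne hj0 with h | h
      · rw [uneg j p hB h] at hp
        exact absurd (g₁ _ (hF j hj p)).1 (by rw [hp]; exact lt_irrefl _)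
      · rw [upos j p hB h] at hp
        exact absurd (g₂ _ (hF j hj p)).1 (by rw [hp]; exact lt_irrefl _)
    · exact hB (hBc p (by rw [← un j p hB, hp]))
  · intro j hj j' hj' p q
    by_cases hp : B p <;> by_cases hq : B q
    · have mono : ∀ j ∈ Set.Icc (-N : ℤ) N, ∀ j' ∈ Set.Icc (-N : ℤ) N, ∀ p q, B p → B q →
          (j < j' ∨ j = j' ∧ p < q) → u j p < u j' q := by
        intro j hj j' hj' p q hp hq h
        have hcn : ∀ j ∈ Set.Icc (-N : ℤ) N, ∀ p, B p → j < 0 → ∀ q, B q → u j p < s q := by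
          intro j hj p hp h q hq
          rw [uneg j p hp h]
          have := (g₁ _ (hF j hj p)).2 q
          exact lt_of_le_of_ne (not_lt.1 fun h3 => (this.2.1 h3).not_gt hq.1) this.1.symm
        have hcp : ∀ j ∈ Set.Icc (-N : ℤ) N, ∀ p, B p → 0 < j → ∀ q, B q → s q < u j p := by
          intro j hj p hp h q hq
          rw [upos j p hp h]
          exact ((g₂ _ (hF j hj p)).2 q).2.2 hq.2
        rcases lt_trichotomy j 0 with h1 | h1 | h1 <;> rcases lt_trichotomy j' 0 with h2 | h2 | h2
        · rw [uneg j p hp h1, uneg j' q hq h2]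
          exact m₁ (hF j hj p) (hF j' hj' q) ((hlex _ _ _ _).2 h)
        · subst h2
          rw [u0]
          exact hcn j hj p hp h1 q hq
        · exact (hcn j hj p hp h1 q hq).trans (hcp j' hj' q hq h2 q hq)
        · omega
        · subst h1 h2
          rw [u0, u0]
          exact hs (by simpa using h)
        · subst h1
          rw [u0]
          exact hcp j' hj' q hq h2 p hp
        · omega
        · omega
        · rw [upos j p hp h1, upos j' q hq h2]
          exact m₂ (hF j hj p) (hF j' hj' q) ((hlex _ _ _ _).2 h)
      simp only [hp, hq, true_and, and_self, not_true_eq_false, false_and, or_false]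
      refine ⟨fun h => ?_, mono j hj j' hj' p q hp hq⟩
      by_contra h'
      have h3 : (j' < j ∨ j' = j ∧ q < p) ∨ (j = j' ∧ p = q) := by
        rcases lt_trichotomy p q with h4 | h4 | h4 <;> omega
      rcases h3 with h3 | ⟨rfl, rfl⟩
      · exact h.not_gt (mono j' hj' j hj q p hq hp h3)
      · exact lt_irrefl _ h
    · rw [un j' q hq, (cross j hj p q hp hq).2]
      simp [hq]
    · rw [un j p hp, (cross j' hj' q p hq hp).1]
      simp [hp]
    · rw [un j p hp, un j' q hq, hs.lt_iff_lt]
      simp [hp]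

/-- A local form of distality: the two formulas on the middle and a neighbouring tuple of a long
finite sequence agree. -/
def LocallyDistal (L : FirstOrder.Language.{u, v}) (M : Type*) [L.Structure M] : Prop :=
  ∀ (A : Set M) (V : Type) [Finite V] (φ : L.Formula (A ⊕ V)),
    ∃ N₀ : ℕ, ∀ N ≥ N₀, ∀ d : ℤ → V → M, IndiscernibleOn L ∅ (Set.Icc (-N : ℤ) N) d →
      IndiscernibleOn L A (Set.Icc (-N : ℤ) N \ {0}) d →
      (φ.Realize (Sum.elim (fun x : A => (x : M)) (d 0)) ↔
        φ.Realize (Sum.elim (fun x : A => (x : M)) (d 1)))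

/-- An index tuple through `c` is the middle member of a family as in `exists_block_family`. Tuples
of this family, each regarded as a single term, form a sequence to which local distality applies,
and this replaces the tuple by one avoiding `c`. Tuples avoiding `c` are compared by the hypothesis
on `A`. -/
theorem LocallyDistal.indiscernible (hM : LocallyDistal L M) {A : Set M} {n : ℕ} {I : Type*}
    [LinearOrder I] {c : I} {a : I → Fin n → M} (h₁ : (Set.Iio c).Infinite)
    (h₂ : (Set.Ioi c).Infinite) (h : Indiscernible L ∅ a)
    (hA : Indiscernible L A (fun i : {i : I // i ≠ c} => a i)) : Indiscernible L A a := by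
  intro k φ s t
  have avoid : ∀ s : Fin k ↪o I, ∃ s' : Fin k → I, StrictMono s' ∧ (∀ p, s' p ≠ c) ∧
      (φ.Realize (Sum.elim (fun x : A => (x : M)) fun p => a (s p.1) p.2) ↔
        φ.Realize (Sum.elim (fun x : A => (x : M)) fun p => a (s' p.1) p.2)) := by
    intro s
    by_cases hc : ∃ p, s p = c
    · obtain ⟨N₀, hN₀⟩ := hM A (Fin k × Fin n) φ
      -- The length is `N₀ + 1` rather than `N₀` so that the index `1` is in range even if `N₀ = 0`.
      obtain ⟨u, B, hu0, huc, hu⟩ := exists_block_family s.strictMono hc h₁ h₂ (N₀ + 1)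
      have h1 : (1 : ℤ) ∈ Set.Icc (-(N₀ + 1 : ℕ) : ℤ) (N₀ + 1 : ℕ) := by
        constructor <;> push_cast <;> omega
      have hpat : ∀ {m : ℕ} {f g : Fin m → ℤ}, StrictMono f → StrictMono g →
          (∀ i, f i ∈ Set.Icc (-(N₀ + 1 : ℕ) : ℤ) (N₀ + 1 : ℕ)) →
          (∀ i, g i ∈ Set.Icc (-(N₀ + 1 : ℕ) : ℤ) (N₀ + 1 : ℕ)) → ∀ x y : Fin m × Fin k,
          (u (f x.1) x.2 < u (f y.1) y.2 ↔ u (g x.1) x.2 < u (g y.1) y.2) := by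
        intro m f g hf hg hfJ hgJ x y
        rw [hu _ (hfJ _) _ (hfJ _), hu _ (hgJ _) _ (hgJ _), hf.lt_iff_lt, hg.lt_iff_lt,
          hf.injective.eq_iff, hg.injective.eq_iff]
      have h0 : ∀ j ∈ Set.Icc (-(N₀ + 1 : ℕ) : ℤ) (N₀ + 1 : ℕ), StrictMono (u j) := by
        intro j hj p q hpq
        rw [hu j hj j hj]
        by_cases hB : B p ∧ B q
        · exact Or.inl ⟨hB.1, hB.2, Or.inr ⟨rfl, hpq⟩⟩
        · exact Or.inr ⟨hB, hpq⟩
      refine ⟨u 1, h0 1 h1, huc 1 h1 one_ne_zero, ?_⟩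
      have key := hN₀ (N₀ + 1) (by omega) (fun j p => a (u j p.1) p.2) ?_ ?_
      · rw [hu0] at key
        exact key
      · intro m ψ f g hf hg hfJ hgJ
        have := h.realize_iff (fun x : Fin m × Fin k => u (f x.1) x.2)
          (fun x : Fin m × Fin k => u (g x.1) x.2) (hpat hf hg hfJ hgJ)
          (ψ.relabel (Sum.map id (Equiv.prodAssoc _ _ _).symm))
        rw [Formula.realize_relabel, Formula.realize_relabel] at this
        convert this using 2 <;>
        · funext x
          rcases x with x | ⟨x, y, z⟩ <;> rfl
      · intro m ψ f g hf hg hfJ hgJ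
        have := hA.realize_iff
          (fun x : Fin m × Fin k => (⟨u (f x.1) x.2, huc _ (hfJ _).1 (hfJ _).2 _⟩ : {i // i ≠ c}))
          (fun x : Fin m × Fin k => (⟨u (g x.1) x.2, huc _ (hgJ _).1 (hgJ _).2 _⟩ : {i // i ≠ c}))
          (hpat hf hg (fun i => (hfJ i).1) (fun i => (hgJ i).1))
          (ψ.relabel (Sum.map id (Equiv.prodAssoc _ _ _).symm))
        rw [Formula.realize_relabel, Formula.realize_relabel] at this
        convert this using 2 <;>
        · funext x
          rcases x with x | ⟨x, y, z⟩ <;> rfl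
    · push Not at hc
      exact ⟨s, s.strictMono, hc, Iff.rfl⟩
  obtain ⟨s', hs', hsc, es⟩ := avoid s
  obtain ⟨t', ht', htc, et⟩ := avoid t
  rw [es, et]
  exact hA.realize_iff (fun p => (⟨s' p, hsc p⟩ : {i // i ≠ c}))
    (fun p => (⟨t' p, htc p⟩ : {i // i ≠ c}))
    (fun x y => by simp only [Subtype.mk_lt_mk, hs'.lt_iff_lt, ht'.lt_iff_lt]) φ

theorem isDistal_of_locallyDistal {T : L.Theory}
    (h : ∀ (M : Type (max u v)) [L.Structure M] [Nonempty M] [M ⊨ T], LocallyDistal L M) :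
    IsDistal T :=
  fun M _ _ _ _ _ _ _ _ _ h₁ h₂ h₃ h₄ => (h M).indiscernible h₁ h₂ h₃ h₄

end LocalDistality

end Hamel

/-! ### Biordered spaces, and extension of partial embeddings in the preordered case -/

namespace Hamel

theorem exists_linearMap_extension {C G G' : Type*} [Field C]
    [AddCommGroup G] [Module C G] [AddCommGroup G'] [Module C G'] (V : Submodule C G) {b : G} (hb : b ∉ V) (g : G →ₗ[C] G')
    (b' : G') : ∃ g' : G →ₗ[C] G', (∀ x ∈ V, g' x = g x) ∧ g' b = b' := by
  obtain ⟨f, hf, hV⟩ := Submodule.exists_le_ker_of_notMem hb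
  refine ⟨g + ((f b)⁻¹ • f).smulRight (b' - g b), fun x hx => ?_, ?_⟩
  · have : f x = 0 := hV hx
    simp [this]
  · simp [hf]

/-- A vector space with two orderings, the second possibly only a preordering, given by their
positive elements, and a homogeneous map `val`. -/
structure BiorderedSpace (C : Type*) [Field C] [LinearOrder C] [IsStrictOrderedRing C]
    (G : Type*) [AddCommGroup G] [Module C G] where
  pos : Fin 2 → G → Prop
  val : G → G
  pos_neg : ∀ i x, pos i x → ¬ pos i (-x)
  pos_add : ∀ i x y, pos i x → pos i y → pos i (x + y)
  -- This makes `¬ pos i (x - y)` a total preorder; the elements `x` with neither `x` nor `-x`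
  -- positive form its kernel.
  not_pos_add : ∀ i x y, ¬ pos i x → ¬ pos i y → ¬ pos i (x + y)
  pos_smul : ∀ i (c : C) x, 0 < c → pos i x → pos i (c • x)
  pos_total : ∀ x, x ≠ 0 → pos 0 x ∨ pos 0 (-x)
  pos_nontrivial : ∀ i, ∃ x, pos i x
  val_zero : val 0 = 0
  val_smul : ∀ (c : C) x, c ≠ 0 → val (c • x) = val x

namespace BiorderedSpace

variable {C : Type*} [Field C] [LinearOrder C] [IsStrictOrderedRing C]
variable {G G' : Type*} [AddCommGroup G] [Module C G] [AddCommGroup G'] [Module C G']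
variable (K : BiorderedSpace C G) (K' : BiorderedSpace C G')

theorem not_pos_zero (i : Fin 2) : ¬ K.pos i 0 := fun h => by
  have := K.pos_neg i 0 h
  rw [neg_zero] at this
  exact this h

variable {K} in
theorem ne_zero_of_pos {i : Fin 2} {x : G} (h : K.pos i x) : x ≠ 0 := by
  rintro rfl
  exact K.not_pos_zero i h

theorem pos_smul_iff (i : Fin 2) {c : C} (hc : 0 < c) (x : G) : K.pos i (c • x) ↔ K.pos i x := by
  refine ⟨fun h => ?_, K.pos_smul i c x hc⟩
  have := K.pos_smul i c⁻¹ _ (inv_pos.2 hc) h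
  rwa [inv_smul_smul₀ hc.ne'] at this

theorem pos_smul_iff_of_neg (i : Fin 2) {c : C} (hc : c < 0) (x : G) :
    K.pos i (c • x) ↔ K.pos i (-x) := by
  rw [← K.pos_smul_iff i (neg_pos.2 hc) (-x), smul_neg, neg_smul, neg_neg]

theorem val_neg (x : G) : K.val (-x) = K.val x := by
  rw [← K.val_smul (-1) x (by simp), neg_smul, one_smul]

variable {K} in
theorem pos_trans {i : Fin 2} {x y z : G} (h : K.pos i (y - x)) (h' : K.pos i (z - y)) :
    K.pos i (z - x) := by
  have := K.pos_add i _ _ h h'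
  rwa [sub_add_sub_cancel'] at this

variable {K} in
theorem not_pos_trans {i : Fin 2} {x y z : G} (h : ¬ K.pos i (y - x)) (h' : ¬ K.pos i (z - y)) :
    ¬ K.pos i (z - x) := by
  have := K.not_pos_add i _ _ h h'
  rwa [sub_add_sub_cancel'] at this

variable {K} in
theorem pos_of_pos_of_not_pos {i : Fin 2} {x y z : G} (h : K.pos i (y - x))
    (h' : ¬ K.pos i (y - z)) : K.pos i (z - x) := by
  by_contra h''
  exact not_pos_trans h'' h' h

variable {K} in
theorem pos_of_not_pos_of_pos {i : Fin 2} {x y z : G} (h : ¬ K.pos i (x - y))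
    (h' : K.pos i (z - y)) : K.pos i (z - x) := by
  by_contra h''
  exact not_pos_trans h h'' h'

variable {K} in
theorem not_pos_swap {i : Fin 2} {x y : G} (h : K.pos i (y - x)) : ¬ K.pos i (x - y) := by
  have := K.pos_neg i _ h
  rwa [neg_sub] at this

theorem pos_sub_total {x y : G} (h : x ≠ y) : K.pos 0 (y - x) ∨ K.pos 0 (x - y) := by
  have := K.pos_total (y - x) (sub_ne_zero.2 h.symm)
  rwa [neg_sub] at this

theorem eq_of_not_pos {x y : G} (h : ¬ K.pos 0 (y - x)) (h' : ¬ K.pos 0 (x - y)) : x = y := by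
  by_contra hne
  exact (K.pos_sub_total hne).elim h h'

theorem exists_max (i : Fin 2) {S : Finset G} (hS : S.Nonempty) :
    ∃ m ∈ S, ∀ x ∈ S, ¬ K.pos i (x - m) := by
  induction hS using Finset.Nonempty.cons_induction with
  | singleton a => exact ⟨a, by simp, fun x hx => by
      rw [Finset.mem_singleton.1 hx, sub_self]
      exact K.not_pos_zero i⟩
  | cons a s ha hs ih =>
    obtain ⟨m, hm, h⟩ := ih
    by_cases h1 : K.pos i (a - m)
    · refine ⟨a, by simp, fun x hx => ?_⟩
      rcases Finset.mem_cons.1 hx with rfl | hx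
      · rw [sub_self]
        exact K.not_pos_zero i
      · exact not_pos_trans (not_pos_swap h1) (h x hx)
    · refine ⟨m, by simp [hm], fun x hx => ?_⟩
      rcases Finset.mem_cons.1 hx with rfl | hx
      · exact h1
      · exact h x hx

theorem exists_min (i : Fin 2) {S : Finset G} (hS : S.Nonempty) :
    ∃ m ∈ S, ∀ x ∈ S, ¬ K.pos i (m - x) := by
  classical
  obtain ⟨m, hm, h⟩ := K.exists_max i (hS.image (- ·))
  obtain ⟨m', hm', rfl⟩ := Finset.mem_image.1 hm
  refine ⟨m', hm', fun x hx => ?_⟩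
  have := h (-x) (Finset.mem_image_of_mem _ hx)
  rwa [neg_sub_neg] at this

/-- A finite cut contains an interval. -/
theorem exists_interval (i : Fin 2) (S U : Finset G) (h : ∀ s ∈ S, ∀ u ∈ U, K.pos i (u - s)) :
    ∃ a b, K.pos i (b - a) ∧ (∀ s ∈ S, ¬ K.pos i (s - a)) ∧ ∀ u ∈ U, ¬ K.pos i (b - u) := by
  obtain ⟨e, he⟩ := K.pos_nontrivial i
  rcases S.eq_empty_or_nonempty with rfl | hS <;> rcases U.eq_empty_or_nonempty with rfl | hU
  · exact ⟨0, e, by simpa using he, by simp, by simp⟩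
  · obtain ⟨u, _, hu⟩ := K.exists_min i hU
    exact ⟨u - e, u, by simpa using he, by simp, hu⟩
  · obtain ⟨s, _, hs⟩ := K.exists_max i hS
    exact ⟨s, s + e, by simpa using he, hs, by simp⟩
  · obtain ⟨s, hs', hs⟩ := K.exists_max i hS
    obtain ⟨u, hu', hu⟩ := K.exists_min i hU
    exact ⟨s, u, h s hs' u hu', hs, hu⟩

theorem exists_between_finsets (i : Fin 2) {D : Set G}
    (hD : ∀ a b, K.pos i (b - a) → ∃ z ∈ D, K.pos i (z - a) ∧ K.pos i (b - z))
    (S U : Finset G) (h : ∀ s ∈ S, ∀ u ∈ U, K.pos i (u - s)) :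
    ∃ z ∈ D, (∀ s ∈ S, K.pos i (z - s)) ∧ ∀ u ∈ U, K.pos i (u - z) := by
  obtain ⟨a, b, hab, h1, h2⟩ := K.exists_interval i S U h
  obtain ⟨z, hz, h3, h4⟩ := hD a b hab
  exact ⟨z, hz, fun s hs => pos_of_not_pos_of_pos (h1 s hs) h3,
    fun u hu => pos_of_pos_of_not_pos h4 (h2 u hu)⟩

theorem exists_midpoint (i : Fin 2) (a b : G) (h : K.pos i (b - a)) :
    ∃ z ∈ Set.univ, K.pos i (z - a) ∧ K.pos i (b - z) := by
  have h2 : (0 : C) < 2⁻¹ := by positivity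
  have h3 := K.pos_smul i _ _ h2 h
  refine ⟨a + (2⁻¹ : C) • (b - a), trivial, by simpa using h3, ?_⟩
  convert h3 using 1
  have : b - a = (2⁻¹ : C) • (b - a) + (2⁻¹ : C) • (b - a) := by
    rw [← add_smul]
    norm_num
  calc b - (a + (2⁻¹ : C) • (b - a)) = (b - a) - (2⁻¹ : C) • (b - a) := by abel
    _ = _ := by nth_rewrite 1 [this]; abel

/-- The map `g` respects the signs and the value of `x`. -/
def Respects (g : G →ₗ[C] G') (x : G) : Prop :=
  (∀ i, (K'.pos i (g x) ↔ K.pos i x) ∧ (K'.pos i (-g x) ↔ K.pos i (-x))) ∧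
    K'.val (g x) = g (K.val x)

variable {K K'}

theorem Respects.map_eq_zero_iff {g : G →ₗ[C] G'} {x : G} (h : Respects K K' g x) :
    g x = 0 ↔ x = 0 := by
  refine ⟨fun h0 => ?_, fun h0 => by rw [h0, map_zero]⟩
  by_contra hx
  rcases K.pos_total x hx with h1 | h1
  · exact K'.not_pos_zero 0 (h0 ▸ (h.1 0).1.2 h1)
  · have := (h.1 0).2.2 h1
    rw [h0, neg_zero] at this
    exact K'.not_pos_zero 0 this

theorem Respects.smul {g : G →ₗ[C] G'} {x : G} (h : Respects K K' g x) {c : C} (hc : c ≠ 0) :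
    Respects K K' g (c • x) := by
  refine ⟨fun i => ?_, by rw [map_smul, K.val_smul c x hc, K'.val_smul c _ hc, h.2]⟩
  rw [map_smul, ← smul_neg, ← smul_neg]
  rcases lt_or_gt_of_ne hc with hc | hc
  · simp only [pos_smul_iff_of_neg _ i hc, neg_neg]
    exact (h.1 i).symm
  · simp only [pos_smul_iff _ i hc]
    exact h.1 i

theorem Respects.congr {g g' : G →ₗ[C] G'} {x : G} (h : Respects K K' g x) (h₁ : g' x = g x)
    (h₂ : g' (K.val x) = g (K.val x)) : Respects K K' g' x := by
  rw [Respects, h₁, h₂]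
  exact h

/-- Extension of a linear map to one more element `b`, respecting a finite set `F`. -/
theorem exists_extension_step {A V : Submodule C G} (hAV : A ≤ V) (hV : ∀ x ∈ V, K.val x ∈ V)
    {g₀ : G →ₗ[C] G'}
    (hP : ∀ F : Finset G, (∀ x ∈ F, x ∈ V) →
      ∃ g : G →ₗ[C] G', (∀ x ∈ A, g x = g₀ x) ∧ ∀ x ∈ F, Respects K K' g x)
    {b : G} (hb : b ∉ V) (F : Finset G) (hF : ∀ x ∈ F, x ∈ V ⊔ Submodule.span C {b})
    (key : ∀ E : Finset G, (∀ a ∈ E, a ∈ V ∧ ∃ c : C, c ≠ 0 ∧ c • (b - a) ∈ F) →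
      ∃ F' : Finset G, (∀ x ∈ F', x ∈ V) ∧ ∀ g : G →ₗ[C] G', (∀ x ∈ F', Respects K K' g x) →
        ∃ b', ∀ g' : G →ₗ[C] G', (∀ x ∈ V, g' x = g x) → g' b = b' →
          ∀ a ∈ E, Respects K K' g' (b - a)) :
    ∃ g : G →ₗ[C] G', (∀ x ∈ A, g x = g₀ x) ∧ ∀ x ∈ F, Respects K K' g x := by
  classical
  -- Outside `V`, an element of `V + C b` is a nonzero multiple of some `b - a`. Since `Respects` is
  -- invariant under nonzero scalars, only the differences `b - a` need attention.
  have h1 : ∀ x ∈ F, x ∈ V ∨ ∃ a ∈ V, ∃ c : C, c ≠ 0 ∧ x = c • (b - a) := by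
    intro x hx
    obtain ⟨y, hy, z, hz, rfl⟩ := Submodule.mem_sup.1 (hF x hx)
    obtain ⟨c, rfl⟩ := Submodule.mem_span_singleton.1 hz
    by_cases hc : c = 0
    · left
      simpa [hc] using hy
    · refine Or.inr ⟨-(c⁻¹ • y), V.neg_mem (V.smul_mem _ hy), c, hc, ?_⟩
      rw [sub_neg_eq_add, smul_add, smul_inv_smul₀ hc, add_comm]
  let E' : G → G := fun x => if h : ∃ a ∈ V, ∃ c : C, c ≠ 0 ∧ x = c • (b - a) then h.choose else 0
  have hE' : ∀ x ∈ F, x ∉ V → E' x ∈ V ∧ ∃ c : C, c ≠ 0 ∧ x = c • (b - E' x) := by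
    intro x hx hxV
    have h := (h1 x hx).resolve_left hxV
    simp only [E', h, dite_true]
    exact h.choose_spec
  obtain ⟨F', hF'V, hF'⟩ := key ((F.filter (· ∉ V)).image E') (by
    intro a ha
    obtain ⟨x, hx, rfl⟩ := Finset.mem_image.1 ha
    rw [Finset.mem_filter] at hx
    obtain ⟨h2, c, hc, h3⟩ := hE' x hx.1 hx.2
    exact ⟨h2, c, hc, h3 ▸ hx.1⟩)
  -- The map on `V` is available only for one finite set at a time. It is therefore chosen after
  -- `F'` is known, and must respect `F'` together with the part of `F` inside `V`.
  obtain ⟨g, hgA, hg⟩ := hP (F' ∪ F.filter (· ∈ V)) (by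
    intro x hx
    rcases Finset.mem_union.1 hx with hx | hx
    · exact hF'V x hx
    · exact (Finset.mem_filter.1 hx).2)
  obtain ⟨b', hb'⟩ := hF' g fun x hx => hg x (Finset.mem_union_left _ hx)
  obtain ⟨g', hg'V, hg'b⟩ := exists_linearMap_extension V hb g b'
  refine ⟨g', fun x hx => by rw [hg'V x (hAV hx), hgA x hx], fun x hx => ?_⟩
  by_cases hxV : x ∈ V
  · exact (hg x (Finset.mem_union_right _ (Finset.mem_filter.2 ⟨hx, hxV⟩))).congr
      (hg'V x hxV) (hg'V _ (hV x hxV))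
  · obtain ⟨h2, c, hc, h3⟩ := hE' x hx hxV
    rw [h3]
    exact (hb' g' hg'V hg'b _ (Finset.mem_image_of_mem _ (Finset.mem_filter.2 ⟨hx, hxV⟩))).smul hc

variable (K K') in
/-- Partial embeddings of `K` into `K'` extend to one more element, up to finite approximation. -/
def HasExtension : Prop :=
  ∀ (A : Submodule C G) (g₀ : G →ₗ[C] G') (b : G) (F : Finset G), (∀ x ∈ A, K.val x ∈ A) →
    (∀ x ∈ A, Respects K K' g₀ x) →
    (∀ x ∈ F, x ∈ A ⊔ Submodule.span C (K.val '' F) ⊔ Submodule.span C {b}) →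
    ∃ g : G →ₗ[C] G', (∀ x ∈ A, g x = g₀ x) ∧ ∀ x ∈ F, Respects K K' g x

variable (K) in
/-- The auxiliary preordering has a dense kernel and `val` is trivial. -/
structure IsPreordered : Prop where
  val_eq : ∀ x, K.val x = 0
  dense : ∀ a b, K.pos 0 (b - a) →
    ∃ z, (¬ K.pos 1 z ∧ ¬ K.pos 1 (-z)) ∧ K.pos 0 (z - a) ∧ K.pos 0 (b - z)

theorem Respects.of_sub {g' : G →ₗ[C] G'} {b a : G} {b' a' : G'} (hb : g' b = b') (ha : g' a = a')
    (h : ∀ i, (K'.pos i (b' - a') ↔ K.pos i (b - a)) ∧ (K'.pos i (a' - b') ↔ K.pos i (a - b)))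
    (hv : K'.val (b' - a') = g' (K.val (b - a))) : Respects K K' g' (b - a) := by
  refine ⟨fun i => ?_, by rw [map_sub, hb, ha, hv]⟩
  rw [map_sub, hb, ha, neg_sub, neg_sub]
  exact h i

/-- If `b'` lies on the correct side of finitely many points then it has the correct signs. -/
theorem sign_iff_of_side {b a : G} {b' a' : G'} {i : Fin 2}
    (h₁ : K.pos i (b - a) → K'.pos i (b' - a')) (h₂ : K.pos i (a - b) → K'.pos i (a' - b'))
    (h₃ : K.pos i (b - a) ∨ K.pos i (a - b)) :
    (K'.pos i (b' - a') ↔ K.pos i (b - a)) ∧ (K'.pos i (a' - b') ↔ K.pos i (a - b)) := by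
  rcases h₃ with h | h
  · exact ⟨iff_of_true (h₁ h) h, iff_of_false (not_pos_swap (h₁ h)) (not_pos_swap h)⟩
  · exact ⟨iff_of_false (not_pos_swap (h₂ h)) (not_pos_swap h), iff_of_true (h₂ h) h⟩

theorem Respects.sub_iff {g : G →ₗ[C] G'} {a b : G} (h : Respects K K' g (b - a)) (i : Fin 2) :
    (K'.pos i (g b - g a) ↔ K.pos i (b - a)) ∧ (K'.pos i (g a - g b) ↔ K.pos i (a - b)) := by
  have := h.1 i
  rwa [map_sub, neg_sub, neg_sub] at this

-- The image of `b` must realize a finite cut for each of the two relations. The cut for the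
-- preorder is realized first, by some `p`. The coset of `p` modulo the kernel consists of equally
-- good points and is dense for `<₀`, so the other cut can be realized within it.
open Pointwise in
theorem IsPreordered.hasExtension (hK : K.IsPreordered) (hK' : K'.IsPreordered) :
    HasExtension K K' := by
  classical
  intro A g₀ b F hA hg₀ hF
  have hF' : ∀ x ∈ F, x ∈ A ⊔ Submodule.span C {b} := by
    intro x hx
    have h1 : Submodule.span C (K.val '' F) = ⊥ := by
      rw [Submodule.span_eq_bot]
      rintro _ ⟨y, -, rfl⟩
      exact hK.val_eq y
    have := hF x hx
    rwa [h1, sup_bot_eq] at this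
  by_cases hb : b ∈ A
  · refine ⟨g₀, fun _ _ => rfl, fun x hx => hg₀ x ?_⟩
    have := hF' x hx
    rwa [sup_eq_left.2 (by simpa using hb)] at this
  refine exists_extension_step le_rfl hA (fun F h => ⟨g₀, fun _ _ => rfl, fun x hx => hg₀ x (h x hx)⟩)
    hb F hF' ?_
  intro E hE
  refine ⟨E - E, fun x hx => ?_, fun g hg => ?_⟩
  · obtain ⟨e, he, e', he', rfl⟩ := Finset.mem_sub.1 hx
    exact A.sub_mem (hE e he).1 (hE e' he').1
  have hg : ∀ e ∈ E, ∀ e' ∈ E, Respects K K' g (e - e') := fun e he e' he' =>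
    hg _ (Finset.sub_mem_sub he he')
  have cut : ∀ i : Fin 2, ∀ s ∈ (E.filter fun a => K.pos i (b - a)).image g,
      ∀ u ∈ (E.filter fun a => K.pos i (a - b)).image g, K'.pos i (u - s) := by
    intro i s hs u hu
    obtain ⟨s, hs', rfl⟩ := Finset.mem_image.1 hs
    obtain ⟨u, hu', rfl⟩ := Finset.mem_image.1 hu
    replace hs := Finset.mem_filter.1 hs'
    replace hu := Finset.mem_filter.1 hu'
    exact ((hg u hu.1 s hs.1).sub_iff i).1.2 (pos_trans hs.2 hu.2)
  -- If `b` is equivalent to some `e ∈ E` for the preorder, then `g e` will do; otherwise all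
  -- comparisons are strict and a point between finite sets is needed.
  obtain ⟨p, hp⟩ : ∃ p : G', ∀ a ∈ E, (K'.pos 1 (p - g a) ↔ K.pos 1 (b - a)) ∧
      (K'.pos 1 (g a - p) ↔ K.pos 1 (a - b)) := by
    by_cases h : ∃ e ∈ E, ¬ K.pos 1 (b - e) ∧ ¬ K.pos 1 (e - b)
    · obtain ⟨e, he, h1, h2⟩ := h
      refine ⟨g e, fun a ha => ?_⟩
      rw [((hg e he a ha).sub_iff 1).1, ((hg e he a ha).sub_iff 1).2]
      exact ⟨⟨fun h => pos_of_pos_of_not_pos h h2, fun h => pos_of_pos_of_not_pos h h1⟩,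
        ⟨fun h => pos_of_not_pos_of_pos h1 h, fun h => pos_of_not_pos_of_pos h2 h⟩⟩
    · push Not at h
      obtain ⟨p, -, h1, h2⟩ := K'.exists_between_finsets 1 (K'.exists_midpoint 1) _ _ (cut 1)
      refine ⟨p, fun a ha => sign_iff_of_side (fun h' => ?_) (fun h' => ?_) ?_⟩
      · exact h1 _ (Finset.mem_image_of_mem _ (Finset.mem_filter.2 ⟨ha, h'⟩))
      · exact h2 _ (Finset.mem_image_of_mem _ (Finset.mem_filter.2 ⟨ha, h'⟩))
      · by_cases h' : K.pos 1 (b - a)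
        · exact Or.inl h'
        · exact Or.inr (h a ha h')
  obtain ⟨b', hb', h1, h2⟩ := K'.exists_between_finsets 0
    (D := {z | ¬ K'.pos 1 (z - p) ∧ ¬ K'.pos 1 (p - z)}) (by
      intro x y hxy
      obtain ⟨z, hz, h1, h2⟩ := hK'.dense (x - p) (y - p) (by simpa using hxy)
      refine ⟨z + p, by simpa [sub_add_cancel_right] using hz, ?_, ?_⟩
      · rwa [add_sub_assoc, ← neg_sub x p, ← sub_eq_add_neg]
      · rwa [add_comm, ← sub_sub]) _ _ (cut 0)
  refine ⟨b', fun g' hg'A hg'b a ha => Respects.of_sub hg'b (hg'A a (hE a ha).1) (fun i => ?_) ?_⟩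
  · fin_cases i
    · refine sign_iff_of_side (fun h' => ?_) (fun h' => ?_) (K.pos_sub_total ?_)
      · exact h1 _ (Finset.mem_image_of_mem _ (Finset.mem_filter.2 ⟨ha, h'⟩))
      · exact h2 _ (Finset.mem_image_of_mem _ (Finset.mem_filter.2 ⟨ha, h'⟩))
      · rintro rfl
        exact hb (hE _ ha).1
    · have h3 := hp a ha
      refine ⟨Iff.trans ?_ h3.1, Iff.trans ?_ h3.2⟩
      · exact ⟨fun h => pos_of_pos_of_not_pos h hb'.1, fun h => pos_of_pos_of_not_pos h hb'.2⟩
      · exact ⟨fun h => pos_of_not_pos_of_pos hb'.2 h, fun h => pos_of_not_pos_of_pos hb'.1 h⟩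
  · rw [hK'.val_eq, hK.val_eq, map_zero]

end BiorderedSpace

end Hamel

/-! ### Extension of partial embeddings between Hamel spaces -/

namespace Hamel

namespace BiorderedSpace

variable {C : Type*} [Field C] [LinearOrder C] [IsStrictOrderedRing C]
variable {G G' : Type*} [AddCommGroup G] [Module C G] [AddCommGroup G'] [Module C G']
variable {K : BiorderedSpace C G} {K' : BiorderedSpace C G'}

variable (K) in
/-- The axioms of independent, dense Hamel spaces, with `val 0 = 0` in place of `∞`. -/
structure IsHamel : Prop where
  total : ∀ x, x ≠ 0 → K.pos 1 x ∨ K.pos 1 (-x)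
  val_pos : ∀ x, x ≠ 0 → K.pos 1 (K.val x)
  val_val : ∀ x, K.val (K.val x) = K.val x
  val_add : ∀ x y, x ≠ 0 → y ≠ 0 → x + y ≠ 0 →
    ¬ K.pos 0 (K.val x - K.val (x + y)) ∨ ¬ K.pos 0 (K.val y - K.val (x + y))
  convex : ∀ x y, K.pos 1 x → K.pos 1 (y - x) → ¬ K.pos 0 (K.val y - K.val x)
  independent : ∀ a₀ b₀ a₁ b₁, K.pos 0 (b₀ - a₀) → K.pos 1 (b₁ - a₁) →
    ∃ z, (K.pos 0 (z - a₀) ∧ K.pos 0 (b₀ - z)) ∧ K.pos 1 (z - a₁) ∧ K.pos 1 (b₁ - z)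
  dense : ∀ a b, K.pos 0 (b - a) → ∃ c, c ≠ 0 ∧ K.pos 0 (K.val c - a) ∧ K.pos 0 (b - K.val c)

variable (K) in
/-- `x` is nonzero and has smaller value than `y`, where the value of `0` is infinite. -/
def Dominates (x y : G) : Prop := x ≠ 0 ∧ (y = 0 ∨ K.pos 0 (K.val y - K.val x))

variable (K) in
/-- The value of `x` is at least `h`, where the value of `0` is infinite. -/
def AtLeast (h x : G) : Prop := x = 0 ∨ ¬ K.pos 0 (h - K.val x)

theorem AtLeast.neg {h x : G} (hx : K.AtLeast h x) : K.AtLeast h (-x) := by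
  rw [AtLeast, neg_eq_zero, K.val_neg]
  exact hx

theorem Dominates.neg {x y : G} (h : K.Dominates x y) : K.Dominates (-x) (-y) := by
  rw [Dominates, neg_eq_zero, K.val_neg, K.val_neg, Ne, neg_eq_zero]
  exact h

/-- The value of a nonzero `y ∈ V` lies in `V` and hence differs from `h`, the value of `c • h`. So
one of the two strictly dominates. -/
theorem dominates_or_dominates_smul {V : Submodule C G} (hV : ∀ x ∈ V, K.val x ∈ V) {h : G} (hh : K.val h = h)
    (hhV : h ∉ V) {y : G} (hy : y ∈ V) {c : C} (hc : c ≠ 0) :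
    (K.Dominates y (c • h) ∨ K.Dominates (c • h) y) := by
  have hh0 : h ≠ 0 := fun h0 => hhV (h0 ▸ V.zero_mem)
  have hch : c • h ≠ 0 := smul_ne_zero hc hh0
  by_cases hy0 : y = 0
  · exact Or.inr ⟨hch, Or.inl hy0⟩
  have hne : K.val y ≠ h := fun h0 => hhV (h0 ▸ hV y hy)
  rcases K.pos_sub_total hne with h1 | h1
  · exact Or.inl ⟨hy0, Or.inr (by rwa [K.val_smul _ _ hc, hh])⟩
  · exact Or.inr ⟨hch, Or.inr (by rwa [K.val_smul _ _ hc, hh])⟩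

namespace IsHamel

variable (hK : K.IsHamel) (hK' : K'.IsHamel)
include hK

theorem atLeast_add {h x y : G} (hx : K.AtLeast h x) (hy : K.AtLeast h y) :
    K.AtLeast h (x + y) := by
  rcases hx with rfl | hx
  · rwa [zero_add]
  rcases hy with rfl | hy
  · rw [add_zero]
    exact Or.inr hx
  by_cases hxy : x + y = 0
  · exact Or.inl hxy
  by_cases hx0 : x = 0
  · subst hx0
    rw [zero_add]
    exact Or.inr hy
  by_cases hy0 : y = 0
  · subst hy0
    rw [add_zero]
    exact Or.inr hx
  right
  rcases hK.val_add x y hx0 hy0 hxy with h1 | h1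
  · exact not_pos_trans h1 hx
  · exact not_pos_trans h1 hy

theorem val_add_of_dominates {x y : G} (h : K.Dominates x y) : K.val (x + y) = K.val x := by
  obtain ⟨hx, rfl | h⟩ := h
  · rw [add_zero]
  by_cases hy : y = 0
  · rw [hy, add_zero]
  have hxy : x + y ≠ 0 := fun h0 => by
    rw [eq_neg_of_add_eq_zero_right h0, K.val_neg, sub_self] at h
    exact K.not_pos_zero 0 h
  have h1 : ¬ K.pos 0 (K.val x - K.val (x + y)) := by
    rcases hK.val_add x y hx hy hxy with h1 | h1
    · exact h1
    · exact fun h2 => h1 (pos_trans h2 h)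
  refine K.eq_of_not_pos h1 ?_
  -- The other inequality comes from the ultrametric inequality for `x = (x + y) + (-y)`.
  have := hK.val_add (x + y) (-y) hxy (neg_ne_zero.2 hy) (by simpa using hx)
  rw [add_neg_cancel_right, K.val_neg] at this
  exact this.resolve_right (not_not.2 h)

/-- If `x` is positive and `x + y` is not, then `-y` is at least `x` for `<₁`, and convexity gives
`-y` a value at most that of `x`, contrary to domination. -/
theorem pos_add_of_dominates {x y : G} (h : K.Dominates x y) :
    K.pos 1 (x + y) ↔ K.pos 1 x := by
  have key : ∀ {x y : G}, K.Dominates x y → K.pos 1 x → K.pos 1 (x + y) := by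
    intro x y h hx
    by_contra hxy
    obtain ⟨-, rfl | h⟩ := h
    · exact hxy (by rwa [add_zero])
    by_cases h0 : x + y = 0
    · rw [eq_neg_of_add_eq_zero_right h0, K.val_neg, sub_self] at h
      exact K.not_pos_zero 0 h
    have h1 := (hK.total _ h0).resolve_left hxy
    have h2 := hK.convex x (-y) hx (by rwa [← neg_add', add_comm])
    rw [K.val_neg] at h2
    exact h2 h
  refine ⟨fun hxy => ?_, key h⟩
  by_contra hx
  have h1 := (hK.total _ h.1).resolve_left hx
  have := key h.neg h1
  rw [← neg_add] at this
  exact K.pos_neg 1 _ hxy this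

theorem pos_neg_add_of_dominates {x y : G} (h : K.Dominates x y) :
    K.pos 1 (-(x + y)) ↔ K.pos 1 (-x) := by
  rw [neg_add]
  exact hK.pos_add_of_dominates h.neg

theorem val_ne_zero {x : G} (hx : x ≠ 0) : K.val x ≠ 0 := ne_zero_of_pos (hK.val_pos x hx)

/-- Adjoining a value `h` creates no value besides `h`: a sum `y + c • h` has the value of its
dominant summand. -/
theorem val_closed_sup {V : Submodule C G} (hV : ∀ x ∈ V, K.val x ∈ V) {h : G}
    (hh : K.val h = h) : ∀ x ∈ V ⊔ Submodule.span C {h}, K.val x ∈ V ⊔ Submodule.span C {h} := by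
  intro x hx
  by_cases hhV : h ∈ V
  · rw [sup_eq_left.2 (by simpa using hhV)] at hx ⊢
    exact hV x hx
  obtain ⟨y, hy, z, hz, rfl⟩ := Submodule.mem_sup.1 hx
  obtain ⟨c, rfl⟩ := Submodule.mem_span_singleton.1 hz
  by_cases hc : c = 0
  · rw [hc, zero_smul, add_zero]
    exact Submodule.mem_sup_left (hV y hy)
  rcases dominates_or_dominates_smul hV hh hhV hy hc with h1 | h1
  · rw [hK.val_add_of_dominates h1]
    exact Submodule.mem_sup_left (hV y hy)
  · rw [add_comm, hK.val_add_of_dominates h1, K.val_smul _ _ hc, hh]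
    exact Submodule.mem_sup_right (Submodule.mem_span_singleton_self h)

include hK' in
open Pointwise in
/-- Extension by a new value. -/
theorem exists_extension_value {A V : Submodule C G} (hAV : A ≤ V) (hV : ∀ x ∈ V, K.val x ∈ V)
    {g₀ : G →ₗ[C] G'}
    (hP : ∀ F : Finset G, (∀ x ∈ F, x ∈ V) →
      ∃ g : G →ₗ[C] G', (∀ x ∈ A, g x = g₀ x) ∧ ∀ x ∈ F, Respects K K' g x)
    {h : G} (hh : K.val h = h) (hhV : h ∉ V) (F : Finset G)
    (hF : ∀ x ∈ F, x ∈ V ⊔ Submodule.span C {h}) :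
    ∃ g : G →ₗ[C] G', (∀ x ∈ A, g x = g₀ x) ∧ ∀ x ∈ F, Respects K K' g x := by
  classical
  refine exists_extension_step hAV hV hP hhV F hF fun E hE => ?_
  have hh0 : h ≠ 0 := fun h0 => hhV (h0 ▸ V.zero_mem)
  -- The values are included because the comparison of `val a` with `h` decides which of `a` and
  -- `-h` dominates.
  set E' := E ∪ E.image K.val with hE'
  have hE'V : ∀ e ∈ E', e ∈ V := by
    intro e he
    rcases Finset.mem_union.1 he with he | he
    · exact (hE e he).1
    · obtain ⟨e', he', rfl⟩ := Finset.mem_image.1 he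
      exact hV _ (hE e' he').1
  refine ⟨(E' - E') ∪ E, fun x hx => ?_, fun g hg => ?_⟩
  · rcases Finset.mem_union.1 hx with hx | hx
    · obtain ⟨e, he, e', he', rfl⟩ := Finset.mem_sub.1 hx
      exact V.sub_mem (hE'V e he) (hE'V e' he')
    · exact (hE x hx).1
  have hgE : ∀ e ∈ E, Respects K K' g e := fun e he => hg _ (Finset.mem_union_right _ he)
  replace hg : ∀ e ∈ E', ∀ e' ∈ E', Respects K K' g (e - e') := fun e he e' he' =>
    hg _ (Finset.mem_union_left _ (Finset.sub_mem_sub he he'))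
  -- The image `h'` of `h` must be a value itself. Values are dense for `<₀`, so one of them lies in
  -- the cut of `h` over the image of `E'`.
  obtain ⟨_, ⟨c, hc, rfl⟩, h1, h2⟩ := K'.exists_between_finsets 0
    (D := {z | ∃ c, c ≠ 0 ∧ z = K'.val c}) (by
      intro a b hab
      obtain ⟨c, hc, h1, h2⟩ := hK'.dense a b hab
      exact ⟨_, ⟨c, hc, rfl⟩, h1, h2⟩)
    ((E'.filter fun a => K.pos 0 (h - a)).image g)
    ((E'.filter fun a => K.pos 0 (a - h)).image g) (by
      intro s hs u hu
      obtain ⟨s, hs', rfl⟩ := Finset.mem_image.1 hs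
      obtain ⟨u, hu', rfl⟩ := Finset.mem_image.1 hu
      replace hs := Finset.mem_filter.1 hs'
      replace hu := Finset.mem_filter.1 hu'
      exact ((hg u hu.1 s hs.1).sub_iff 0).1.2 (pos_trans hs.2 hu.2))
  set h' := K'.val c with hh'
  have hh'0 : h' ≠ 0 := hK'.val_ne_zero hc
  have hh'' : K'.val h' = h' := hK'.val_val c
  have side : ∀ e ∈ E', (K'.pos 0 (h' - g e) ↔ K.pos 0 (h - e)) ∧
      (K'.pos 0 (g e - h') ↔ K.pos 0 (e - h)) := by
    intro a ha
    refine sign_iff_of_side (fun h' => ?_) (fun h' => ?_) (K.pos_sub_total ?_)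
    · exact h1 _ (Finset.mem_image_of_mem _ (Finset.mem_filter.2 ⟨ha, h'⟩))
    · exact h2 _ (Finset.mem_image_of_mem _ (Finset.mem_filter.2 ⟨ha, h'⟩))
    · rintro rfl
      exact hhV (hE'V _ ha)
  refine ⟨h', fun g' hg'V hg'h a ha => ?_⟩
  have haV := (hE a ha).1
  have ha' : a ∈ E' := Finset.mem_union_left _ ha
  have hva : K.val a ∈ E' := Finset.mem_union_right _ (Finset.mem_image_of_mem _ ha)
  have hra := hgE a ha
  have hdom := dominates_or_dominates_smul hV hh hhV haV (neg_ne_zero.2 one_ne_zero : (-1 : C) ≠ 0)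
  rw [neg_smul, one_smul] at hdom
  have hpos : K.pos 1 h := hh ▸ hK.val_pos h hh0
  have hpos' : K'.pos 1 h' := hh'' ▸ hK'.val_pos h' hh'0
  -- The same summand dominates on both sides. If it is `a`, signs and values are respected because
  -- `g` respects `a`; if it is `-h`, then `h` and `h'` are both positive for `<₁` and are their own
  -- values.
  have sgn : ((K'.pos 1 (-(g a + -h')) ↔ K.pos 1 (-(a + -h))) ∧
      (K'.pos 1 (g a + -h') ↔ K.pos 1 (a + -h))) ∧
      K'.val (g a + -h') = g' (K.val (a + -h)) := by
    rcases hdom with hd | hd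
    · have hd' : K'.Dominates (g a) (-h') := by
        refine ⟨fun h0 => hd.1 (hra.map_eq_zero_iff.1 h0), Or.inr ?_⟩
        rw [K'.val_neg, hh'', hra.2, (side _ hva).1]
        have := hd.2.resolve_left (neg_ne_zero.2 hh0)
        rwa [K.val_neg, hh] at this
      rw [hK.pos_add_of_dominates hd, hK.pos_neg_add_of_dominates hd, hK.val_add_of_dominates hd,
        hK'.pos_add_of_dominates hd', hK'.pos_neg_add_of_dominates hd',
        hK'.val_add_of_dominates hd', hg'V _ (hV a haV)]
      exact ⟨(hra.1 1).symm, hra.2⟩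
    · have hd' : K'.Dominates (-h') (g a) := by
        refine ⟨neg_ne_zero.2 hh'0, ?_⟩
        rcases hd.2 with h0 | h0
        · exact Or.inl (hra.map_eq_zero_iff.2 h0)
        · right
          rw [K.val_neg, hh] at h0
          rwa [K'.val_neg, hh'', hra.2, (side _ hva).2]
      rw [add_comm a, add_comm (g a), hK.pos_add_of_dominates hd, hK.pos_neg_add_of_dominates hd,
        hK.val_add_of_dominates hd, hK'.pos_add_of_dominates hd',
        hK'.pos_neg_add_of_dominates hd', hK'.val_add_of_dominates hd', K.val_neg, hh, K'.val_neg,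
        hh'', hg'h, neg_neg, neg_neg]
      exact ⟨⟨iff_of_true hpos' hpos, iff_of_false (K'.pos_neg 1 _ hpos') (K.pos_neg 1 _ hpos)⟩, rfl⟩
  refine Respects.of_sub hg'h (hg'V a haV) (fun i => ?_) ?_
  · fin_cases i
    · exact side a ha'
    · have := sgn.1
      simp only [← sub_eq_add_neg, neg_sub] at this
      exact this
  · have := sgn.2
    rwa [← sub_eq_add_neg, ← sub_eq_add_neg, ← neg_sub, K'.val_neg, ← neg_sub h a, K.val_neg] at this

/-- If all values of `b - a`, for `a` in a finite subset `E` of a subspace `V`, lie in `V`, then `b`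
can be approximated by a point of `V`, as seen from `E`. -/
theorem exists_center {V : Submodule C G} {b : G} (hb : b ∉ V)
    {E : Finset G} (hE0 : E.Nonempty) (hE : ∀ a ∈ E, a ∈ V) (hEb : ∀ a ∈ E, K.val (b - a) ∈ V) :
    ∃ p ∈ V, ∀ a ∈ E, K.val (p - a) = K.val (b - a) ∧
      (K.pos 1 (p - a) ↔ K.pos 1 (b - a)) ∧ (K.pos 1 (a - p) ↔ K.pos 1 (a - b)) := by
  classical
  have hne : ∀ a ∈ E, b - a ≠ 0 := fun a ha h0 => hb (by rw [sub_eq_zero.1 h0]; exact hE a ha)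
  -- The largest value `h` belongs to the points of `E` closest to `b`.
  obtain ⟨h, hh, hmax⟩ := K.exists_max 0 (hE0.image fun a => K.val (b - a))
  obtain ⟨a₀, ha₀, ha₀h⟩ := Finset.mem_image.1 hh
  have hvh : K.val h = h := by rw [← ha₀h, hK.val_val]
  have hpos : K.pos 1 h := ha₀h ▸ hK.val_pos _ (hne a₀ ha₀)
  have hhV : h ∈ V := ha₀h ▸ hEb a₀ ha₀
  have hatl : ∀ a, K.val (b - a) = h → K.AtLeast h (b - a) := fun a ha => by
    right
    rw [ha, sub_self]
    exact K.not_pos_zero 0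
  have hath : K.AtLeast h h := by
    right
    rw [hvh, sub_self]
    exact K.not_pos_zero 0
  -- The point `p` lies in the ball around `b` of elements at distance of value at least `h`. The
  -- closest points of `E` below `b` stay at or below `p - k`, those above `b` at or above `p + k`,
  -- with `val k = h`. If closest points occur on one side only, `p` is one step `h` away from the
  -- extreme one, towards `b`; otherwise it is the midpoint between the two sides.
  obtain ⟨k, p, hpV, hk, hkh, hpb, hl, hr⟩ : ∃ k p, p ∈ V ∧ K.pos 1 k ∧ K.val k = h ∧
      K.AtLeast h (b - p) ∧
      (∀ a ∈ E, K.val (b - a) = h → K.pos 1 (b - a) → ¬ K.pos 1 (a - (p - k))) ∧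
      (∀ a ∈ E, K.val (b - a) = h → K.pos 1 (a - b) → ¬ K.pos 1 ((p + k) - a)) := by
    have hlm : ∀ l ∈ (E.filter fun a => K.val (b - a) = h ∧ K.pos 1 (b - a)),
        l ∈ V ∧ K.AtLeast h (b - l) ∧ K.pos 1 (b - l) ∧ K.val (b - l) = h := fun l hl => by
      rw [Finset.mem_filter] at hl
      exact ⟨hE l hl.1, hatl l hl.2.1, hl.2.2, hl.2.1⟩
    have hrm : ∀ l ∈ (E.filter fun a => K.val (b - a) = h ∧ K.pos 1 (a - b)),
        l ∈ V ∧ K.AtLeast h (b - l) ∧ K.pos 1 (l - b) := fun l hl => by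
      rw [Finset.mem_filter] at hl
      exact ⟨hE l hl.1, hatl l hl.2.1, hl.2.2⟩
    rcases (E.filter fun a => K.val (b - a) = h ∧ K.pos 1 (b - a)).eq_empty_or_nonempty
      with hL | hL <;>
    rcases (E.filter fun a => K.val (b - a) = h ∧ K.pos 1 (a - b)).eq_empty_or_nonempty
      with hR | hR
    · exfalso
      rcases hK.total _ (hne a₀ ha₀) with h1 | h1
      · exact Finset.notMem_empty a₀ (hL ▸ Finset.mem_filter.2 ⟨ha₀, ha₀h, h1⟩)
      · rw [neg_sub] at h1
        exact Finset.notMem_empty a₀ (hR ▸ Finset.mem_filter.2 ⟨ha₀, ha₀h, h1⟩)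
    · obtain ⟨r, hr, hrmin⟩ := K.exists_min 1 hR
      obtain ⟨h1, h2, h3⟩ := hrm r hr
      refine ⟨h, r - h, V.sub_mem h1 hhV, hpos, hvh, ?_, ?_, ?_⟩
      · convert hK.atLeast_add h2 hath using 1
        abel
      · intro a ha hah h4
        exact absurd (Finset.mem_filter.2 ⟨ha, hah, h4⟩) (hL ▸ Finset.notMem_empty a)
      · intro a ha hah h4
        rw [sub_add_cancel]
        exact hrmin a (Finset.mem_filter.2 ⟨ha, hah, h4⟩)
    · obtain ⟨l, hl, hlmax⟩ := K.exists_max 1 hL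
      obtain ⟨h1, h2, h3, -⟩ := hlm l hl
      refine ⟨h, l + h, V.add_mem h1 hhV, hpos, hvh, ?_, ?_, ?_⟩
      · convert hK.atLeast_add h2 hath.neg using 1
        abel
      · intro a ha hah h4
        rw [add_sub_cancel_right]
        exact hlmax a (Finset.mem_filter.2 ⟨ha, hah, h4⟩)
      · intro a ha hah h4
        exact absurd (Finset.mem_filter.2 ⟨ha, hah, h4⟩) (hR ▸ Finset.notMem_empty a)
    · obtain ⟨r, hr, hrmin⟩ := K.exists_min 1 hR
      obtain ⟨l, hl, hlmax⟩ := K.exists_max 1 hL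
      obtain ⟨h1, h2, h3⟩ := hrm r hr
      obtain ⟨h4, h5, h6, h7⟩ := hlm l hl
      have hlr : K.pos 1 (r - l) := pos_trans h6 h3
      have htwo : (2⁻¹ : C) ≠ 0 := by simp
      have hsum : (2⁻¹ : C) • (r - l) + (2⁻¹ : C) • (r - l) = r - l := by
        rw [← add_smul]
        norm_num
      have hatr : K.AtLeast h (r - l) := by
        convert hK.atLeast_add h5 h2.neg using 1
        abel
      -- Both `b - l` and `b - r` have value at least `h`, hence so has `r - l`. Convexity applied
      -- to `0 < b - l < r - l` gives the other inequality.
      have hv : K.val ((2⁻¹ : C) • (r - l)) = h := by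
        rw [K.val_smul _ _ htwo]
        have h8 := hK.convex (b - l) (r - l) h6 (by rwa [sub_sub_sub_cancel_right])
        rw [h7] at h8
        exact K.eq_of_not_pos (hatr.resolve_left (ne_zero_of_pos hlr)) h8
      refine ⟨(2⁻¹ : C) • (r - l), l + (2⁻¹ : C) • (r - l),
        V.add_mem h4 (V.smul_mem _ (V.sub_mem h1 h4)), K.pos_smul 1 _ _ (by positivity) hlr, hv,
        ?_, ?_, ?_⟩
      · have : K.AtLeast h ((2⁻¹ : C) • (r - l)) := by
          right
          rw [hv, sub_self]
          exact K.not_pos_zero 0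
        convert hK.atLeast_add h5 this.neg using 1
        abel
      · intro a ha hah h4
        rw [add_sub_cancel_right]
        exact hlmax a (Finset.mem_filter.2 ⟨ha, hah, h4⟩)
      · intro a ha hah h4
        rw [add_assoc, hsum, add_sub_cancel]
        exact hrmin a (Finset.mem_filter.2 ⟨ha, hah, h4⟩)
  -- If `z` is at least `k` for `<₁`, convexity bounds its value above by `val k = h`; the
  -- ultrametric bound from below makes it equal to `h`.
  have main : ∀ w z, K.AtLeast h z → z = k + w → ¬ K.pos 1 (-w) → K.pos 1 z ∧ K.val z = h := by
    rintro w z hz rfl hw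
    by_cases hw0 : w = 0
    · rw [hw0, add_zero]
      exact ⟨hk, hkh⟩
    have hw' := (hK.total w hw0).resolve_right hw
    have hkw := K.pos_add 1 _ _ hk hw'
    refine ⟨hkw, ?_⟩
    have h8 := hK.convex k (k + w) hk (by rwa [add_sub_cancel_left])
    rw [hkh] at h8
    exact (K.eq_of_not_pos (hz.resolve_left (ne_zero_of_pos hkw)) h8)
  refine ⟨p, hpV, fun a ha => ?_⟩
  by_cases hah : K.val (b - a) = h
  · have hz : K.AtLeast h (p - a) := by
      convert hK.atLeast_add hpb.neg (hatl a hah) using 1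
      abel
    rcases hK.total _ (hne a ha) with h1 | h1
    · obtain ⟨h2, h3⟩ := main ((p - k) - a) (p - a) hz (by abel) (by
        rw [neg_sub]
        exact hl a ha hah h1)
      exact ⟨h3.trans hah.symm, iff_of_true h2 h1,
        iff_of_false (not_pos_swap h2) (not_pos_swap h1)⟩
    · rw [neg_sub] at h1
      have hz' := hz.neg
      rw [neg_sub] at hz'
      obtain ⟨h2, h3⟩ := main (a - (p + k)) (a - p) hz' (by abel) (by
        rw [neg_sub]
        exact hr a ha hah h1)
      rw [← neg_sub, K.val_neg] at h3
      exact ⟨h3.trans hah.symm, iff_of_false (not_pos_swap h2) (not_pos_swap h1),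
        iff_of_true h2 h1⟩
  -- From a point `a` farther away than the closest ones, the shift from `b` to `p` is dominated by
  -- `b - a`.
  · have hlt : K.pos 0 (h - K.val (b - a)) := (K.pos_sub_total hah).resolve_right
      (hmax _ (Finset.mem_image_of_mem _ ha))
    have hd : K.Dominates (b - a) (p - b) := by
      refine ⟨hne a ha, ?_⟩
      rcases hpb.neg with h1 | h1
      · left
        rwa [neg_sub] at h1
      · right
        rw [neg_sub] at h1
        exact pos_of_pos_of_not_pos hlt h1
    have e : p - a = (b - a) + (p - b) := by abel
    rw [← neg_sub p a, ← neg_sub b a, e, hK.val_add_of_dominates hd, hK.pos_add_of_dominates hd,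
      hK.pos_neg_add_of_dominates hd]
    exact ⟨rfl, Iff.rfl, Iff.rfl⟩

include hK' in
open Pointwise in
/-- Extension by an element that adds no new values. -/
theorem exists_extension_immediate {A V : Submodule C G} (hAV : A ≤ V)
    (hV : ∀ x ∈ V, K.val x ∈ V) {g₀ : G →ₗ[C] G'}
    (hP : ∀ F : Finset G, (∀ x ∈ F, x ∈ V) →
      ∃ g : G →ₗ[C] G', (∀ x ∈ A, g x = g₀ x) ∧ ∀ x ∈ F, Respects K K' g x)
    {b : G} (hb : b ∉ V) (F : Finset G) (hF : ∀ x ∈ F, x ∈ V ⊔ Submodule.span C {b})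
    (hFV : ∀ x ∈ F, K.val x ∈ V) :
    ∃ g : G →ₗ[C] G', (∀ x ∈ A, g x = g₀ x) ∧ ∀ x ∈ F, Respects K K' g x := by
  classical
  refine exists_extension_step hAV hV hP hb F hF fun E hE => ?_
  rcases E.eq_empty_or_nonempty with rfl | hE0
  · exact ⟨∅, by simp, fun g _ => ⟨0, by simp⟩⟩
  have hEb : ∀ a ∈ E, K.val (b - a) ∈ V := by
    intro a ha
    obtain ⟨-, c, hc, h⟩ := hE a ha
    rw [← K.val_smul c _ hc]
    exact hFV _ h
  obtain ⟨p, hpV, hp⟩ := hK.exists_center hb hE0 (fun a ha => (hE a ha).1) hEb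
  refine ⟨(E - E) ∪ E.image (p - ·), fun x hx => ?_, fun g hg => ?_⟩
  · rcases Finset.mem_union.1 hx with hx | hx
    · obtain ⟨e, he, e', he', rfl⟩ := Finset.mem_sub.1 hx
      exact V.sub_mem (hE e he).1 (hE e' he').1
    · obtain ⟨e, he, rfl⟩ := Finset.mem_image.1 hx
      exact V.sub_mem hpV (hE e he).1
  have hgp : ∀ e ∈ E, Respects K K' g (p - e) := fun e he =>
    hg _ (Finset.mem_union_right _ (Finset.mem_image_of_mem _ he))
  replace hg : ∀ e ∈ E, ∀ e' ∈ E, Respects K K' g (e - e') := fun e he e' he' =>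
    hg _ (Finset.mem_union_left _ (Finset.sub_mem_sub he he'))
  -- The value `h'` exceeds the images of all values of `b - a`, so an error of value at least `h'`
  -- changes neither signs for `<₁` nor values.
  obtain ⟨_, ⟨c, hc, rfl⟩, h1, -⟩ := K'.exists_between_finsets 0
    (D := {z | ∃ c, c ≠ 0 ∧ z = K'.val c}) (by
      intro a b hab
      obtain ⟨c, hc, h1, h2⟩ := hK'.dense a b hab
      exact ⟨_, ⟨c, hc, rfl⟩, h1, h2⟩)
    (E.image fun a => g (K.val (b - a))) ∅ (by simp)
  set h' := K'.val c with hh'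
  have hh'' : K'.val h' = h' := hK'.val_val c
  have hpos' : K'.pos 1 h' := hK'.val_pos c hc
  obtain ⟨α, β, hαβ, hα, hβ⟩ := K'.exists_interval 0
    ((E.filter fun a => K.pos 0 (b - a)).image g)
    ((E.filter fun a => K.pos 0 (a - b)).image g) (by
      intro s hs u hu
      obtain ⟨s, hs', rfl⟩ := Finset.mem_image.1 hs
      obtain ⟨u, hu', rfl⟩ := Finset.mem_image.1 hu
      replace hs := Finset.mem_filter.1 hs'
      replace hu := Finset.mem_filter.1 hu'
      exact ((hg u hu.1 s hs.1).sub_iff 0).1.2 (pos_trans hs.2 hu.2))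
  -- The cut of `b` for `<₀` is met inside the `<₁`-interval of radius `h'` around `g p`.
  obtain ⟨b', ⟨hb1, hb2⟩, hb3, hb4⟩ := hK'.independent α β (g p - h') (g p + h') hαβ (by
    convert K'.pos_add 1 _ _ hpos' hpos' using 1
    abel)
  -- Elements of absolute value below `h'` for `<₁` are zero or have value at least `h'`, by
  -- convexity.
  have hu : b' - g p = 0 ∨ ¬ K'.pos 0 (h' - K'.val (b' - g p)) := by
    by_cases h0 : b' - g p = 0
    · exact Or.inl h0
    right
    rcases hK'.total _ h0 with h2 | h2
    · have := hK'.convex _ h' h2 (by convert hb4 using 1; abel)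
      rwa [hh''] at this
    · have := hK'.convex _ h' h2 (by convert hb3 using 1; abel)
      rwa [hh'', K'.val_neg] at this
  refine ⟨b', fun g' hg'V hg'b a ha => Respects.of_sub hg'b (hg'V a (hE a ha).1) ?_ ?_⟩
  all_goals
    have hr := hgp a ha
    -- Hence `b' - g a` has the `<₁`-sign and the value of `g p - g a`, which are those of `p - a`
    -- and so of `b - a`.
    have hd : K'.Dominates (g p - g a) (b' - g p) := by
      refine ⟨fun h0 => ?_, ?_⟩
      · rw [← map_sub, hr.map_eq_zero_iff] at h0
        have hba : b - a ≠ 0 := fun h0 => hb (by rw [sub_eq_zero.1 h0]; exact (hE a ha).1)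
        have h3 := (hp a ha).2
        rw [← neg_sub p a, h0, neg_zero, ← neg_sub b a] at h3
        rcases hK.total _ hba with h2 | h2
        · exact K.not_pos_zero 1 (h3.1.2 h2)
        · exact K.not_pos_zero 1 (h3.2.2 h2)
      · refine hu.imp id fun h2 => ?_
        have h3 := h1 _ (Finset.mem_image_of_mem _ ha)
        rw [← map_sub, hr.2, (hp a ha).1]
        exact pos_of_pos_of_not_pos h3 h2
    have e : b' - g a = (g p - g a) + (b' - g p) := by abel
  · intro i
    fin_cases i
    · refine sign_iff_of_side (fun h' => ?_) (fun h' => ?_) (K.pos_sub_total ?_)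
      · exact pos_of_not_pos_of_pos
          (hα _ (Finset.mem_image_of_mem _ (Finset.mem_filter.2 ⟨ha, h'⟩))) hb1
      · exact pos_of_pos_of_not_pos hb2
          (hβ _ (Finset.mem_image_of_mem _ (Finset.mem_filter.2 ⟨ha, h'⟩)))
      · rintro rfl
        exact hb (hE _ ha).1
    · have h3 := hr.sub_iff 1
      have h4 := (hp a ha).2
      change (K'.pos 1 (b' - g a) ↔ K.pos 1 (b - a)) ∧ (K'.pos 1 (g a - b') ↔ K.pos 1 (a - b))
      rw [← neg_sub b' (g a), e, hK'.pos_add_of_dominates hd, hK'.pos_neg_add_of_dominates hd,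
        neg_sub, h3.1, h3.2]
      exact h4
  · rw [e, hK'.val_add_of_dominates hd, ← map_sub, hr.2, (hp a ha).1, hg'V _ (hEb a ha)]

-- The values of the elements of `F` are adjoined one at a time, each being new or already present.
-- Then adjoining `b` requires no further values for the elements of `F`, which is the immediate
-- case.
include hK' in
theorem hasExtension : HasExtension K K' := by
  classical
  intro A g₀ b F hA hg₀ hF
  have values : ∀ S : Finset G, (∀ h ∈ S, K.val h = h) →
      (∀ x ∈ A ⊔ Submodule.span C (S : Set G), K.val x ∈ A ⊔ Submodule.span C (S : Set G)) ∧
      ∀ F : Finset G, (∀ x ∈ F, x ∈ A ⊔ Submodule.span C (S : Set G)) →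
        ∃ g : G →ₗ[C] G', (∀ x ∈ A, g x = g₀ x) ∧ ∀ x ∈ F, Respects K K' g x := by
    intro S
    induction S using Finset.induction_on with
    | empty =>
      intro _
      simp only [Finset.coe_empty, Submodule.span_empty, sup_bot_eq]
      exact ⟨hA, fun F hF => ⟨g₀, fun _ _ => rfl, fun x hx => hg₀ x (hF x hx)⟩⟩
    | insert h S _ ih =>
      intro hS
      obtain ⟨h1, h2⟩ := ih fun x hx => hS x (Finset.mem_insert_of_mem hx)
      have hh := hS h (Finset.mem_insert_self _ _)
      rw [Finset.coe_insert, Submodule.span_insert, sup_comm (Submodule.span C {h}), ← sup_assoc]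
      refine ⟨hK.val_closed_sup h1 hh, fun F hF => ?_⟩
      by_cases hhV : h ∈ A ⊔ Submodule.span C (S : Set G)
      · refine h2 F fun x hx => ?_
        have := hF x hx
        rwa [sup_eq_left.2 (by simpa using hhV)] at this
      · exact hK.exists_extension_value hK' le_sup_left h1 h2 hh hhV F hF
  obtain ⟨h1, h2⟩ := values (F.image K.val) (by
    intro h hh
    obtain ⟨x, -, rfl⟩ := Finset.mem_image.1 hh
    exact hK.val_val x)
  rw [Finset.coe_image] at h1 h2
  by_cases hb : b ∈ A ⊔ Submodule.span C (K.val '' F)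
  · refine h2 F fun x hx => ?_
    have := hF x hx
    rwa [sup_eq_left.2 (by simpa using hb)] at this
  · exact hK.exists_extension_immediate hK' le_sup_left h1 h2 hb F hF fun x hx =>
      Submodule.mem_sup_right (Submodule.subset_span ⟨x, hx, rfl⟩)

end IsHamel

end BiorderedSpace

end Hamel

/-! ### Values along translates of indiscernible sequences -/

namespace Hamel

namespace BiorderedSpace

variable {C : Type*} [Field C] [LinearOrder C] [IsStrictOrderedRing C]
variable {G : Type*} [AddCommGroup G] [Module C G]
variable {K : BiorderedSpace C G}

/-- A relation on triples does not depend on the choice of the increasing triple in `[-N, N]`. -/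
def Uniform₃ (N : ℤ) (R : ℤ → ℤ → ℤ → Prop) : Prop :=
  ∀ j j' j'' k k' k'', -N ≤ j → j < j' → j' < j'' → j'' ≤ N → -N ≤ k → k < k' → k' < k'' → k'' ≤ N →
    R j j' j'' → R k k' k''

/-- A relation on pairs does not depend on the choice of the increasing pair in `[-N, N] ∩ J`. -/
def Uniform₂ (N : ℤ) (J : Set ℤ) (R : ℤ → ℤ → Prop) : Prop :=
  ∀ j j' k k', -N ≤ j → j < j' → j' ≤ N → -N ≤ k → k < k' → k' ≤ N →
    j ∈ J → j' ∈ J → k ∈ J → k' ∈ J → R j j' → R k k'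

variable (K) in
/-- The facts about the distances in an indiscernible sequence `x` used for computing values. -/
structure UniformDistances (N : ℤ) (x : ℤ → G) : Prop where
  sign : Uniform₂ N Set.univ fun j k => K.pos 1 (x j - x k)
  eq : Uniform₂ N Set.univ fun j k => x j = x k
  left : Uniform₃ N fun j k l => K.val (x j - x k) = K.val (x j - x l)
  left_lt : Uniform₃ N fun j k l => K.pos 0 (K.val (x k - x l) - K.val (x j - x l))
  right : Uniform₃ N fun j k l => K.val (x k - x l) = K.val (x j - x l)
  right_lt : Uniform₃ N fun j k l => K.pos 0 (K.val (x j - x k) - K.val (x j - x l))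

variable (K) in
/-- The facts about the values in a sequence `y` that is indiscernible off `0`. -/
structure UniformValues (N : ℤ) (y : ℤ → G) : Prop where
  ne_zero : ∀ j, -N ≤ j → j ≤ N → y j ≠ 0
  lt : Uniform₂ N {0}ᶜ fun j k => K.pos 0 (K.val (y k) - K.val (y j))
  gt : Uniform₂ N {0}ᶜ fun j k => K.pos 0 (K.val (y j) - K.val (y k))
  sign : Uniform₂ N {0}ᶜ fun j k => (K.pos 1 (y j) ↔ K.pos 1 (y k))

variable (K) in
/-- Values along a translate of an indiscernible sequence are distances or constant. -/
def HasValueDichotomy : Prop :=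
  ∀ (N : ℤ) (x y : ℤ → G) (g : G), 2 ≤ N → (∀ j, y j = x j + g) → K.UniformDistances N x →
    K.UniformValues N y →
    (∀ j, -N < j → j < N → K.val (y j) = K.val (x j - x N)) ∨
    (∀ j, -N < j → j < N → K.val (y j) = K.val (x j - x (-N))) ∨
    ∃ h, ∀ j, -N < j → j < N → K.val (y j) = h

theorem IsPreordered.hasValueDichotomy (hK : K.IsPreordered) : K.HasValueDichotomy :=
  fun _ _ _ _ _ _ _ _ => Or.inr (Or.inr ⟨0, fun _ _ _ => hK.val_eq _⟩)

namespace IsHamel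

/-- For `j < k` off `0` the term `y j` dominates `y k`, so `x j - x k = y j - y k` has the value of
`y j`. Thus distances in `x` depend on the smaller index only and increase with it. These are
properties of `x` alone and therefore extend to the index `0`. -/
theorem val_eq_of_increasing (hK : K.IsHamel) {N : ℤ} {x y : ℤ → G} {g : G} (hN : 2 ≤ N)
    (hxy : ∀ j, y j = x j + g) (heq : Uniform₂ N Set.univ fun j k => x j = x k)
    (hleft : Uniform₃ N fun j k l => K.val (x j - x k) = K.val (x j - x l))
    (hlt : Uniform₃ N fun j k l => K.pos 0 (K.val (x k - x l) - K.val (x j - x l)))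
    (hy0 : ∀ j, -N ≤ j → j ≤ N → y j ≠ 0)
    (hy : ∀ j k, -N ≤ j → j < k → k ≤ N → j ≠ 0 → k ≠ 0 →
      K.pos 0 (K.val (y k) - K.val (y j))) :
    ∀ j, -N < j → j < N → K.val (y j) = K.val (x j - x N) := by
  have hd : ∀ j k, x j - x k = y j + -y k := fun j k => by
    rw [hxy, hxy]
    abel
  have h1 : ∀ j k, -N ≤ j → j < k → k ≤ N → j ≠ 0 → k ≠ 0 → K.val (x j - x k) = K.val (y j) := by
    intro j k hj hjk hk hj0 hk0
    rw [hd]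
    refine hK.val_add_of_dominates ⟨hy0 j hj (hjk.le.trans hk), Or.inr ?_⟩
    rw [K.val_neg]
    exact hy j k hj hjk hk hj0 hk0
  intro j hj hjN
  by_cases hj0 : j = 0
  · subst hj0
    have h2 := hleft (-2) (-1) 1 0 (N - 1) N (by omega) (by omega) (by omega) (by omega) (by omega)
      (by omega) (by omega) le_rfl (by
        beta_reduce
        rw [h1 (-2) (-1) (by omega) (by omega) (by omega) (by omega) (by omega),
          h1 (-2) 1 (by omega) (by omega) (by omega) (by omega) (by omega)])
    have h3 := hlt (-2) (-1) 1 0 (N - 1) N (by omega) (by omega) (by omega) (by omega) (by omega)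
      (by omega) (by omega) le_rfl (by
        beta_reduce
        rw [h1 (-2) 1 (by omega) (by omega) (by omega) (by omega) (by omega),
          h1 (-1) 1 (by omega) (by omega) (by omega) (by omega) (by omega)]
        exact hy _ _ (by omega) (by omega) (by omega) (by omega) (by omega))
    beta_reduce at h2 h3
    have h4 : x 0 ≠ x (N - 1) := fun h0 => by
      have h5 := heq 0 (N - 1) 1 2 (by omega) (by omega) (by omega) (by omega) (by omega) hN
        trivial trivial trivial trivial h0
      have h6 := hy 1 2 (by omega) (by omega) hN (by omega) (by omega)
      rw [hxy, hxy, ← h5, sub_self] at h6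
      exact K.not_pos_zero 0 h6
    rw [h1 (N - 1) N (by omega) (by omega) le_rfl (by omega) (by omega), ← h2] at h3
    rw [← h2]
    -- By `h3` the distance from `x 0` to `x (N - 1)` has a smaller value than `y (N - 1)`, so the
    -- first summand dominates.
    have h7 : y 0 = (x 0 - x (N - 1)) + y (N - 1) := by
      rw [hxy, hxy]
      abel
    rw [h7]
    exact hK.val_add_of_dominates ⟨sub_ne_zero.2 h4, Or.inr h3⟩
  · exact (h1 j N hj.le hjN le_rfl hj0 (by omega)).symm

/-- Between positive elements of equal value, convexity squeezes the value of `b` from both sides;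
the negative case follows by reflection. -/
theorem val_eq_of_between (hK : K.IsHamel) {a b c : G} (hab : ¬ K.pos 1 (a - b))
    (hbc : ¬ K.pos 1 (b - c)) (hc : c ≠ 0) (hac : K.pos 1 a ↔ K.pos 1 c)
    (hv : K.val a = K.val c) : K.val b = K.val a := by
  have key : ∀ {a b c : G}, ¬ K.pos 1 (a - b) → ¬ K.pos 1 (b - c) → K.pos 1 a →
      K.val a = K.val c → K.val b = K.val a := by
    intro a b c hab hbc ha hv
    by_cases h1 : a = b
    · rw [h1]
    by_cases h2 : b = c
    · rw [h2, hv]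
    have h3 : K.pos 1 (b - a) := by
      have := (hK.total _ (sub_ne_zero.2 h1)).resolve_left hab
      rwa [neg_sub] at this
    have h4 : K.pos 1 (c - b) := by
      have := (hK.total _ (sub_ne_zero.2 h2)).resolve_left hbc
      rwa [neg_sub] at this
    have h5 : K.pos 1 b := by
      have := K.pos_add 1 _ _ ha h3
      rwa [add_sub_cancel] at this
    exact K.eq_of_not_pos (hv ▸ hK.convex b c h5 h4) (hK.convex a b ha h3)
  by_cases ha1 : K.pos 1 a
  · exact key hab hbc ha1 hv
  · have hc1 := (hK.total c hc).resolve_left fun h => ha1 (hac.2 h)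
    have := key (a := -c) (b := -b) (c := -a) (by rwa [neg_sub_neg]) (by rwa [neg_sub_neg]) hc1
      (by rw [K.val_neg, K.val_neg, hv])
    rwa [K.val_neg, K.val_neg, ← hv] at this

/-- Off `0` the values are increasing, decreasing or constant in `j`. The increasing case is
`val_eq_of_increasing`, and the decreasing one is its mirror image. In the constant case `y 0` lies
between `y (-1)` and `y 1` for `<₁`, which have the same sign and value. -/
theorem hasValueDichotomy (hK : K.IsHamel) : K.HasValueDichotomy := by
  intro N x y g hN hxy hx hy
  by_cases h1 : K.pos 0 (K.val (y 1) - K.val (y (-1)))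
  · left
    refine hK.val_eq_of_increasing hN hxy hx.eq hx.left hx.left_lt hy.ne_zero ?_
    intro j k hj hjk hk hj0 hk0
    exact hy.lt (-1) 1 j k (by omega) (by omega) (by omega) hj hjk hk (by simp) (by simp) hj0 hk0 h1
  by_cases h2 : K.pos 0 (K.val (y (-1)) - K.val (y 1))
  · right; left
    have := hK.val_eq_of_increasing (x := fun j => x (-j)) (y := fun j => y (-j)) hN
      (fun j => hxy (-j)) ?_ ?_ ?_ (fun j hj hj' => hy.ne_zero _ (by omega) (by omega)) ?_
    · intro j hj hj'
      simpa using this (-j) (by omega) (by omega)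
    · intro j j' k k' h1 h2 h3 h4 h5 h6 _ _ _ _ h
      exact (hx.eq (-j') (-j) (-k') (-k) (by omega) (by omega) (by omega) (by omega) (by omega)
        (by omega) trivial trivial trivial trivial h.symm).symm
    · intro j j' j'' k k' k'' h1 h2 h3 h4 h5 h6 h7 h8 h
      rw [← neg_sub, K.val_neg, ← neg_sub (x (-j'')), K.val_neg] at h
      rw [← neg_sub, K.val_neg, ← neg_sub (x (-k'')), K.val_neg]
      exact hx.right (-j'') (-j') (-j) (-k'') (-k') (-k) (by omega) (by omega) (by omega)
        (by omega) (by omega) (by omega) (by omega) (by omega) h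
    · intro j j' j'' k k' k'' h1 h2 h3 h4 h5 h6 h7 h8 h
      rw [← neg_sub (x (-j'')), K.val_neg, ← neg_sub (x (-j'')), K.val_neg] at h
      rw [← neg_sub (x (-k'')), K.val_neg, ← neg_sub (x (-k'')), K.val_neg]
      exact hx.right_lt (-j'') (-j') (-j) (-k'') (-k') (-k) (by omega) (by omega) (by omega)
        (by omega) (by omega) (by omega) (by omega) (by omega) h
    · intro j k hj hjk hk hj0 hk0
      exact hy.gt (-1) 1 (-k) (-j) (by omega) (by omega) (by omega) (by omega) (by omega) (by omega)
        (by simp) (by simp) (by simpa using hk0) (by simpa using hj0) h2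
  · right; right
    refine ⟨K.val (y N), fun j hj hj' => ?_⟩
    have hc : ∀ j k, -N ≤ j → j < k → k ≤ N → j ≠ 0 → k ≠ 0 → K.val (y j) = K.val (y k) := by
      intro j k hj hjk hk hj0 hk0
      refine K.eq_of_not_pos (fun h => h1 ?_) (fun h => h2 ?_)
      · exact hy.lt j k (-1) 1 hj hjk hk (by omega) (by omega) (by omega) hj0 hk0 (by simp)
          (by simp) h
      · exact hy.gt j k (-1) 1 hj hjk hk (by omega) (by omega) (by omega) hj0 hk0 (by simp)
          (by simp) h
    by_cases hj0 : j = 0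
    · subst hj0
      rw [← hc (-1) N (by omega) (by omega) le_rfl (by omega) (by omega)]
      -- If two terms had different signs, any two off `0` would; but of `y (-2)`, `y (-1)`, `y 1`
      -- two have the same sign.
      have hs : K.pos 1 (y (-1)) ↔ K.pos 1 (y 1) := by
        by_cases h : (K.pos 1 (y (-1)) ↔ K.pos 1 (y 1))
        · exact h
        exfalso
        have h' : ∀ j k, -N ≤ j → j < k → k ≤ N → j ≠ 0 → k ≠ 0 →
            ¬ (K.pos 1 (y j) ↔ K.pos 1 (y k)) := fun j k a b c d e f => h
          (hy.sign j k (-1) 1 a b c (by omega) (by omega) (by omega) d e (by simp) (by simp) f)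
        have a1 := h' (-2) (-1) (by omega) (by omega) (by omega) (by omega) (by omega)
        have a2 := h' (-2) 1 (by omega) (by omega) (by omega) (by omega) (by omega)
        tauto
      have hd : ∀ j k, y j - y k = x j - x k := fun j k => by
        rw [hxy, hxy]
        abel
      have hv := hc (-1) 1 (by omega) (by omega) (by omega) (by omega) (by omega)
      have n1 := hy.ne_zero (-1) (by omega) (by omega)
      have n2 := hy.ne_zero 1 (by omega) (by omega)
      by_cases h3 : K.pos 1 (x (-1) - x 0)
      · have h4 := hx.sign (-1) 0 0 1 (by omega) (by omega) (by omega) (by omega) (by omega)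
          (by omega) trivial trivial trivial trivial h3
        rw [hv]
        exact hK.val_eq_of_between (by rw [hd]; exact not_pos_swap h4)
          (by rw [hd]; exact not_pos_swap h3) n1 hs.symm hv.symm
      · refine hK.val_eq_of_between (by rwa [hd]) ?_ n2 hs hv
        rw [hd]
        exact fun h => h3 (hx.sign 0 1 (-1) 0 (by omega) (by omega) (by omega) (by omega) (by omega)
          (by omega) trivial trivial trivial trivial h)
    · exact hc j N hj.le hj' le_rfl hj0 (by omega)

end IsHamel

end BiorderedSpace

end Hamel

namespace Hamel

/-! ### Terms and atomic formulas of the language of Hamel spaces -/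

section Operations

open FirstOrder.Language

variable (C : Type u) {X : Type*} [(hamelLang C).Structure X]

/-- The symbols of `hamelLang C` in its structures. -/
def sZero : X := Structure.funMap (L := hamelLang C) HamelFunc.zero ![]
def sInfty : X := Structure.funMap (L := hamelLang C) HamelFunc.infty ![]
def sAdd (x y : X) : X := Structure.funMap (L := hamelLang C) HamelFunc.add ![x, y]
variable {C} in
def sSmul (c : C) (x : X) : X := Structure.funMap (L := hamelLang C) (HamelFunc.smul c) ![x]
def sVal (x : X) : X := Structure.funMap (L := hamelLang C) HamelFunc.val ![x]
def sLt (i : Fin 2) (x y : X) : Prop :=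
  Structure.RelMap (L := hamelLang C) (HamelRel.lt i) ![x, y]

variable {C}

theorem funMap_zero (v : Fin 0 → X) :
    Structure.funMap (L := hamelLang C) HamelFunc.zero v = sZero C := by
  rw [sZero]
  congr 1
  exact Subsingleton.elim _ _

theorem funMap_infty (v : Fin 0 → X) :
    Structure.funMap (L := hamelLang C) HamelFunc.infty v = sInfty C := by
  rw [sInfty]
  congr 1
  exact Subsingleton.elim _ _

theorem funMap_add (v : Fin 2 → X) :
    Structure.funMap (L := hamelLang C) HamelFunc.add v = sAdd C (v 0) (v 1) := by
  rw [sAdd]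
  congr 1
  funext i
  fin_cases i <;> rfl

theorem funMap_smul (c : C) (v : Fin 1 → X) :
    Structure.funMap (L := hamelLang C) (HamelFunc.smul c) v = sSmul c (v 0) := by
  rw [sSmul]
  congr 1
  funext i
  fin_cases i
  rfl

theorem funMap_val (v : Fin 1 → X) :
    Structure.funMap (L := hamelLang C) HamelFunc.val v = sVal C (v 0) := by
  rw [sVal]
  congr 1
  funext i
  fin_cases i
  rfl

theorem relMap_lt (i : Fin 2) (v : Fin 2 → X) :
    Structure.RelMap (L := hamelLang C) (HamelRel.lt i) v ↔ sLt C i (v 0) (v 1) := by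
  rw [sLt, iff_eq_eq]
  congr 1
  funext i
  fin_cases i <;> rfl

variable {α : Type*}

/-- Terms and formulas built from the symbols of `hamelLang C`. -/
def tZero : (hamelLang C).Term α := .func (l := 0) HamelFunc.zero ![]
def tInfty : (hamelLang C).Term α := .func (l := 0) HamelFunc.infty ![]
def tAdd (s t : (hamelLang C).Term α) : (hamelLang C).Term α := .func (l := 2) HamelFunc.add ![s, t]
def tSmul (c : C) (t : (hamelLang C).Term α) : (hamelLang C).Term α :=
  .func (l := 1) (HamelFunc.smul c) ![t]
def tVal (t : (hamelLang C).Term α) : (hamelLang C).Term α := .func (l := 1) HamelFunc.val ![t]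
def fLt (i : Fin 2) (s t : (hamelLang C).Term α) : (hamelLang C).Formula α :=
  Relations.formula (n := 2) (HamelRel.lt i : (hamelLang C).Relations 2) ![s, t]

@[simp] theorem realize_tZero (v : α → X) : (tZero : (hamelLang C).Term α).realize v = sZero C :=
  funMap_zero _
@[simp] theorem realize_tInfty (v : α → X) :
    (tInfty : (hamelLang C).Term α).realize v = sInfty C :=
  funMap_infty _
@[simp] theorem realize_tAdd (s t : (hamelLang C).Term α) (v : α → X) :
    (tAdd s t).realize v = sAdd C (s.realize v) (t.realize v) :=
  funMap_add _
@[simp] theorem realize_tSmul (c : C) (t : (hamelLang C).Term α) (v : α → X) :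
    (tSmul c t).realize v = sSmul c (t.realize v) :=
  funMap_smul _ _
@[simp] theorem realize_tVal (t : (hamelLang C).Term α) (v : α → X) :
    (tVal t).realize v = sVal C (t.realize v) :=
  funMap_val _
@[simp] theorem realize_fLt (i : Fin 2) (s t : (hamelLang C).Term α) (v : α → X) :
    (fLt i s t).Realize v ↔ sLt C i (s.realize v) (t.realize v) :=
  Formula.realize_rel.trans (relMap_lt i _)

theorem isQF_fLt (i : Fin 2) (s t : (hamelLang C).Term α) : BoundedFormula.IsQF (fLt i s t) :=
  (BoundedFormula.IsAtomic.rel _ _).isQF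

theorem isQF_equal (s t : (hamelLang C).Term α) : BoundedFormula.IsQF (s.equal t) :=
  (BoundedFormula.IsAtomic.equal _ _).isQF

/-- Induction on terms of `hamelLang C`. -/
theorem term_induction {P : (hamelLang C).Term α → Prop} (var : ∀ x, P (.var x)) (zero : P tZero)
    (infty : P tInfty) (add : ∀ s t, P s → P t → P (tAdd s t)) (smul : ∀ c t, P t → P (tSmul c t))
    (val : ∀ t, P t → P (tVal t)) (t : (hamelLang C).Term α) : P t := by
  induction t with
  | var x => exact var x
  | @func l f ts ih =>
    match l, f with
    | 0, HamelFunc.zero =>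
      convert zero using 1
      rw [tZero]
      congr 1
      exact Subsingleton.elim _ _
    | 0, HamelFunc.infty =>
      convert infty using 1
      rw [tInfty]
      congr 1
      exact Subsingleton.elim _ _
    | 2, HamelFunc.add =>
      convert add _ _ (ih 0) (ih 1) using 1
      rw [tAdd]
      congr 1
      funext i
      fin_cases i <;> rfl
    | 1, HamelFunc.smul c =>
      convert smul c _ (ih 0) using 1
      rw [tSmul]
      congr 1
      funext i
      fin_cases i
      rfl
    | 1, HamelFunc.val =>
      convert val _ (ih 0) using 1
      rw [tVal]
      congr 1
      funext i
      fin_cases i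
      rfl

end Operations

theorem sup_span_mono {C G : Type*} [Field C] [AddCommGroup G] [Module C G]
    (A : Submodule C G) (d : G) {s t : Set G} (h : s ⊆ t) :
    A ⊔ Submodule.span C s ⊔ Submodule.span C {d} ≤
      A ⊔ Submodule.span C t ⊔ Submodule.span C {d} :=
  sup_le_sup_right (sup_le_sup_left (Submodule.span_mono h) _) _

/-! ### Transfer of quantifier-free formulas along linear maps -/

section Carriers

open FirstOrder.Language

variable {C : Type u} [Field C] [LinearOrder C] [IsStrictOrderedRing C]
variable {G G' : Type*} [AddCommGroup G] [Module C G] [AddCommGroup G'] [Module C G']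

/-- `X` is the structure on `G` (if `b = false`, with `∞` interpreted as `0`), or on `G ∪ {∞}`
(if `b = true`), given by a biordered space `K`. -/
structure Carrier (K : BiorderedSpace C G) (X : Type*) [(hamelLang C).Structure X] (b : Bool) where
  emb : G → X
  injective : Function.Injective emb
  cover : ∀ x : X, x = (sInfty C : X) ∨ ∃ g, emb g = x
  ne_infty : b = true → ∀ g, emb g ≠ (sInfty C : X)
  infty_eq : b = false → emb 0 = (sInfty C : X)
  zero : emb 0 = (sZero C : X)
  add : ∀ x y, sAdd C (emb x) (emb y) = emb (x + y)
  smul : ∀ (c : C) x, sSmul c (emb x) = emb (c • x)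
  infty_add : b = true → ∀ x : X, sAdd C (sInfty C) x = (sInfty C : X)
  add_infty : b = true → ∀ x : X, sAdd C x (sInfty C) = (sInfty C : X)
  smul_infty : b = true → ∀ c : C, sSmul c (sInfty C : X) = (sInfty C : X)
  val : ∀ x, x ≠ 0 → sVal C (emb x) = emb (K.val x)
  val_zero : sVal C (emb 0) = (sInfty C : X)
  val_infty : sVal C (sInfty C : X) = (sInfty C : X)
  lt : ∀ i x y, sLt C i (emb x) (emb y) ↔ K.pos i (y - x)
  lt_infty : b = true → ∀ i x, sLt C i (emb x) (sInfty C)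
  not_infty_lt : b = true → ∀ i (x : X), ¬ sLt C i (sInfty C) x

namespace Carrier

variable {K : BiorderedSpace C G} {K' : BiorderedSpace C G'} {X X' : Type*}
  [(hamelLang C).Structure X] [(hamelLang C).Structure X'] {b : Bool}
variable (c : Carrier K X b) (c' : Carrier K' X' b)

theorem cases (x : X) : (∃ g, c.emb g = x) ∨ (b = true ∧ x = (sInfty C : X) ∧ ∀ g, c.emb g ≠ x) := by
  rcases c.cover x with h | h
  · cases b with
    | true => exact Or.inr ⟨rfl, h, fun g => h ▸ c.ne_infty rfl g⟩
    | false => exact Or.inl ⟨0, (c.infty_eq rfl).trans h.symm⟩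
  · exact Or.inl h

open Classical in
/-- The map between structures induced by a linear map. -/
noncomputable def map (g : G →ₗ[C] G') (x : X) : X' :=
  if h : ∃ a, c.emb a = x then c'.emb (g h.choose) else sInfty C

theorem map_emb (g : G →ₗ[C] G') (a : G) : c.map c' g (c.emb a) = c'.emb (g a) := by
  have h : ∃ a', c.emb a' = c.emb a := ⟨a, rfl⟩
  rw [map, dif_pos h, c.injective h.choose_spec]

theorem map_infty (g : G →ₗ[C] G') : c.map c' g (sInfty C) = (sInfty C : X') := by
  cases b with
  | true =>
    rw [map, dif_neg]
    rintro ⟨a, ha⟩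
    exact c.ne_infty rfl a ha
  | false => rw [← c.infty_eq rfl, map_emb, map_zero, c'.infty_eq rfl]

theorem map_zero (g : G →ₗ[C] G') : c.map c' g (sZero C) = (sZero C : X') := by
  rw [← c.zero, map_emb, _root_.map_zero, c'.zero]

theorem map_add (g : G →ₗ[C] G') (x y : X) :
    c.map c' g (sAdd C x y) = sAdd C (c.map c' g x) (c.map c' g y) := by
  rcases c.cases x with ⟨x, rfl⟩ | ⟨hb, rfl, -⟩
  · rcases c.cases y with ⟨y, rfl⟩ | ⟨hb, rfl, -⟩
    · rw [c.add, map_emb, map_emb, map_emb, c'.add, _root_.map_add]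
    · rw [c.add_infty hb, map_infty, c'.add_infty hb]
  · rw [c.infty_add hb, map_infty, c'.infty_add hb]

theorem map_smul (g : G →ₗ[C] G') (r : C) (x : X) :
    c.map c' g (sSmul r x) = sSmul r (c.map c' g x) := by
  rcases c.cases x with ⟨x, rfl⟩ | ⟨hb, rfl, -⟩
  · rw [c.smul, map_emb, map_emb, c'.smul, _root_.map_smul]
  · rw [c.smul_infty hb, map_infty, c'.smul_infty hb]

theorem map_val {g : G →ₗ[C] G'} {x : X} (h : ∀ a, c.emb a = x → K.Respects K' g a) :
    c.map c' g (sVal C x) = sVal C (c.map c' g x) := by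
  rcases c.cases x with ⟨x, rfl⟩ | ⟨hb, rfl, -⟩
  · have hx := h x rfl
    by_cases h0 : x = 0
    · rw [h0, c.val_zero, map_emb, _root_.map_zero, c'.val_zero, map_infty]
    · rw [c.val x h0, map_emb, map_emb, c'.val _ (fun h1 => h0 (hx.map_eq_zero_iff.1 h1)), hx.2]
  · rw [c.val_infty, map_infty, c'.val_infty]

theorem map_lt {g : G →ₗ[C] G'} {x y : X} (i : Fin 2)
    (h : ∀ a a', c.emb a = x → c.emb a' = y → K.Respects K' g (a' - a)) :
    sLt C i (c.map c' g x) (c.map c' g y) ↔ sLt C i x y := by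
  rcases c.cases x with ⟨x, rfl⟩ | ⟨hb, rfl, -⟩
  · rcases c.cases y with ⟨y, rfl⟩ | ⟨hb, rfl, -⟩
    · rw [map_emb, map_emb, c.lt, c'.lt, ← map_sub]
      exact ((h x y rfl rfl).1 i).1
    · rw [map_infty, map_emb]
      exact iff_of_true (c'.lt_infty hb i _) (c.lt_infty hb i _)
  · rw [map_infty]
    exact iff_of_false (c'.not_infty_lt hb i _) (c.not_infty_lt hb i _)

theorem map_eq_iff {g : G →ₗ[C] G'} {x y : X}
    (h : ∀ a a', c.emb a = x → c.emb a' = y → K.Respects K' g (a' - a)) :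
    c.map c' g x = c.map c' g y ↔ x = y := by
  refine ⟨fun hxy => ?_, fun hxy => hxy ▸ rfl⟩
  rcases c.cases x with ⟨x, rfl⟩ | ⟨hb, rfl, -⟩ <;> rcases c.cases y with ⟨y, rfl⟩ | ⟨hb, rfl, -⟩
  · rw [map_emb, map_emb] at hxy
    have h1 := (h x y rfl rfl).map_eq_zero_iff.1 (by rw [map_sub, c'.injective hxy, sub_self])
    rw [sub_eq_zero.1 h1]
  · rw [map_infty, map_emb] at hxy
    exact absurd hxy (c'.ne_infty hb _)
  · rw [map_infty, map_emb] at hxy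
    exact absurd hxy.symm (c'.ne_infty hb _)
  · rfl

/-- A finite set to which the extension property applies. -/
def Admissible (K : BiorderedSpace C G) (A : Submodule C G) (d : G) (F : Finset G) : Prop :=
  ∀ x ∈ F, x ∈ A ⊔ Submodule.span C (K.val '' F) ⊔ Submodule.span C {d}

open Classical in
theorem Admissible.union {A : Submodule C G} {d : G} {F₁ F₂ : Finset G}
    (h₁ : Admissible K A d F₁) (h₂ : Admissible K A d F₂) : Admissible K A d (F₁ ∪ F₂) := by
  intro x hx
  rcases Finset.mem_union.1 hx with hx | hx
  · exact sup_span_mono A d (Set.image_mono (by simp)) (h₁ x hx)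
  · exact sup_span_mono A d (Set.image_mono (by simp)) (h₂ x hx)

open Classical in
theorem Admissible.insert {A : Submodule C G} {d : G} {F : Finset G}
    (h : Admissible K A d F) {x : G}
    (hx : x ∈ A ⊔ Submodule.span C (K.val '' F) ⊔ Submodule.span C {d}) :
    Admissible K A d (insert x F) := by
  intro y hy
  refine sup_span_mono A d (Set.image_mono (s := (F : Set G)) (by simp)) ?_
  rcases Finset.mem_insert.1 hy with rfl | hy
  · exact hx
  · exact h y hy

/-- Evaluating a term commutes with the maps induced by linear maps respecting a suitable finite
set, which contains the value of the term. -/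
theorem exists_admissible_term {γ : Type*} {ρ : γ → X} {A : Submodule C G} {d : G}
    (hρ : ∀ z a, c.emb a = ρ z → a ∈ A ∨ a = d) (t : (hamelLang C).Term γ) :
    ∃ F : Finset G, Admissible K A d F ∧ (∀ a, c.emb a = t.realize ρ → a ∈ F) ∧
      ∀ g : G →ₗ[C] G', (∀ x ∈ F, K.Respects K' g x) →
        t.realize (c.map c' g ∘ ρ) = c.map c' g (t.realize ρ) := by
  classical
  -- Enlarging `F` by the element that the term denotes makes its value available to the terms built
  -- from it.
  have addValue : ∀ (t : (hamelLang C).Term γ) (F : Finset G), Admissible K A d F →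
      (∀ a, c.emb a = t.realize ρ →
        a ∈ A ⊔ Submodule.span C (K.val '' F) ⊔ Submodule.span C {d}) →
      (∀ g : G →ₗ[C] G', (∀ x ∈ F, K.Respects K' g x) →
        t.realize (c.map c' g ∘ ρ) = c.map c' g (t.realize ρ)) →
      ∃ F : Finset G, Admissible K A d F ∧ (∀ a, c.emb a = t.realize ρ → a ∈ F) ∧
        ∀ g : G →ₗ[C] G', (∀ x ∈ F, K.Respects K' g x) →
          t.realize (c.map c' g ∘ ρ) = c.map c' g (t.realize ρ) := by
    intro t F hF ha hg
    by_cases h : ∃ a, c.emb a = t.realize ρ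
    · obtain ⟨a, hat⟩ := h
      refine ⟨insert a F, hF.insert (ha a hat), fun a' ha' => ?_, fun g hg' => hg g fun x hx =>
        hg' x (Finset.mem_insert_of_mem hx)⟩
      rw [c.injective (ha'.trans hat.symm)]
      exact Finset.mem_insert_self _ _
    · exact ⟨F, hF, fun a hat => absurd ⟨a, hat⟩ h, hg⟩
  have hempty : Admissible K A d ∅ := fun x hx => absurd hx (Finset.notMem_empty x)
  induction t using term_induction with
  | var z =>
    refine addValue _ ∅ hempty (fun a ha => ?_) fun g _ => rfl
    rcases hρ z a ha with h | rfl
    · exact Submodule.mem_sup_left (Submodule.mem_sup_left h)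
    · exact Submodule.mem_sup_right (Submodule.mem_span_singleton_self _)
  | zero =>
    refine addValue _ ∅ hempty (fun a ha => ?_) fun g _ => ?_
    · rw [realize_tZero, ← c.zero] at ha
      rw [c.injective ha]
      exact Submodule.zero_mem _
    · rw [realize_tZero, realize_tZero, map_zero]
  | infty =>
    refine addValue _ ∅ hempty (fun a ha => ?_) fun g _ => ?_
    · rw [realize_tInfty] at ha
      cases b with
      | true => exact absurd ha (c.ne_infty rfl a)
      | false =>
        rw [← c.infty_eq rfl] at ha
        rw [c.injective ha]
        exact Submodule.zero_mem _
    · rw [realize_tInfty, realize_tInfty, map_infty]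
  | add s t hs ht =>
    obtain ⟨F₁, hF₁, v₁, g₁⟩ := hs
    obtain ⟨F₂, hF₂, v₂, g₂⟩ := ht
    refine addValue _ (F₁ ∪ F₂) (hF₁.union hF₂) (fun a ha => ?_) fun g hg => ?_
    · rw [realize_tAdd] at ha
      rcases c.cases (s.realize ρ) with ⟨x, hx⟩ | ⟨hb, hx, -⟩
      · rcases c.cases (t.realize ρ) with ⟨y, hy⟩ | ⟨hb, hy, -⟩
        · rw [← hx, ← hy, c.add] at ha
          rw [c.injective ha]
          exact Submodule.add_mem _
            (hF₁.union hF₂ x (Finset.mem_union_left _ (v₁ x hx)))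
            (hF₁.union hF₂ y (Finset.mem_union_right _ (v₂ y hy)))
        · rw [hy, c.add_infty hb] at ha
          exact absurd ha (c.ne_infty hb a)
      · rw [hx, c.infty_add hb] at ha
        exact absurd ha (c.ne_infty hb a)
    · rw [realize_tAdd, realize_tAdd, map_add, g₁ g fun x hx => hg x (Finset.mem_union_left _ hx),
        g₂ g fun x hx => hg x (Finset.mem_union_right _ hx)]
  | smul r t ht =>
    obtain ⟨F, hF, v, h⟩ := ht
    refine addValue _ F hF (fun a ha => ?_) fun g hg => ?_
    · rw [realize_tSmul] at ha
      rcases c.cases (t.realize ρ) with ⟨x, hx⟩ | ⟨hb, hx, -⟩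
      · rw [← hx, c.smul] at ha
        rw [c.injective ha]
        exact Submodule.smul_mem _ _ (hF x (v x hx))
      · rw [hx, c.smul_infty hb] at ha
        exact absurd ha (c.ne_infty hb a)
    · rw [realize_tSmul, realize_tSmul, map_smul, h g hg]
  | val t ht =>
    obtain ⟨F, hF, v, h⟩ := ht
    refine addValue _ F hF (fun a ha => ?_) fun g hg => ?_
    · rw [realize_tVal] at ha
      rcases c.cases (t.realize ρ) with ⟨x, hx⟩ | ⟨hb, hx, -⟩
      · by_cases hx0 : x = 0
        · rw [← hx, hx0, c.val_zero] at ha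
          cases b with
          | true => exact absurd ha (c.ne_infty rfl a)
          | false =>
            rw [← c.infty_eq rfl] at ha
            rw [c.injective ha]
            exact Submodule.zero_mem _
        · rw [← hx, c.val x hx0] at ha
          rw [c.injective ha]
          exact Submodule.mem_sup_left (Submodule.mem_sup_right
            (Submodule.subset_span ⟨x, v x hx, rfl⟩))
      · rw [hx, c.val_infty] at ha
        exact absurd ha (c.ne_infty hb a)
    · rw [realize_tVal, realize_tVal, c.map_val c' fun a ha => hg a (v a ha), h g hg]

/-- The truth of a quantifier-free formula is preserved by the maps induced by linear maps
respecting a suitable finite set. -/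
theorem exists_admissible_formula {α : Type*} {n : ℕ} {v : α → X} {xs : Fin n → X}
    {A : Submodule C G} {d : G} (hρ : ∀ z a, c.emb a = Sum.elim v xs z → a ∈ A ∨ a = d)
    {ψ : (hamelLang C).BoundedFormula α n} (hψ : ψ.IsQF) :
    ∃ F : Finset G, Admissible K A d F ∧ ∀ g : G →ₗ[C] G', (∀ x ∈ F, K.Respects K' g x) →
      (ψ.Realize (c.map c' g ∘ v) (c.map c' g ∘ xs) ↔ ψ.Realize v xs) := by
  classical
  -- Equality and order of two terms are decided by the sign of the difference, so the difference is
  -- put into the finite set.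
  have two : ∀ s t : (hamelLang C).Term (α ⊕ Fin n), ∃ F : Finset G, Admissible K A d F ∧
      ∀ g : G →ₗ[C] G', (∀ x ∈ F, K.Respects K' g x) →
        (s.realize (c.map c' g ∘ Sum.elim v xs) = c.map c' g (s.realize (Sum.elim v xs)) ∧
        t.realize (c.map c' g ∘ Sum.elim v xs) = c.map c' g (t.realize (Sum.elim v xs))) ∧
        ∀ a a', c.emb a = s.realize (Sum.elim v xs) → c.emb a' = t.realize (Sum.elim v xs) →
          K.Respects K' g (a' - a) := by
    intro s t
    obtain ⟨F₁, hF₁, v₁, g₁⟩ := c.exists_admissible_term c' hρ s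
    obtain ⟨F₂, hF₂, v₂, g₂⟩ := c.exists_admissible_term c' hρ t
    have hF := hF₁.union hF₂
    by_cases h : ∃ a a', c.emb a = s.realize (Sum.elim v xs) ∧
        c.emb a' = t.realize (Sum.elim v xs)
    · obtain ⟨a, a', ha, ha'⟩ := h
      refine ⟨insert (a' - a) (F₁ ∪ F₂), hF.insert (Submodule.sub_mem _
        (hF a' (Finset.mem_union_right _ (v₂ a' ha')))
        (hF a (Finset.mem_union_left _ (v₁ a ha)))), fun g hg =>
        ⟨⟨g₁ g fun x hx => hg x (by simp [hx]), g₂ g fun x hx => hg x (by simp [hx])⟩, ?_⟩⟩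
      intro e e' he he'
      rw [c.injective (he.trans ha.symm), c.injective (he'.trans ha'.symm)]
      exact hg _ (Finset.mem_insert_self _ _)
    · exact ⟨F₁ ∪ F₂, hF, fun g hg => ⟨⟨g₁ g fun x hx => hg x (by simp [hx]),
        g₂ g fun x hx => hg x (by simp [hx])⟩, fun a a' ha ha' => absurd ⟨a, a', ha, ha'⟩ h⟩⟩
  induction hψ with
  | falsum => exact ⟨∅, fun x hx => absurd hx (Finset.notMem_empty x), fun g _ => Iff.rfl⟩
  | of_isAtomic h =>
    cases h with
    | equal s t =>
      obtain ⟨F, hF, h⟩ := two s t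
      refine ⟨F, hF, fun g hg => ?_⟩
      obtain ⟨⟨h1, h2⟩, h3⟩ := h g hg
      rw [BoundedFormula.realize_bdEqual, BoundedFormula.realize_bdEqual, ← Sum.comp_elim, h1, h2]
      exact c.map_eq_iff c' h3
    | @rel l R ts =>
      match l, R with
      | 2, HamelRel.lt i =>
        obtain ⟨F, hF, h⟩ := two (ts 0) (ts 1)
        refine ⟨F, hF, fun g hg => ?_⟩
        obtain ⟨⟨h1, h2⟩, h3⟩ := h g hg
        refine BoundedFormula.realize_rel.trans (Iff.trans ((relMap_lt i _).trans ?_)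
          ((relMap_lt i _).symm.trans BoundedFormula.realize_rel.symm))
        rw [← Sum.comp_elim, h1, h2]
        exact c.map_lt c' i h3
  | imp _ _ h1 h2 =>
    obtain ⟨F₁, hF₁, g₁⟩ := h1
    obtain ⟨F₂, hF₂, g₂⟩ := h2
    refine ⟨F₁ ∪ F₂, hF₁.union hF₂, fun g hg => ?_⟩
    rw [BoundedFormula.realize_imp, BoundedFormula.realize_imp,
      g₁ g fun x hx => hg x (Finset.mem_union_left _ hx),
      g₂ g fun x hx => hg x (Finset.mem_union_right _ hx)]

/-- The subspace of elements that are given by terms in `a`. -/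
def termSpan {β : Type*} (a : β → X) : Submodule C G where
  carrier := {g | ∃ t : (hamelLang C).Term β, c.emb g = t.realize a}
  zero_mem' := ⟨tZero, by rw [realize_tZero, c.zero]⟩
  add_mem' := by
    rintro g h ⟨s, hs⟩ ⟨t, ht⟩
    exact ⟨tAdd s t, by rw [realize_tAdd, ← hs, ← ht, c.add]⟩
  smul_mem' := by
    rintro r g ⟨t, ht⟩
    exact ⟨tSmul r t, by rw [realize_tSmul, ← ht, c.smul]⟩

/-- Equations between terms belong to the quantifier-free type, so sending `t(a)` to `t(a')` is well
defined on `termSpan`, and linear as terms are closed under the operations. It extends to `G` as any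
linear map on a subspace does. -/
theorem exists_linearMap_of_sameQFType {β : Type*} {a : β → X} {a' : β → X'}
    (h : SameQFType (hamelLang C) a a') :
    ∃ g : G →ₗ[C] G', ∀ (t : (hamelLang C).Term β) (x : G), c.emb x = t.realize a →
      c'.emb (g x) = t.realize a' := by
  have heq : ∀ s t : (hamelLang C).Term β, s.realize a = t.realize a ↔
      s.realize a' = t.realize a' := fun s t => by
    simpa using h _ (isQF_equal s t)
  have hex : ∀ x : c.termSpan a, ∃ y : G', ∀ t : (hamelLang C).Term β,
      c.emb x = t.realize a → c'.emb y = t.realize a' := by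
    rintro ⟨x, s, hs⟩
    rcases c'.cases (s.realize a') with ⟨y, hy⟩ | ⟨hb, hs', -⟩
    · exact ⟨y, fun t ht => hy.trans ((heq s t).1 (hs.symm.trans ht))⟩
    · have := (heq s tInfty).2 (by rw [hs', realize_tInfty])
      rw [realize_tInfty, ← hs] at this
      exact absurd this (c.ne_infty hb x)
  choose f hf using hex
  let f' : c.termSpan a →ₗ[C] G' :=
    { toFun := f
      map_add' := by
        rintro x y
        obtain ⟨s, hs⟩ := x.2
        obtain ⟨t, ht⟩ := y.2
        apply c'.injective
        rw [hf (x + y) (tAdd s t) (by rw [realize_tAdd, ← hs, ← ht, c.add]; rfl), realize_tAdd,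
          ← c'.add, hf x s hs, hf y t ht]
      map_smul' := by
        rintro r x
        obtain ⟨t, ht⟩ := x.2
        apply c'.injective
        rw [hf (r • x) (tSmul r t) (by rw [realize_tSmul, ← ht, c.smul]; rfl), realize_tSmul,
          RingHom.id_apply, ← c'.smul, hf x t ht] }
  obtain ⟨g, hg⟩ := f'.exists_extend
  refine ⟨g, fun t x hx => ?_⟩
  have h1 : g x = f ⟨x, t, hx⟩ := LinearMap.congr_fun hg ⟨x, t, hx⟩
  rw [h1]
  exact hf ⟨x, t, hx⟩ t hx

theorem respects_of_sameQFType {β : Type*} {a : β → X} {a' : β → X'}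
    (h : SameQFType (hamelLang C) a a') {g : G →ₗ[C] G'}
    (hg : ∀ (t : (hamelLang C).Term β) (x : G), c.emb x = t.realize a →
      c'.emb (g x) = t.realize a') {x : G} (hx : x ∈ c.termSpan a) : K.Respects K' g x := by
  obtain ⟨t, ht⟩ := hx
  have ht' := hg t x ht
  have hsign : ∀ i, (K'.pos i (g x) ↔ K.pos i x) ∧ (K'.pos i (-g x) ↔ K.pos i (-x)) := by
    intro i
    have h1 := h _ (isQF_fLt i tZero t)
    have h2 := h _ (isQF_fLt i t tZero)
    rw [realize_fLt, realize_fLt, realize_tZero, realize_tZero, ← ht, ← ht', ← c.zero, ← c'.zero,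
      c.lt, c'.lt] at h1 h2
    rw [sub_zero, sub_zero] at h1
    rw [zero_sub, zero_sub] at h2
    exact ⟨h1.symm, h2.symm⟩
  refine ⟨hsign, ?_⟩
  by_cases hx0 : x = 0
  · rw [hx0, _root_.map_zero, K.val_zero, K'.val_zero, _root_.map_zero]
  have hgx0 : g x ≠ 0 := fun h0 => by
    rcases K.pos_total x hx0 with h1 | h1
    · exact K'.not_pos_zero 0 (h0 ▸ (hsign 0).1.2 h1)
    · have := (hsign 0).2.2 h1
      rw [h0, neg_zero] at this
      exact K'.not_pos_zero 0 this
  apply c'.injective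
  rw [hg (tVal t) (K.val x) (by rw [realize_tVal, ← ht, c.val x hx0]), realize_tVal, ← ht',
    c'.val _ hgx0]

theorem val_mem_termSpan {β : Type*} {a : β → X} {x : G} (hx : x ∈ c.termSpan a) :
    K.val x ∈ c.termSpan a := by
  by_cases hx0 : x = 0
  · rw [hx0, K.val_zero]
    exact Submodule.zero_mem _
  obtain ⟨t, ht⟩ := hx
  exact ⟨tVal t, by rw [realize_tVal, ← ht, c.val x hx0]⟩

-- The type gives a partial embedding on the span of the terms in `a`, and `ψ` requires a map
-- respecting only finitely many further elements; this is what `HasExtension` supplies.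
include c c' in
theorem back_and_forth (hKK' : K.HasExtension K') {β : Type*} {a : β → X} {a' : β → X'}
    (h : SameQFType (hamelLang C) a a') (x : X) {ψ : (hamelLang C).Formula (Option β)}
    (hψ : BoundedFormula.IsQF ψ) (hx : ψ.Realize fun o => o.elim x a) :
    ∃ y : X', ψ.Realize fun o => o.elim y a' := by
  obtain ⟨g₀, hg₀⟩ := c.exists_linearMap_of_sameQFType c' h
  obtain ⟨d, hd⟩ : ∃ d, ∀ e, c.emb e = x → e = d := by
    rcases c.cases x with ⟨d, hd⟩ | ⟨-, -, h⟩
    · exact ⟨d, fun e he => c.injective (he.trans hd.symm)⟩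
    · exact ⟨0, fun e he => absurd he (h e)⟩
  obtain ⟨F, hF, hFψ⟩ := c.exists_admissible_formula c' (A := c.termSpan a) (d := d)
    (v := fun o : Option β => o.elim x a) (xs := default) (by
      rintro ((_ | z) | z) e he
      · exact Or.inr (hd e he)
      · exact Or.inl ⟨.var z, he⟩
      · exact z.elim0) hψ
  obtain ⟨g, hgA, hg⟩ := hKK' (c.termSpan a) g₀ d F (fun _ => c.val_mem_termSpan)
    (fun x hx => c.respects_of_sameQFType c' h hg₀ hx) hF
  refine ⟨c.map c' g x, ?_⟩
  have h1 := (hFψ g hg).2 hx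
  rw [Formula.Realize]
  convert h1 using 1
  · funext o
    rcases o with _ | z
    · rfl
    · change a' z = c.map c' g (a z)
      rcases c.cases (a z) with ⟨e, he⟩ | ⟨hb, he, -⟩
      · rw [← he, map_emb, hgA e ⟨.var z, he⟩, hg₀ (.var z) e he]
        rfl
      · have := (h _ (isQF_equal (.var z) tInfty)).1 (by simpa using he)
        rw [he, map_infty]
        simpa using this

end Carrier

end Carriers

end Hamel

namespace Hamel

/-! ### Far members of an indiscernible sequence as parameters -/

section Indiscernibility

open FirstOrder.Language

variable {L : FirstOrder.Language.{u, v}} {M : Type*} [L.Structure M]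

theorem IndiscernibleOn.mono {A : Set M} {I : Type*} [LinearOrder I] {J J' : Set I}
    {V : Type*} {d : I → V → M} (h : IndiscernibleOn L A J d) (hJ : J' ⊆ J) :
    IndiscernibleOn L A J' d :=
  fun k φ s t hs ht hsJ htJ => h k φ s t hs ht (fun i => hJ (hsJ i)) fun i => hJ (htJ i)

theorem IndiscernibleOn.realize_terms {A : Set M} {I : Type*} [LinearOrder I] {J : Set I}
    {V : Type*} {d : I → V → M} (h : IndiscernibleOn L A J d) {k : ℕ} (θ : L.Formula (Fin k))
    (t : L.Term (A ⊕ V)) {s s' : Fin k → I} (hs : StrictMono s) (hs' : StrictMono s')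
    (hsJ : ∀ i, s i ∈ J) (hsJ' : ∀ i, s' i ∈ J) :
    (θ.Realize fun i => t.realize (Sum.elim (fun x : A => (x : M)) (d (s i)))) ↔
      θ.Realize fun i => t.realize (Sum.elim (fun x : A => (x : M)) (d (s' i))) := by
  have := h k (BoundedFormula.subst θ fun i => t.relabel (Sum.map id fun v => (i, v))) s s' hs hs'
    hsJ hsJ'
  simp only [Formula.Realize, BoundedFormula.realize_subst, Term.realize_relabel] at this ⊢
  convert this using 4 <;>
  · funext x
    rcases x with x | x <;> rfl

/-- The terms of a sequence with indices between `m` and `N`. -/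
def outerTerms {V : Type*} (N : ℤ) (d : ℤ → V → M) (m : ℤ) : Set M :=
  {z | ∃ p, (p < -m ∨ m < p) ∧ -N ≤ p ∧ p ≤ N ∧ ∃ v, d p v = z}

theorem outerTerms_anti {V : Type*} {N : ℤ} {d : ℤ → V → M} {m m' : ℤ} (h : m' ≤ m) :
    outerTerms N d m ⊆ outerTerms N d m' := by
  rintro z ⟨p, hp, hp'⟩
  exact ⟨p, by omega, hp'⟩

/-- A fixed index outside `[-m, m]` is on the same side of every index inside, so adding finitely
many such indices to increasing tuples inside does not disturb their common order type. -/
theorem IndiscernibleOn.outerTerms {V : Type*} {N : ℤ} {d : ℤ → V → M}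
    (h : IndiscernibleOn L ∅ (Set.Icc (-N) N) d) {m : ℤ} (hm : m ≤ N) :
    IndiscernibleOn L (outerTerms N d m) (Set.Icc (-m) m) d := by
  intro k φ s t hs ht hsm htm
  choose p hp hpl hpr v hv using fun q : Hamel.outerTerms N d m => q.2
  let Z := ↥((Finset.Icc (-N) N).filter fun p => p < -m ∨ m < p)
  have hZ : ∀ z : Z, (-N ≤ (z : ℤ) ∧ (z : ℤ) ≤ N) ∧ ((z : ℤ) < -m ∨ m < (z : ℤ)) := fun z => by
    have := Finset.mem_filter.1 z.2
    exact ⟨Finset.mem_Icc.1 this.1, this.2⟩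
  let e : Hamel.outerTerms N d m → Z := fun q => 
    ⟨p q, Finset.mem_filter.2 ⟨Finset.mem_Icc.2 ⟨hpl q, hpr q⟩, hp q⟩⟩
  let ψ : L.Formula ((∅ : Set M) ⊕ ((Z ⊕ Fin k) × V)) := φ.relabel (Sum.elim
    (fun q => Sum.inr (Sum.inl (e q), v q)) (fun x => Sum.inr (Sum.inr x.1, x.2)))
  let f : (Fin k → ℤ) → Z ⊕ Fin k → ℤ := fun s => Sum.elim (fun z => (z : ℤ)) s
  have hf : ∀ s : Fin k → ℤ, (∀ i, s i ∈ Set.Icc (-m) m) → ∀ w, f s w ∈ Set.Icc (-N) N := by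
    rintro s hs (z | i)
    · exact (hZ z).1
    · have := hs i
      exact ⟨(by omega : -N ≤ -m).trans this.1, this.2.trans hm⟩
  have key := h.realize_iff (f s) (f t) (by
    rintro (z | i) (z' | i')
    · exact Iff.rfl
    · have h1 := (hZ z).2
      have h2 := hsm i'
      have h3 := htm i'
      change (z : ℤ) < s i' ↔ (z : ℤ) < t i'
      rw [Set.mem_Icc] at h2 h3
      omega
    · have h1 := (hZ z').2
      have h2 := hsm i
      have h3 := htm i
      change s i < (z' : ℤ) ↔ t i < (z' : ℤ)
      rw [Set.mem_Icc] at h2 h3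
      omega
    · exact hs.lt_iff_lt.trans ht.lt_iff_lt.symm) (hf s hsm) (hf t htm) ψ
  simp only [ψ, Formula.realize_relabel] at key
  convert key using 2 <;>
  · funext x
    rcases x with x | x
    · exact (hv x).symm
    · rfl

theorem IndiscernibleOn.uniform₂ {A : Set M} {m : ℤ} {J : Set ℤ} {V : Type*} {d : ℤ → V → M}
    (h : IndiscernibleOn L A (Set.Icc (-m) m ∩ J) d) (t : L.Term (A ⊕ V)) {R : ℤ → ℤ → Prop}
    (θ : L.Formula (Fin 2))
    (hR : ∀ j k, -m ≤ j → j < k → k ≤ m → j ∈ J → k ∈ J → (R j k ↔ θ.Realize fun i =>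
      t.realize (Sum.elim (fun x : A => (x : M)) (d (![j, k] i))))) :
    BiorderedSpace.Uniform₂ m J R := by
  intro j j' k k' h1 h2 h3 h4 h5 h6 hj hj' hk hk' h7
  rw [hR _ _ h1 h2 h3 hj hj'] at h7
  rw [hR _ _ h4 h5 h6 hk hk']
  refine (h.realize_terms θ t ?_ ?_ ?_ ?_).1 h7
  · rw [Fin.strictMono_iff_lt_succ]
    intro i
    fin_cases i
    exact h2
  · rw [Fin.strictMono_iff_lt_succ]
    intro i
    fin_cases i
    exact h5
  · intro i
    fin_cases i
    exacts [⟨⟨h1, h2.le.trans h3⟩, hj⟩, ⟨⟨h1.trans h2.le, h3⟩, hj'⟩]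
  · intro i
    fin_cases i
    exacts [⟨⟨h4, h5.le.trans h6⟩, hk⟩, ⟨⟨h4.trans h5.le, h6⟩, hk'⟩]

theorem IndiscernibleOn.uniform₃ {A : Set M} {m : ℤ} {V : Type*} {d : ℤ → V → M}
    (h : IndiscernibleOn L A (Set.Icc (-m) m) d) (t : L.Term (A ⊕ V)) {R : ℤ → ℤ → ℤ → Prop}
    (θ : L.Formula (Fin 3))
    (hR : ∀ j k l, -m ≤ j → j < k → k < l → l ≤ m → (R j k l ↔ θ.Realize fun i =>
      t.realize (Sum.elim (fun x : A => (x : M)) (d (![j, k, l] i))))) :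
    BiorderedSpace.Uniform₃ m R := by
  have key : ∀ {j k l : ℤ}, -m ≤ j → j < k → k < l → l ≤ m →
      StrictMono ![j, k, l] ∧ ∀ i, ![j, k, l] i ∈ Set.Icc (-m) m := by
    intro j k l h1 h2 h3 h4
    constructor
    · rw [Fin.strictMono_iff_lt_succ]
      intro i
      fin_cases i
      exacts [h2, h3]
    · intro i
      fin_cases i
      exacts [⟨h1, by simp; omega⟩, ⟨by simp; omega, by simp; omega⟩, ⟨by simp; omega, h4⟩]
  intro j j' j'' k k' k'' h1 h2 h3 h4 h5 h6 h7 h8 h9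
  rw [hR _ _ _ h1 h2 h3 h4] at h9
  rw [hR _ _ _ h5 h6 h7 h8]
  exact (h.realize_terms θ t (key h1 h2 h3 h4).1 (key h5 h6 h7 h8).1 (key h1 h2 h3 h4).2
    (key h5 h6 h7 h8).2).1 h9

/-- A property of one term is uniform. -/
theorem IndiscernibleOn.realize_term_iff {A : Set M} {J : Set ℤ} {V : Type*} {d : ℤ → V → M}
    (h : IndiscernibleOn L A J d) (t : L.Term (A ⊕ V)) (θ : L.Formula (Fin 1)) {j k : ℤ}
    (hj : j ∈ J) (hk : k ∈ J) :
    (θ.Realize fun _ => t.realize (Sum.elim (fun x : A => (x : M)) (d j))) ↔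
      θ.Realize fun _ => t.realize (Sum.elim (fun x : A => (x : M)) (d k)) :=
  h.realize_terms θ t (s := fun _ => j) (s' := fun _ => k) (Subsingleton.strictMono _)
    (Subsingleton.strictMono _) (fun _ => hj) fun _ => hk

end Indiscernibility

/-! ### Terms along indiscernible sequences, and local distality -/

section Carriers

open FirstOrder.Language

variable {C : Type u} [Field C] [LinearOrder C] [IsStrictOrderedRing C]
variable {G : Type*} [AddCommGroup G] [Module C G]

/-- The sequence `x` is increasing, decreasing or constant for the relation `i`, so the sign of `x 0
+ g` is caught between those at `-1` and `1`, which agree. -/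
theorem BiorderedSpace.pos_translate_iff (K : BiorderedSpace C G) {i : Fin 2} {N : ℤ} (hN : 1 ≤ N)
    {x : ℤ → G} {g : G} (h₁ : BiorderedSpace.Uniform₂ N Set.univ fun j k => K.pos i (x k - x j))
    (h₂ : BiorderedSpace.Uniform₂ N Set.univ fun j k => K.pos i (x j - x k))
    (h₃ : K.pos i (x (-1) + g) ↔ K.pos i (x 1 + g)) :
    K.pos i (x 0 + g) ↔ K.pos i (x 1 + g) := by
  have e : ∀ j k, x j + g = (x j - x k) + (x k + g) := fun j k => by abel
  by_cases h : K.pos i (x 1 - x 0)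
  · have h' := h₁ 0 1 (-1) 0 (by omega) (by omega) hN (by omega) (by omega) (by omega) trivial
      trivial trivial trivial h
    refine ⟨fun h4 => ?_, fun h4 => ?_⟩
    · rw [e 1 0]
      exact K.pos_add i _ _ h h4
    · rw [e 0 (-1)]
      exact K.pos_add i _ _ h' (h₃.2 h4)
  · by_cases h0 : K.pos i (x 0 - x 1)
    · have h' := h₂ 0 1 (-1) 0 (by omega) (by omega) hN (by omega) (by omega) (by omega) trivial
        trivial trivial trivial h0
      refine ⟨fun h4 => h₃.1 ?_, fun h4 => ?_⟩
      · rw [e (-1) 0]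
        exact K.pos_add i _ _ h' h4
      · rw [e 0 1]
        exact K.pos_add i _ _ h0 h4
    · refine ⟨fun h4 => ?_, fun h4 => ?_⟩ <;> by_contra h5
      · have := K.not_pos_add i _ _ h0 h5
        rw [← e] at this
        exact this h4
      · have := K.not_pos_add i _ _ h h5
        rw [← e] at this
        exact this h4

namespace Carrier

variable {K : BiorderedSpace C G} {X : Type*} [(hamelLang C).Structure X] {b : Bool}
variable (c : Carrier K X b)

theorem sub_emb (x y : G) : sAdd C (c.emb x) (sSmul (-1 : C) (c.emb y)) = c.emb (x - y) := by
  rw [c.smul, c.add, neg_one_smul, sub_eq_add_neg]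

theorem val_sub_emb {x y : G} (h : x ≠ y) :
    sVal C (sAdd C (c.emb x) (sSmul (-1 : C) (c.emb y))) = c.emb (K.val (x - y)) := by
  rw [sub_emb, c.val _ (sub_ne_zero.2 h)]

theorem uniform_pos {Q : Set X} {J : Set ℤ} {V : Type*} {d : ℤ → V → X} {m : ℤ}
    (h : IndiscernibleOn (hamelLang C) Q (Set.Icc (-m) m ∩ J) d)
    (T : (hamelLang C).Term (Q ⊕ V)) {x : ℤ → G}
    (hT : ∀ j, -m ≤ j → j ≤ m → j ∈ J →
      T.realize (Sum.elim (fun z : Q => (z : X)) (d j)) = c.emb (x j)) (i : Fin 2) :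
    BiorderedSpace.Uniform₂ m J (fun j k => K.pos i (x k - x j)) ∧
      BiorderedSpace.Uniform₂ m J (fun j k => K.pos i (x j - x k)) := by
  constructor
  · refine h.uniform₂ T (fLt i (.var 0) (.var 1)) fun j k h1 h2 h3 hj hk => ?_
    rw [realize_fLt, Term.realize_var, Term.realize_var]
    change _ ↔ sLt C i (T.realize (Sum.elim _ (d j))) (T.realize (Sum.elim _ (d k)))
    rw [hT j h1 (by omega) hj, hT k (by omega) h3 hk, c.lt]
  · refine h.uniform₂ T (fLt i (.var 1) (.var 0)) fun j k h1 h2 h3 hj hk => ?_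
    rw [realize_fLt, Term.realize_var, Term.realize_var]
    change _ ↔ sLt C i (T.realize (Sum.elim _ (d k))) (T.realize (Sum.elim _ (d j)))
    rw [hT j h1 (by omega) hj, hT k (by omega) h3 hk, c.lt]

theorem uniform_eq {Q : Set X} {J : Set ℤ} {V : Type*} {d : ℤ → V → X} {m : ℤ}
    (h : IndiscernibleOn (hamelLang C) Q (Set.Icc (-m) m ∩ J) d)
    (T : (hamelLang C).Term (Q ⊕ V)) {x : ℤ → G}
    (hT : ∀ j, -m ≤ j → j ≤ m → j ∈ J →
      T.realize (Sum.elim (fun z : Q => (z : X)) (d j)) = c.emb (x j)) :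
    BiorderedSpace.Uniform₂ m J (fun j k => x j = x k) := by
  refine h.uniform₂ T (Term.equal (.var 0) (.var 1)) fun j k h1 h2 h3 hj hk => ?_
  rw [Formula.realize_equal, Term.realize_var, Term.realize_var]
  change _ ↔ T.realize (Sum.elim _ (d j)) = T.realize (Sum.elim _ (d k))
  rw [hT j h1 (by omega) hj, hT k (by omega) h3 hk, c.injective.eq_iff]

/-- Distinctness of the `x j` is needed because at `0` the symbol `v` gives `∞`, while `K.val` gives
`0`. -/
theorem uniformDistances {Q : Set X} {V : Type*} {d : ℤ → V → X} {m : ℤ}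
    (h : IndiscernibleOn (hamelLang C) Q (Set.Icc (-m) m) d)
    (T : (hamelLang C).Term (Q ⊕ V)) {x : ℤ → G}
    (hT : ∀ j, -m ≤ j → j ≤ m →
      T.realize (Sum.elim (fun z : Q => (z : X)) (d j)) = c.emb (x j))
    (hx : ∀ j k, -m ≤ j → j < k → k ≤ m → x j ≠ x k) :
    K.UniformDistances m x := by
  have h' := h.mono (Set.inter_subset_left (t := Set.univ))
  have hT' : ∀ j, -m ≤ j → j ≤ m → j ∈ Set.univ →
    T.realize (Sum.elim (fun z : Q => (z : X)) (d j)) = c.emb (x j) := fun j h1 h2 _ => hT j h1 h2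
  let D : Fin 3 → Fin 3 → (hamelLang C).Term (Fin 3) := fun a a' =>
    tVal (tAdd (.var a) (tSmul (-1 : C) (.var a')))
  have hD : ∀ j k l, -m ≤ j → j < k → k < l → l ≤ m → ∀ a a', a < a' →
      (D a a').realize (fun i => T.realize (Sum.elim (fun z : Q => (z : X)) (d (![j, k, l] i)))) =
        c.emb (K.val (x (![j, k, l] a) - x (![j, k, l] a'))) := by
    intro j k l h1 h2 h3 h4 a a' haa
    have hm : ∀ a, -m ≤ ![j, k, l] a ∧ ![j, k, l] a ≤ m := by
      intro a
      fin_cases a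
      exacts [⟨h1, by simp; omega⟩, ⟨by simp; omega, by simp; omega⟩, ⟨by simp; omega, h4⟩]
    have hlt : ![j, k, l] a < ![j, k, l] a' := by
      fin_cases a <;> fin_cases a' <;> simp at haa ⊢ <;> omega
    rw [realize_tVal, realize_tAdd, realize_tSmul, Term.realize_var, Term.realize_var,
      hT _ (hm a).1 (hm a).2, hT _ (hm a').1 (hm a').2,
      c.val_sub_emb (hx _ _ (hm a).1 hlt (hm a').2)]
  have heq : ∀ a₁ a₁' a₂ a₂', a₁ < a₁' → a₂ < a₂' → BiorderedSpace.Uniform₃ m fun j k l =>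
      K.val (x (![j, k, l] a₁) - x (![j, k, l] a₁')) =
        K.val (x (![j, k, l] a₂) - x (![j, k, l] a₂')) := by
    intro a₁ a₁' a₂ a₂' ha₁ ha₂
    refine h.uniform₃ T (Term.equal (D a₁ a₁') (D a₂ a₂')) fun j k l h1 h2 h3 h4 => ?_
    rw [Formula.realize_equal, hD j k l h1 h2 h3 h4 _ _ ha₁, hD j k l h1 h2 h3 h4 _ _ ha₂,
      c.injective.eq_iff]
  have hlt : ∀ a₁ a₁' a₂ a₂', a₁ < a₁' → a₂ < a₂' → BiorderedSpace.Uniform₃ m fun j k l =>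
      K.pos 0 (K.val (x (![j, k, l] a₁) - x (![j, k, l] a₁')) -
        K.val (x (![j, k, l] a₂) - x (![j, k, l] a₂'))) := by
    intro a₁ a₁' a₂ a₂' ha₁ ha₂
    refine h.uniform₃ T (fLt 0 (D a₂ a₂') (D a₁ a₁')) fun j k l h1 h2 h3 h4 => ?_
    rw [realize_fLt, hD j k l h1 h2 h3 h4 _ _ ha₁, hD j k l h1 h2 h3 h4 _ _ ha₂, c.lt]
  exact
    { sign := (c.uniform_pos h' T hT' 1).2
      eq := c.uniform_eq h' T hT'
      left := heq 0 1 0 2 (by decide) (by decide)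
      left_lt := hlt 1 2 0 2 (by decide) (by decide)
      right := heq 1 2 0 2 (by decide) (by decide)
      right_lt := hlt 0 1 0 2 (by decide) (by decide) }

theorem uniformValues {A : Set X} {V : Type*} {d : ℤ → V → X} {m : ℤ}
    (h : IndiscernibleOn (hamelLang C) A (Set.Icc (-m) m ∩ {0}ᶜ) d)
    (t : (hamelLang C).Term (A ⊕ V)) {y : ℤ → G}
    (ht : ∀ j, -m ≤ j → j ≤ m →
      t.realize (Sum.elim (fun z : A => (z : X)) (d j)) = c.emb (y j))
    (hy : ∀ j, -m ≤ j → j ≤ m → y j ≠ 0) :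
    K.UniformValues m y := by
  have hv : ∀ j, -m ≤ j → j ≤ m → j ∈ ({0}ᶜ : Set ℤ) →
      (tVal t).realize (Sum.elim (fun z : A => (z : X)) (d j)) = c.emb (K.val (y j)) := by
    intro j h1 h2 _
    rw [realize_tVal, ht j h1 h2, c.val _ (hy j h1 h2)]
  refine ⟨hy, (c.uniform_pos h _ hv 0).1, (c.uniform_pos h _ hv 0).2, ?_⟩
  intro j j' k k' h1 h2 h3 h4 h5 h6 hj hj' hk hk' _
  have := h.realize_term_iff t (fLt 1 tZero (.var 0)) (j := k) (k := k') ⟨⟨h4, by omega⟩, hk⟩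
    ⟨⟨by omega, h6⟩, hk'⟩
  rwa [realize_fLt, realize_fLt, realize_tZero, realize_tZero, Term.realize_var, Term.realize_var,
    ht k h4 (by omega), ht k' (by omega) h6, ← c.zero, c.lt, c.lt, sub_zero, sub_zero] at this

/-- The values of a term along a sequence are a translate of those of an indiscernible sequence. -/
def Represented (A : Set X) (N : ℤ) {V : Type*} (d : ℤ → V → X)
    (m : ℤ) (t : (hamelLang C).Term (A ⊕ V)) : Prop :=
  (b = true ∧ ∀ j, -m ≤ j → j ≤ m →
    t.realize (Sum.elim (fun z : A => (z : X)) (d j)) = sInfty C) ∨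
  ∃ (T : (hamelLang C).Term (outerTerms N d m ⊕ V)) (x : ℤ → G) (g : G),
    ∀ j, -m ≤ j → j ≤ m →
      T.realize (Sum.elim (fun z : outerTerms N d m => (z : X)) (d j)) = c.emb (x j) ∧
      t.realize (Sum.elim (fun z : A => (z : X)) (d j)) = c.emb (x j + g)

variable {c}
variable {A : Set X} {N m : ℤ} {V : Type*} {d : ℤ → V → X}

theorem Represented.of_eq_infty {t : (hamelLang C).Term (A ⊕ V)}
    (h : ∀ j, -m ≤ j → j ≤ m → t.realize (Sum.elim (fun z : A => (z : X)) (d j)) = sInfty C) :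
    c.Represented A N d m t := by
  cases b with
  | true => exact Or.inl ⟨rfl, h⟩
  | false =>
    refine Or.inr ⟨tZero, fun _ => 0, 0, fun j h1 h2 => ⟨?_, ?_⟩⟩
    · rw [realize_tZero, c.zero]
    · rw [h j h1 h2, add_zero, c.infty_eq rfl]

theorem Represented.of_const {t : (hamelLang C).Term (A ⊕ V)} {x : X}
    (h : ∀ j, -m ≤ j → j ≤ m → t.realize (Sum.elim (fun z : A => (z : X)) (d j)) = x) :
    c.Represented A N d m t := by
  rcases c.cover x with rfl | ⟨g, rfl⟩
  · exact .of_eq_infty h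
  · exact Or.inr ⟨tZero, fun _ => 0, g, fun j h1 h2 => ⟨by rw [realize_tZero, c.zero],
      by rw [h j h1 h2, zero_add]⟩⟩

/-- A coordinate of the sequence is `∞` at all indices or at none, by indiscernibility over `∅`. -/
theorem Represented.var (hd : IndiscernibleOn (hamelLang C) ∅ (Set.Icc (-N) N) d) (hmN : m ≤ N) (z : A ⊕ V) :
    c.Represented A N d m (.var z) := by
  rcases z with a | v
  · exact .of_const (x := (a : X)) fun j _ _ => rfl
  · by_cases h : ∀ j, -m ≤ j → j ≤ m → ∃ g, c.emb g = d j v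
    · choose! x hx using h
      exact Or.inr ⟨.var (Sum.inr v), x, 0, fun j h1 h2 =>
        ⟨(hx j h1 h2).symm, by rw [add_zero]; exact (hx j h1 h2).symm⟩⟩
    · push Not at h
      obtain ⟨j₀, h1, h2, h3⟩ := h
      refine .of_eq_infty fun j h4 h5 => ?_
      have h6 : d j₀ v = (sInfty C : X) := by
        rcases c.cover (d j₀ v) with h | ⟨g, hg⟩
        · exact h
        · exact absurd hg (h3 g)
      have := (hd.realize_term_iff (.var (Sum.inr v)) (Term.equal (.var 0) tInfty) (j := j₀)
        (k := j) ⟨by omega, by omega⟩ ⟨by omega, by omega⟩).1 (by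
          rw [Formula.realize_equal, realize_tInfty]
          exact h6)
      rw [Formula.realize_equal, realize_tInfty] at this
      exact this

theorem Represented.add {s t : (hamelLang C).Term (A ⊕ V)} (hs : c.Represented A N d m s)
    (ht : c.Represented A N d m t) : c.Represented A N d m (tAdd s t) := by
  rcases hs with ⟨hb, hs⟩ | ⟨T, x, g, hs⟩
  · exact .of_eq_infty fun j h1 h2 => by rw [realize_tAdd, hs j h1 h2, c.infty_add hb]
  rcases ht with ⟨hb, ht⟩ | ⟨T', x', g', ht⟩
  · exact .of_eq_infty fun j h1 h2 => by rw [realize_tAdd, ht j h1 h2, c.add_infty hb]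
  refine Or.inr ⟨tAdd T T', fun j => x j + x' j, g + g', fun j h1 h2 => ⟨?_, ?_⟩⟩
  · rw [realize_tAdd, (hs j h1 h2).1, (ht j h1 h2).1, c.add]
  · rw [realize_tAdd, (hs j h1 h2).2, (ht j h1 h2).2, c.add]
    congr 1
    beta_reduce
    abel

theorem Represented.smul {t : (hamelLang C).Term (A ⊕ V)} (r : C)
    (ht : c.Represented A N d m t) : c.Represented A N d m (tSmul r t) := by
  rcases ht with ⟨hb, ht⟩ | ⟨T', x', g', ht⟩
  · exact .of_eq_infty fun j h1 h2 => by rw [realize_tSmul, ht j h1 h2, c.smul_infty hb]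
  refine Or.inr ⟨tSmul r T', fun j => r • x' j, r • g', fun j h1 h2 => ⟨?_, ?_⟩⟩
  · rw [realize_tSmul, (ht j h1 h2).1, c.smul]
  · rw [realize_tSmul, (ht j h1 h2).2, c.smul, smul_add]

/-- The sign of a represented term does not jump at the middle of the sequence. -/
theorem pos_iff_of_represented (hd : IndiscernibleOn (hamelLang C) ∅ (Set.Icc (-N) N) d)
    (hA : IndiscernibleOn (hamelLang C) A (Set.Icc (-N) N \ {0}) d) (hm : 1 ≤ m) (hmN : m ≤ N)
    {t : (hamelLang C).Term (A ⊕ V)} {T : (hamelLang C).Term (outerTerms N d m ⊕ V)} {x : ℤ → G}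
    {g : G} (h : ∀ j, -m ≤ j → j ≤ m →
      T.realize (Sum.elim (fun z : outerTerms N d m => (z : X)) (d j)) = c.emb (x j) ∧
      t.realize (Sum.elim (fun z : A => (z : X)) (d j)) = c.emb (x j + g)) (i : Fin 2) :
    (K.pos i (x 0 + g) ↔ K.pos i (x 1 + g)) ∧ (K.pos i (-(x 0 + g)) ↔ K.pos i (-(x 1 + g))) := by
  have hu := c.uniform_pos ((hd.outerTerms hmN).mono (Set.inter_subset_left (t := Set.univ))) T
    (x := x) (fun j h1 h2 _ => (h j h1 h2).1) i
  constructor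
  · refine K.pos_translate_iff hm hu.1 hu.2 ?_
    have := hA.realize_term_iff t (fLt i tZero (.var 0)) (j := -1) (k := 1)
      ⟨⟨by omega, by omega⟩, by simp⟩ ⟨⟨by omega, by omega⟩, by simp⟩
    rwa [realize_fLt, realize_fLt, realize_tZero, realize_tZero, Term.realize_var, Term.realize_var,
      (h (-1) (by omega) (by omega)).2, (h 1 (by omega) (by omega)).2, ← c.zero, c.lt, c.lt,
      sub_zero, sub_zero] at this
  · rw [neg_add, neg_add]
    have e : ∀ j k, -x j - -x k = x k - x j := fun j k => by abel
    refine K.pos_translate_iff (x := fun j => -x j) hm ?_ ?_ ?_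
    · simp only [e]
      exact hu.2
    · simp only [e]
      exact hu.1
    · have := hA.realize_term_iff t (fLt i (.var 0) tZero) (j := -1) (k := 1)
        ⟨⟨by omega, by omega⟩, by simp⟩ ⟨⟨by omega, by omega⟩, by simp⟩
      rwa [realize_fLt, realize_fLt, realize_tZero, realize_tZero, Term.realize_var, Term.realize_var,
        (h (-1) (by omega) (by omega)).2, (h 1 (by omega) (by omega)).2, ← c.zero, c.lt, c.lt,
        zero_sub, zero_sub, neg_add, neg_add] at this

theorem eq_zero_iff_of_represented (hd : IndiscernibleOn (hamelLang C) ∅ (Set.Icc (-N) N) d)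
    (hA : IndiscernibleOn (hamelLang C) A (Set.Icc (-N) N \ {0}) d) (hm : 1 ≤ m) (hmN : m ≤ N)
    {t : (hamelLang C).Term (A ⊕ V)} {T : (hamelLang C).Term (outerTerms N d m ⊕ V)} {x : ℤ → G}
    {g : G} (h : ∀ j, -m ≤ j → j ≤ m →
      T.realize (Sum.elim (fun z : outerTerms N d m => (z : X)) (d j)) = c.emb (x j) ∧
      t.realize (Sum.elim (fun z : A => (z : X)) (d j)) = c.emb (x j + g)) :
    x 0 + g = 0 ↔ x 1 + g = 0 := by
  have key : ∀ y : G, y = 0 ↔ ¬ K.pos 0 y ∧ ¬ K.pos 0 (-y) := by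
    refine fun y => ⟨?_, fun h => ?_⟩
    · rintro rfl
      rw [neg_zero]
      exact ⟨K.not_pos_zero 0, K.not_pos_zero 0⟩
    · by_contra h0
      rcases K.pos_total y h0 with h1 | h1
      exacts [h.1 h1, h.2 h1]
  have := pos_iff_of_represented hd hA hm hmN h 0
  rw [key, key (x 1 + g), this.1, this.2]

/-- By the dichotomy, the value of `x j + g` is constant or the value of `x j - x e` with `e = ±(m +
1)`. The latter is again a term in `d j` and far members of the sequence, since `d e` is far from
the smaller window `[-m, m]`. -/
theorem Represented.val (hK : K.HasValueDichotomy)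
    (hd : IndiscernibleOn (hamelLang C) ∅ (Set.Icc (-N) N) d)
    (hA : IndiscernibleOn (hamelLang C) A (Set.Icc (-N) N \ {0}) d) (hm : 1 ≤ m) (hmN : m + 1 ≤ N)
    {t : (hamelLang C).Term (A ⊕ V)} (ht : c.Represented A N d (m + 1) t) :
    c.Represented A N d m (tVal t) := by
  rcases ht with ⟨hb, ht⟩ | ⟨T, x, g, h⟩
  · exact .of_eq_infty fun j h1 h2 => by
      rw [realize_tVal, ht j (by omega) (by omega), c.val_infty]
  -- If two of the `x j` coincide, all do, and the term is constant on the window.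
  by_cases hx : ∃ j k, -(m + 1) ≤ j ∧ j < k ∧ k ≤ m + 1 ∧ x j = x k
  · obtain ⟨j₀, k₀, h1, h2, h3, h4⟩ := hx
    have hu := c.uniform_eq ((hd.outerTerms hmN).mono (Set.inter_subset_left (t := Set.univ))) T
      (x := x) fun j h1 h2 _ => (h j h1 h2).1
    refine .of_const (x := (tVal t).realize (Sum.elim (fun z : A => (z : X)) (d (m + 1))))
      fun j h5 h6 => ?_
    have h7 := hu j₀ k₀ j (m + 1) h1 h2 h3 (by omega) (by omega) le_rfl trivial trivial trivial
      trivial h4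
    rw [realize_tVal, realize_tVal, (h j (by omega) (by omega)).2,
      (h (m + 1) (by omega) le_rfl).2, h7]
  push Not at hx
  have hA' := hA.mono (J' := Set.Icc (-(m + 1)) (m + 1) ∩ {0}ᶜ) fun j hj =>
    ⟨⟨by have := hj.1.1; omega, by have := hj.1.2; omega⟩, hj.2⟩
  have h10 : ∀ j, -(m + 1) ≤ j → j ≤ m + 1 → j ≠ 0 → (x j + g = 0 ↔ x 1 + g = 0) := by
    intro j h1 h2 h3
    have := hA'.realize_term_iff t (Term.equal (.var 0) tZero) (j := j) (k := 1)
      ⟨⟨h1, h2⟩, h3⟩ ⟨⟨by omega, by omega⟩, by simp⟩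
    rwa [Formula.realize_equal, Formula.realize_equal, realize_tZero, realize_tZero, Term.realize_var,
      Term.realize_var, (h j h1 h2).2, (h 1 (by omega) (by omega)).2, ← c.zero,
      c.injective.eq_iff, c.injective.eq_iff] at this
  -- Vanishing at `1` would force vanishing at `2`, both indices being off `0`, and so `x 1 = x 2`.
  have hy1 : x 1 + g ≠ 0 := fun h0 => by
    have := (h10 2 (by omega) (by omega) (by omega)).2 h0
    exact hx 1 2 (by omega) (by omega) (by omega) (add_right_cancel (h0.trans this.symm))
  have hy : ∀ j, -(m + 1) ≤ j → j ≤ m + 1 → x j + g ≠ 0 := by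
    intro j h1 h2
    by_cases hj : j = 0
    · rw [hj, Ne, eq_zero_iff_of_represented hd hA (by omega) hmN h]
      exact hy1
    · rw [Ne, h10 j h1 h2 hj]
      exact hy1
  have hval : ∀ j, -m ≤ j → j ≤ m → (tVal t).realize (Sum.elim (fun z : A => (z : X)) (d j)) =
      c.emb (K.val (x j + g)) := fun j h1 h2 => by
    rw [realize_tVal, (h j (by omega) (by omega)).2, c.val _ (hy j (by omega) (by omega))]
  have hdist : ∀ e : ℤ, (e = m + 1 ∨ e = -(m + 1)) →
      (∀ j, -(m + 1) < j → j < m + 1 → K.val (x j + g) = K.val (x j - x e)) →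
      c.Represented A N d m (tVal t) := by
    intro e he hv
    have hem : ∀ v, d e v ∈ outerTerms N d m := fun v =>
      ⟨e, by omega, by omega, by omega, v, rfl⟩
    -- The second copy of `T` computes `x e`: there, the variables of the sequence are replaced by
    -- the parameters `d e v`.
    refine Or.inr ⟨tVal (tAdd
      (T.relabel (Sum.map (Set.inclusion (outerTerms_anti (by omega))) id)) (tSmul (-1 : C)
      (T.relabel (Sum.elim (fun z => Sum.inl (Set.inclusion (outerTerms_anti (by omega)) z))
        fun v => Sum.inl ⟨d e v, hem v⟩)))), fun j => K.val (x j - x e), 0, fun j h1 h2 => ⟨?_, ?_⟩⟩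
    · rw [realize_tVal, realize_tAdd, realize_tSmul, Term.realize_relabel, Term.realize_relabel,
        Sum.elim_comp_map]
      have e1 := (h j (by omega) (by omega)).1
      have e2 := (h e (by omega) (by omega)).1
      have e3 : (Sum.elim (fun z : outerTerms N d m => (z : X)) (d j) ∘
          Sum.elim (fun z => Sum.inl (Set.inclusion (outerTerms_anti (by omega)) z))
            fun v => Sum.inl ⟨d e v, hem v⟩) =
          Sum.elim (fun z : outerTerms N d (m + 1) => (z : X)) (d e) := by
        funext z
        rcases z with z | z <;> rfl
      rw [e3, e2]
      refine Eq.trans (congrArg (fun z => sVal C (sAdd C z _)) e1) (c.val_sub_emb ?_)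
      rcases he with rfl | rfl
      · exact hx _ _ (by omega) (by omega) le_rfl
      · exact (hx _ _ le_rfl (by omega) (by omega)).symm
    · rw [hval j h1 h2, add_zero, hv j (by omega) (by omega)]
  rcases hK (m + 1) x (fun j => x j + g) g (by omega) (fun _ => rfl)
    (c.uniformDistances (hd.outerTerms hmN) T (fun j h1 h2 => (h j h1 h2).1) hx)
    (c.uniformValues hA' t (fun j h1 h2 => (h j h1 h2).2) hy) with hv | hv | ⟨v, hv⟩
  · exact hdist _ (Or.inl rfl) hv
  · exact hdist _ (Or.inr rfl) hv
  · exact .of_const (x := c.emb v) fun j h1 h2 => by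
      rw [hval j h1 h2, hv j (by omega) (by omega)]

variable (c)

/-- Each occurrence of `v` costs one index at either end of the sequence, so a margin `n` depending
only on `t` suffices. -/
theorem exists_represented (hK : K.HasValueDichotomy) (t : (hamelLang C).Term (A ⊕ V)) :
    ∃ n : ℕ, ∀ (N m : ℤ) (d : ℤ → V → X), 1 ≤ m → m + n ≤ N →
      IndiscernibleOn (hamelLang C) ∅ (Set.Icc (-N) N) d →
      IndiscernibleOn (hamelLang C) A (Set.Icc (-N) N \ {0}) d → c.Represented A N d m t := by
  induction t using term_induction with
  | var z => exact ⟨0, fun N m d hm hmN hd _ => .var hd (by omega) z⟩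
  | zero => exact ⟨0, fun N m d hm hmN hd _ => .of_const fun j _ _ => realize_tZero _⟩
  | infty => exact ⟨0, fun N m d hm hmN hd _ => .of_const fun j _ _ => realize_tInfty _⟩
  | add s t hs ht =>
    obtain ⟨n₁, h₁⟩ := hs
    obtain ⟨n₂, h₂⟩ := ht
    exact ⟨n₁ + n₂, fun N m d hm hmN hd hA => (h₁ N m d hm (by omega) hd hA).add
      (h₂ N m d hm (by omega) hd hA)⟩
  | smul r t ht =>
    obtain ⟨n, h⟩ := ht
    exact ⟨n, fun N m d hm hmN hd hA => (h N m d hm hmN hd hA).smul r⟩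
  | val t ht =>
    obtain ⟨n, h⟩ := ht
    exact ⟨n + 1, fun N m d hm hmN hd hA => .val hK hd hA hm (by omega)
      (h N (m + 1) d (by omega) (by push_cast at hmN; omega) hd hA)⟩

-- Atomic formulas compare two terms, hence concern the sign of their difference; this is again
-- represented, and such signs agree at `0` and `1`.
include c in
theorem locally_iff_of_isQF (hK : K.HasValueDichotomy) {ψ : (hamelLang C).Formula (A ⊕ V)}
    (hψ : BoundedFormula.IsQF ψ) :
    ∃ N₀ : ℕ, ∀ N : ℤ, N₀ ≤ N → ∀ d : ℤ → V → X,
      IndiscernibleOn (hamelLang C) ∅ (Set.Icc (-N) N) d →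
      IndiscernibleOn (hamelLang C) A (Set.Icc (-N) N \ {0}) d →
      (ψ.Realize (Sum.elim (fun x : A => (x : X)) (d 0)) ↔
        ψ.Realize (Sum.elim (fun x : A => (x : X)) (d 1))) := by
  have two : ∀ s t : (hamelLang C).Term (A ⊕ V), ∃ N₀ : ℕ, ∀ N : ℤ, N₀ ≤ N → ∀ d : ℤ → V → X,
      IndiscernibleOn (hamelLang C) ∅ (Set.Icc (-N) N) d →
      IndiscernibleOn (hamelLang C) A (Set.Icc (-N) N \ {0}) d →
      (s.realize (Sum.elim (fun x : A => (x : X)) (d 0)) =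
          t.realize (Sum.elim (fun x : A => (x : X)) (d 0)) ↔
        s.realize (Sum.elim (fun x : A => (x : X)) (d 1)) =
          t.realize (Sum.elim (fun x : A => (x : X)) (d 1))) ∧
      ∀ i, (sLt C i (s.realize (Sum.elim (fun x : A => (x : X)) (d 0)))
          (t.realize (Sum.elim (fun x : A => (x : X)) (d 0))) ↔
        sLt C i (s.realize (Sum.elim (fun x : A => (x : X)) (d 1)))
          (t.realize (Sum.elim (fun x : A => (x : X)) (d 1)))) := by
    intro s t
    obtain ⟨n, hn⟩ := c.exists_represented hK s
    obtain ⟨n', hn'⟩ := c.exists_represented hK t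
    -- After the margins of both terms have been used up, the window `[-1, 1]` remains.
    refine ⟨n + n' + 1, fun N hN d hd hA => ?_⟩
    have hs := hn N 1 d le_rfl (by omega) hd hA
    have ht := hn' N 1 d le_rfl (by omega) hd hA
    rcases hs with ⟨hb, hs⟩ | ⟨T, x, g, hs⟩
    · rw [hs 0 (by omega) (by omega), hs 1 (by omega) (by omega)]
      rcases ht with ⟨-, ht⟩ | ⟨T', x', g', ht⟩
      · rw [ht 0 (by omega) (by omega), ht 1 (by omega) (by omega)]
        exact ⟨Iff.rfl, fun _ => Iff.rfl⟩
      · rw [(ht 0 (by omega) (by omega)).2, (ht 1 (by omega) (by omega)).2]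
        exact ⟨iff_of_false (c.ne_infty hb _).symm (c.ne_infty hb _).symm,
          fun i => iff_of_false (c.not_infty_lt hb i _) (c.not_infty_lt hb i _)⟩
    rcases ht with ⟨hb, ht⟩ | ⟨T', x', g', ht⟩
    · rw [ht 0 (by omega) (by omega), ht 1 (by omega) (by omega),
        (hs 0 (by omega) (by omega)).2, (hs 1 (by omega) (by omega)).2]
      exact ⟨iff_of_false (c.ne_infty hb _) (c.ne_infty hb _),
        fun i => iff_of_true (c.lt_infty hb i _) (c.lt_infty hb i _)⟩
    have e : ∀ j, x' j + g' - (x j + g) = (x' j - x j) + (g' - g) := fun j => by abel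
    have h : ∀ j, -1 ≤ j → j ≤ 1 →
        (tAdd T' (tSmul (-1 : C) T)).realize
          (Sum.elim (fun z : outerTerms N d 1 => (z : X)) (d j)) = c.emb (x' j - x j) ∧
        (tAdd t (tSmul (-1 : C) s)).realize (Sum.elim (fun z : A => (z : X)) (d j)) =
          c.emb ((x' j - x j) + (g' - g)) := by
      intro j h1 h2
      rw [realize_tAdd, realize_tSmul, (hs j h1 h2).1, (ht j h1 h2).1, c.sub_emb, realize_tAdd,
        realize_tSmul, (hs j h1 h2).2, (ht j h1 h2).2, c.sub_emb, e]
      exact ⟨rfl, rfl⟩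
    rw [(ht 0 (by omega) (by omega)).2, (ht 1 (by omega) (by omega)).2,
      (hs 0 (by omega) (by omega)).2, (hs 1 (by omega) (by omega)).2, c.injective.eq_iff,
      c.injective.eq_iff]
    have h0 := eq_zero_iff_of_represented hd hA le_rfl (by omega)
      (x := fun j => x' j - x j) (g := g' - g) h
    rw [← e, ← e, sub_eq_zero, sub_eq_zero] at h0
    refine ⟨⟨fun h => (h0.1 h.symm).symm, fun h => (h0.2 h.symm).symm⟩, fun i => ?_⟩
    have hi := (pos_iff_of_represented hd hA le_rfl (by omega)
      (x := fun j => x' j - x j) (g := g' - g) h i).1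
    rw [← e, ← e] at hi
    rw [c.lt, c.lt]
    exact hi
  have noVar : ∀ t : (hamelLang C).Term ((A ⊕ V) ⊕ Fin 0),
      ∃ t' : (hamelLang C).Term (A ⊕ V), ∀ ρ : A ⊕ V → X,
        t.realize (Sum.elim ρ default) = t'.realize ρ := fun t =>
    ⟨t.relabel (Sum.elim id Fin.elim0), fun ρ => by
      rw [Term.realize_relabel]
      congr 1
      funext z
      rcases z with z | z
      · rfl
      · exact z.elim0⟩
  induction hψ with
  | falsum => exact ⟨0, fun _ _ _ _ _ => Iff.rfl⟩
  | of_isAtomic h =>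
    cases h with
    | equal s t =>
      obtain ⟨s', hs'⟩ := noVar s
      obtain ⟨t', ht'⟩ := noVar t
      obtain ⟨N₀, h⟩ := two s' t'
      refine ⟨N₀, fun N hN d hd hA => ?_⟩
      rw [Formula.Realize, Formula.Realize, BoundedFormula.realize_bdEqual,
        BoundedFormula.realize_bdEqual, hs', hs', ht', ht']
      exact (h N hN d hd hA).1
    | @rel l R ts =>
      match l, R with
      | 2, HamelRel.lt i =>
        obtain ⟨s', hs'⟩ := noVar (ts 0)
        obtain ⟨t', ht'⟩ := noVar (ts 1)
        obtain ⟨N₀, h⟩ := two s' t'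
        refine ⟨N₀, fun N hN d hd hA => ?_⟩
        refine BoundedFormula.realize_rel.trans (Iff.trans ((relMap_lt i _).trans ?_)
          ((relMap_lt i _).symm.trans BoundedFormula.realize_rel.symm))
        rw [hs', hs', ht', ht']
        exact (h N hN d hd hA).2 i
  | imp _ _ h1 h2 =>
    obtain ⟨N₁, h₁⟩ := h1
    obtain ⟨N₂, h₂⟩ := h2
    refine ⟨N₁ + N₂, fun N hN d hd hA => ?_⟩
    have e₁ := h₁ N (by omega) d hd hA
    have e₂ := h₂ N (by omega) d hd hA
    rw [Formula.Realize] at e₁ e₂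
    rw [Formula.Realize, Formula.Realize, BoundedFormula.realize_imp, BoundedFormula.realize_imp]
    exact imp_congr e₁ e₂

end Carrier

/-- A model of a theory with quantifier elimination that is given by a biordered space with the
value dichotomy is locally distal. -/
theorem Carrier.locallyDistal {T : (hamelLang C).Theory} (hT : BackAndForth.{u, 0, u} T)
    {K : BiorderedSpace C G} {X : Type u} [(hamelLang C).Structure X] [Nonempty X] [X ⊨ T]
    {b : Bool} (c : Carrier K X b) (hK : K.HasValueDichotomy) : LocallyDistal (hamelLang C) X := by
  intro A V _ φ
  obtain ⟨ψ, hψ, e⟩ := hT.quantifierElimination φ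
  obtain ⟨N₀, h⟩ := c.locally_iff_of_isQF hK hψ
  refine ⟨N₀, fun N hN d hd hA => ?_⟩
  have := h N (by exact_mod_cast hN) d hd hA
  rw [Formula.Realize, Formula.Realize, e X, e X]
  exact this

end Carriers
end Hamel

namespace Hamel

/-! ### Models of the theory of a class of biordered spaces -/

section Elementarity

open FirstOrder.Language

variable {C : Type u} [Field C] [LinearOrder C] [IsStrictOrderedRing C]

/-- `t ≠ ∞` if `b = true`, and no condition if `b = false`. -/
def fFinite {α : Type*} (b : Bool) (t : (hamelLang C).Term α) : (hamelLang C).Formula α :=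
  bif b then (t.equal tInfty).not else ⊤

omit [Field C] [LinearOrder C] [IsStrictOrderedRing C] in
@[simp] theorem realize_fFinite {α X : Type*} [(hamelLang C).Structure X] (b : Bool)
    (t : (hamelLang C).Term α) (v : α → X) :
    (fFinite b t).Realize v ↔ (b = true → t.realize v ≠ sInfty C) := by
  cases b
  · simp [fFinite]
  · simp [fFinite]

/-- The elements other than `∞`; all elements if `b = false`. -/
abbrev FiniteElements (C : Type u) (b : Bool) (M : Type*) [(hamelLang C).Structure M] : Type _ :=
  {x : M // b = true → x ≠ sInfty C}

namespace Carrier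

variable {G : Type*} [AddCommGroup G] [Module C G] {K : BiorderedSpace C G} {X : Type*}
  [(hamelLang C).Structure X] {b : Bool} (c : Carrier K X b)

theorem finite_emb (g : G) : b = true → c.emb g ≠ sInfty C := fun h => c.ne_infty h g

theorem exists_emb {x : X} (h : b = true → x ≠ sInfty C) : ∃ g, c.emb g = x := by
  rcases c.cases x with h1 | ⟨hb, h1, -⟩
  exacts [h1, absurd h1 (h hb)]

theorem lt_zero (i : Fin 2) (x : G) : sLt C i (sZero C) (c.emb x) ↔ K.pos i x := by
  rw [← c.zero, c.lt, sub_zero]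

theorem eq_zero_iff (x : G) : c.emb x = sZero C ↔ x = 0 := by
  rw [← c.zero, c.injective.eq_iff]

end Carrier

variable (P : ∀ (G : Type u) [AddCommGroup G] [Module C G], BiorderedSpace C G → Prop) (b : Bool)
variable (M : Type u) [(hamelLang C).Structure M]

/-- `M` satisfies the sentences true in all structures given by biordered spaces of class `P`. -/
def IsModelOf : Prop :=
  ∀ σ : (hamelLang C).Sentence,
    (∀ (G : Type u) [AddCommGroup G] [Module C G] (K : BiorderedSpace C G), P G K →
      ∀ (N : Type u) [(hamelLang C).Structure N], Carrier K N b → N ⊨ σ) → M ⊨ σ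

variable {P b M} (h : IsModelOf P b M)

include h

namespace IsModelOf

/-- The theory is given semantically, without a list of axioms. Any property of the class that can
be written as a formula is verified in the structures of the class and thereby holds in `M`; in this
way the algebraic axioms are recovered one by one. -/
theorem forall_all {n : ℕ} (φ : (hamelLang C).Formula (Fin n))
    (hφ : ∀ (G : Type u) [AddCommGroup G] [Module C G] (K : BiorderedSpace C G), P G K →
      ∀ (N : Type u) [(hamelLang C).Structure N], Carrier K N b → ∀ a : Fin n → N, φ.Realize a)
    (a : Fin n → M) : φ.Realize a := by
  have := h ((φ.relabel (Sum.inr : Fin n → Empty ⊕ Fin n)).iAlls (Fin n)) (by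
    intro G _ _ K hK N _ c
    rw [Sentence.Realize, Formula.realize_iAlls]
    intro a
    rw [Formula.realize_relabel]
    exact hφ G K hK N c a)
  rw [Sentence.Realize, Formula.realize_iAlls] at this
  have := this a
  rw [Formula.realize_relabel] at this
  exact this

theorem forall_finite {n : ℕ} (φ : (hamelLang C).Formula (Fin n))
    (hφ : ∀ (G : Type u) [AddCommGroup G] [Module C G] (K : BiorderedSpace C G), P G K →
      ∀ (N : Type u) [(hamelLang C).Structure N] (c : Carrier K N b), ∀ a : Fin n → G,
        φ.Realize fun i => c.emb (a i))
    (a : Fin n → FiniteElements C b M) : φ.Realize fun i => (a i).1 := by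
  have := h.forall_all (((List.finRange n).map fun i => fFinite b (.var i)).foldr
    (· ⊓ ·) ⊤ |>.imp φ) (by
      intro G _ _ K hK N _ c v
      rw [Formula.realize_imp, realize_list_inf]
      intro hv
      have : ∀ i, ∃ g, c.emb g = v i := fun i => c.exists_emb (by
        have := hv (fFinite b (.var i)) (List.mem_map_of_mem (List.mem_finRange i))
        rwa [realize_fFinite] at this)
      choose a ha using this
      rw [← funext ha]
      exact hφ G K hK N c a) fun i => (a i).1
  rw [Formula.realize_imp, realize_list_inf] at this
  refine this fun ψ hψ => ?_
  obtain ⟨i, -, rfl⟩ := List.mem_map.1 hψ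
  rw [realize_fFinite]
  exact (a i).2

theorem forall_exists_finite {n : ℕ} (φ : (hamelLang C).Formula (Fin n ⊕ Fin 1))
    (hφ : ∀ (G : Type u) [AddCommGroup G] [Module C G] (K : BiorderedSpace C G), P G K →
      ∀ (N : Type u) [(hamelLang C).Structure N] (c : Carrier K N b), ∀ a : Fin n → G,
        ∃ g, φ.Realize (Sum.elim (fun i => c.emb (a i)) fun _ => c.emb g))
    (a : Fin n → FiniteElements C b M) :
    ∃ g : FiniteElements C b M, φ.Realize (Sum.elim (fun i => (a i).1) fun _ => g.1) := by
  have key : ∀ (N : Type u) [(hamelLang C).Structure N] (a : Fin n → N),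
      ((φ ⊓ fFinite b (.var (Sum.inr 0))).iExs (Fin 1)).Realize a ↔
        ∃ g : FiniteElements C b N, φ.Realize (Sum.elim a fun _ => g.1) := by
    intro N _ a
    rw [Formula.realize_iExs]
    constructor
    · rintro ⟨x, hx⟩
      rw [Formula.realize_inf, realize_fFinite] at hx
      refine ⟨⟨x 0, hx.2⟩, ?_⟩
      convert hx.1 using 3 with i
      rw [Subsingleton.elim i 0]
    · rintro ⟨g, hg⟩
      refine ⟨fun _ => g.1, ?_⟩
      rw [Formula.realize_inf, realize_fFinite]
      exact ⟨hg, g.2⟩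
  rw [← key]
  refine h.forall_finite _ (fun G _ _ K hK N _ c a => ?_) a
  rw [key]
  obtain ⟨g, hg⟩ := hφ G K hK N c a
  exact ⟨⟨c.emb g, c.finite_emb g⟩, hg⟩

/-- The operations on the finite elements of a model. -/
def add (x y : FiniteElements C b M) : FiniteElements C b M := ⟨sAdd C x.1 y.1, by
  have := h.forall_finite (fFinite b (tAdd (.var 0) (.var 1))) (fun G _ _ K _ N _ c a => by
    rw [realize_fFinite, realize_tAdd, Term.realize_var, Term.realize_var, c.add]
    exact c.finite_emb _) ![x, y]
  rwa [realize_fFinite, realize_tAdd, Term.realize_var, Term.realize_var] at this⟩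

def zero : FiniteElements C b M := ⟨sZero C, by
  have := h.forall_finite (n := 0) (fFinite b tZero) (fun G _ _ K _ N _ c a => by
    rw [realize_fFinite, realize_tZero, ← c.zero]
    exact c.finite_emb _) ![]
  rwa [realize_fFinite, realize_tZero] at this⟩

def smul (r : C) (x : FiniteElements C b M) : FiniteElements C b M := ⟨sSmul r x.1, by
  have := h.forall_finite (fFinite b (tSmul r (.var 0))) (fun G _ _ K _ N _ c a => by
    rw [realize_fFinite, realize_tSmul, Term.realize_var, c.smul]
    exact c.finite_emb _) ![x]
  rwa [realize_fFinite, realize_tSmul, Term.realize_var] at this⟩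

theorem forall_eq {n : ℕ} (s t : (hamelLang C).Term (Fin n))
    (hst : ∀ (G : Type u) [AddCommGroup G] [Module C G] (K : BiorderedSpace C G), P G K →
      ∀ (N : Type u) [(hamelLang C).Structure N] (c : Carrier K N b), ∀ a : Fin n → G,
        s.realize (fun i => c.emb (a i)) = t.realize fun i => c.emb (a i))
    (a : Fin n → FiniteElements C b M) : s.realize (fun i => (a i).1) = t.realize fun i => (a i).1 := by
  have := h.forall_finite (s.equal t) (fun G _ _ K hK N _ c a => by
    rw [Formula.realize_equal]
    exact hst G K hK N c a) a
  rwa [Formula.realize_equal] at this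

/-- The vector space underlying a model. -/
@[reducible] def addCommGroup : AddCommGroup (FiniteElements C b M) :=
  letI : Add (FiniteElements C b M) := ⟨h.add⟩
  letI : Zero (FiniteElements C b M) := ⟨h.zero⟩
  letI : Neg (FiniteElements C b M) := ⟨h.smul (-1)⟩
  { AddGroup.ofLeftAxioms (G := FiniteElements C b M)
      (fun x y z => Subtype.ext <| by
        have := h.forall_eq (tAdd (tAdd (.var 0) (.var 1)) (.var 2))
          (tAdd (.var 0) (tAdd (.var 1) (.var 2))) (fun G _ _ K _ N _ c a => by
            simp [c.add, add_assoc]) ![x, y, z]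
        simp at this
        exact this)
      (fun x => Subtype.ext <| by
        have := h.forall_eq (tAdd tZero (.var 0)) (.var 0) (fun G _ _ K _ N _ c a => by
          simp [← c.zero, c.add]) ![x]
        simp at this
        exact this)
      (fun x => Subtype.ext <| by
        have := h.forall_eq (tAdd (tSmul (-1 : C) (.var 0)) (.var 0)) tZero
          (fun G _ _ K _ N _ c a => by simp [← c.zero, c.add, c.smul]) ![x]
        simp at this
        exact this) with
    add_comm := fun x y => Subtype.ext <| by
      have := h.forall_eq (tAdd (.var 0) (.var 1)) (tAdd (.var 1) (.var 0))
        (fun G _ _ K _ N _ c a => by simp [c.add, add_comm]) ![x, y]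
      simp at this
      exact this }

@[reducible] def module : letI := h.addCommGroup; Module C (FiniteElements C b M) :=
  letI := h.addCommGroup
  { smul := h.smul
    one_smul := fun x => Subtype.ext <| by
      have := h.forall_eq (tSmul (1 : C) (.var 0)) (.var 0)
        (fun G _ _ K _ N _ c a => by simp [c.smul]) ![x]
      simp at this
      exact this
    mul_smul := fun r s x => Subtype.ext <| by
      have := h.forall_eq (tSmul (r * s) (.var 0)) (tSmul r (tSmul s (.var 0)))
        (fun G _ _ K _ N _ c a => by simp [c.smul, mul_smul]) ![x]
      simp at this
      exact this
    smul_zero := fun r => Subtype.ext <| by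
      have := h.forall_eq (n := 0) (tSmul r tZero) tZero
        (fun G _ _ K _ N _ c a => by simp [← c.zero, c.smul]) ![]
      simp at this
      exact this
    smul_add := fun r x y => Subtype.ext <| by
      have := h.forall_eq (tSmul r (tAdd (.var 0) (.var 1)))
        (tAdd (tSmul r (.var 0)) (tSmul r (.var 1)))
        (fun G _ _ K _ N _ c a => by simp [c.add, c.smul]) ![x, y]
      simp at this
      exact this
    add_smul := fun r s x => Subtype.ext <| by
      have := h.forall_eq (tSmul (r + s) (.var 0))
        (tAdd (tSmul r (.var 0)) (tSmul s (.var 0)))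
        (fun G _ _ K _ N _ c a => by simp [c.add, c.smul, add_smul]) ![x]
      simp at this
      exact this
    zero_smul := fun x => Subtype.ext <| by
      have := h.forall_eq (tSmul (0 : C) (.var 0)) tZero
        (fun G _ _ K _ N _ c a => by simp [← c.zero, c.smul]) ![x]
      simp at this
      exact this }

/-- The value of a finite element, where the value of `0` is `0`. -/
theorem val_finite (x : FiniteElements C b M) (hx : x ≠ h.zero) : b = true → sVal C x.1 ≠ sInfty C := by
  have := h.forall_finite (((Term.var 0).equal tZero).not.imp (fFinite b (tVal (.var 0))))
    (fun G _ _ K _ N _ c a => by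
      rw [Formula.realize_imp, Formula.realize_not, Formula.realize_equal, realize_tZero,
        Term.realize_var, c.eq_zero_iff, realize_fFinite, realize_tVal, Term.realize_var]
      intro h0
      rw [c.val _ h0]
      exact c.finite_emb _) ![x]
  rw [Formula.realize_imp, Formula.realize_not, Formula.realize_equal, realize_tZero,
    Term.realize_var, realize_fFinite, realize_tVal, Term.realize_var] at this
  exact this fun h0 => hx (Subtype.ext h0)

open Classical in
noncomputable def val (x : FiniteElements C b M) : FiniteElements C b M :=
  if hx : x = h.zero then h.zero else ⟨sVal C x.1, h.val_finite x hx⟩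

theorem val_zero : h.val h.zero = h.zero := dif_pos rfl

theorem coe_val {x : FiniteElements C b M} (hx : x ≠ h.zero) : (h.val x).1 = sVal C x.1 :=
  congrArg Subtype.val (dif_neg hx)

theorem forall_imp {n : ℕ} (φ ψ : (hamelLang C).Formula (Fin n))
    (hφ : ∀ (G : Type u) [AddCommGroup G] [Module C G] (K : BiorderedSpace C G), P G K →
      ∀ (N : Type u) [(hamelLang C).Structure N] (c : Carrier K N b), ∀ a : Fin n → G,
        φ.Realize (fun i => c.emb (a i)) → ψ.Realize fun i => c.emb (a i))
    (a : Fin n → FiniteElements C b M) : φ.Realize (fun i => (a i).1) → ψ.Realize fun i => (a i).1 := by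
  have := h.forall_finite (φ.imp ψ) (fun G _ _ K hK N _ c a => by
    rw [Formula.realize_imp]
    exact hφ G K hK N c a) a
  rwa [Formula.realize_imp] at this

/-- The biordered space underlying a model. -/
@[reducible] noncomputable def space : letI := h.addCommGroup; letI := h.module
    BiorderedSpace C (FiniteElements C b M) :=
  letI := h.addCommGroup
  letI := h.module
  { pos := fun i x => sLt C i (sZero C) x.1
    val := h.val
    pos_neg := fun i x => by
      have := h.forall_imp (fLt i tZero (.var 0)) (fLt i tZero (tSmul (-1 : C) (.var 0))).not
        (fun G _ _ K _ N _ c a => by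
          simpa [c.smul, c.lt_zero] using K.pos_neg i (a 0)) ![x]
      simp at this
      exact this
    pos_add := fun i x y h1 h2 => by
      have := h.forall_imp (fLt i tZero (.var 0) ⊓ fLt i tZero (.var 1))
        (fLt i tZero (tAdd (.var 0) (.var 1)))
        (fun G _ _ K _ N _ c a => by
          simpa [c.add, c.lt_zero] using K.pos_add i (a 0) (a 1)) ![x, y]
      simp at this
      exact this h1 h2
    not_pos_add := fun i x y h1 h2 => by
      have := h.forall_imp ((fLt i tZero (.var 0)).not ⊓ (fLt i tZero (.var 1)).not)
        (fLt i tZero (tAdd (.var 0) (.var 1))).not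
        (fun G _ _ K _ N _ c a => by
          simpa [c.add, c.lt_zero] using K.not_pos_add i (a 0) (a 1)) ![x, y]
      simp at this
      exact this h1 h2
    pos_smul := fun i r x hr h1 => by
      have := h.forall_imp (fLt i tZero (.var 0)) (fLt i tZero (tSmul r (.var 0)))
        (fun G _ _ K _ N _ c a => by
          simpa [c.smul, c.lt_zero] using K.pos_smul i r (a 0) hr) ![x]
      simp at this
      exact this h1
    pos_total := fun x hx => by
      have := h.forall_imp ((Term.var 0).equal tZero).not
        (fLt 0 tZero (.var 0) ⊔ fLt 0 tZero (tSmul (-1 : C) (.var 0)))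
        (fun G _ _ K _ N _ c a => by
          simpa [c.smul, c.lt_zero, c.eq_zero_iff] using K.pos_total (a 0)) ![x]
      simp at this
      exact this fun h0 => hx (Subtype.ext h0)
    pos_nontrivial := fun i => by
      obtain ⟨x, hx⟩ := h.forall_exists_finite (n := 0) (fLt i tZero (.var (Sum.inr 0)))
        (fun G _ _ K _ N _ c a => by
          simpa [c.lt_zero] using K.pos_nontrivial i) ![]
      simp at hx
      exact ⟨x, hx⟩
    val_zero := h.val_zero
    val_smul := fun r x hr => by
      by_cases hx : x = h.zero
      · subst hx
        congr 1
        exact smul_zero r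
      · have hrx : h.smul r x ≠ h.zero := fun h0 => hx ((smul_eq_zero_iff_right hr).1 h0)
        apply Subtype.ext
        refine (h.coe_val hrx).trans (Eq.trans ?_ (h.coe_val hx).symm)
        have := h.forall_imp ((Term.var 0).equal tZero).not
          ((tVal (tSmul r (.var 0))).equal (tVal (.var 0)))
          (fun G _ _ K _ N _ c a => by
            simp only [Formula.realize_not, Formula.realize_equal, Term.realize_var, realize_tZero,
              c.eq_zero_iff, realize_tVal, realize_tSmul, c.smul]
            intro h0
            rw [c.val _ h0, c.val _ (smul_ne_zero hr h0), K.val_smul r _ hr]) ![x]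
        simp at this
        exact this fun h0 => hx (Subtype.ext h0) }

/-- A model is given by a biordered space. -/
def carrier : letI := h.addCommGroup; letI := h.module; Carrier h.space M b :=
  letI := h.addCommGroup
  letI := h.module
  { emb := Subtype.val
    injective := Subtype.val_injective
    cover := fun x => by
      by_cases hx : x = sInfty C
      exacts [Or.inl hx, Or.inr ⟨⟨x, fun _ => hx⟩, rfl⟩]
    ne_infty := fun hb x => x.2 hb
    infty_eq := fun hb => by
      have := h.forall_eq (n := 0) tZero tInfty (fun G _ _ K _ N _ c a => by
        rw [realize_tZero, realize_tInfty, ← c.zero, c.infty_eq hb]) ![]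
      simp at this
      exact this
    zero := rfl
    add := fun _ _ => rfl
    smul := fun _ _ => rfl
    infty_add := fun hb x => by
      have := h.forall_all ((tAdd tInfty (.var 0)).equal tInfty) (fun G _ _ K _ N _ c a => by
        simp [c.infty_add hb]) ![x]
      simpa using this
    add_infty := fun hb x => by
      have := h.forall_all ((tAdd (.var 0) tInfty).equal tInfty) (fun G _ _ K _ N _ c a => by
        simp [c.add_infty hb]) ![x]
      simpa using this
    smul_infty := fun hb r => by
      have := h.forall_all (n := 0) ((tSmul r tInfty).equal tInfty) (fun G _ _ K _ N _ c a => by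
        simp [c.smul_infty hb]) ![]
      simpa using this
    val := fun x hx => (h.coe_val hx).symm
    val_zero := by
      have := h.forall_all (n := 0) ((tVal tZero).equal tInfty) (fun G _ _ K _ N _ c a => by
        simp [← c.zero, c.val_zero]) ![]
      simp at this
      exact this
    val_infty := by
      have := h.forall_all (n := 0) ((tVal tInfty).equal tInfty) (fun G _ _ K _ N _ c a => by
        simp [c.val_infty]) ![]
      simpa using this
    lt := fun i x y => by
      have := h.forall_finite ((fLt i (.var 0) (.var 1)).iff
        (fLt i tZero (tAdd (.var 1) (tSmul (-1 : C) (.var 0))))) (fun G _ _ K _ N _ c a => by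
        simp [c.lt, c.smul, c.add, c.lt_zero, sub_eq_add_neg]) ![x, y]
      simp at this
      rw [sub_eq_add_neg]
      exact this
    lt_infty := fun hb i x => by
      have := h.forall_finite (fLt i (.var 0) tInfty) (fun G _ _ K _ N _ c a => by
        simp [c.lt_infty hb]) ![x]
      simpa using this
    not_infty_lt := fun hb i x => by
      have := h.forall_all (fLt i tInfty (.var 0)).not (fun G _ _ K _ N _ c a => by
        simp [c.not_infty_lt hb]) ![x]
      simpa using this }

end IsModelOf

/-- The class of spaces underlying independent, dense Hamel spaces. -/
def HamelClass (C : Type u) [Field C] [LinearOrder C] [IsStrictOrderedRing C] (G : Type u)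
    [AddCommGroup G] [Module C G] (K : BiorderedSpace C G) : Prop := K.IsHamel

/-- The class of preordered spaces. -/
def PreorderedClass (C : Type u) [Field C] [LinearOrder C] [IsStrictOrderedRing C] (G : Type u)
    [AddCommGroup G] [Module C G] (K : BiorderedSpace C G) : Prop := K.IsPreordered

omit h in
theorem IsModelOf.isPreordered (h : IsModelOf (PreorderedClass C) b M) :
    let := h.addCommGroup; letI := h.module; h.space.IsPreordered := by
  let := h.addCommGroup
  let := h.module
  refine ⟨fun x => ?_, fun x y hxy => ?_⟩
  · by_cases hx : x = h.zero
    · rw [hx]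
      exact h.val_zero
    · have := h.forall_imp ((Term.var 0).equal tZero).not ((tVal (.var 0)).equal tZero)
        (fun G _ _ K hK N _ c a => by
          simp only [Formula.realize_not, Formula.realize_equal, Term.realize_var, realize_tZero,
            c.eq_zero_iff, realize_tVal]
          intro h0
          rw [c.val _ h0, hK.val_eq, c.zero]) ![x]
      simp at this
      exact Subtype.ext ((h.coe_val hx).trans (this fun h0 => hx (Subtype.ext h0)))
  · obtain ⟨z, hz⟩ := h.forall_exists_finite (fLt 0 tZero (tAdd (.var (Sum.inl 1))
      (tSmul (-1 : C) (.var (Sum.inl 0)))) |>.imp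
      (((fLt 1 tZero (.var (Sum.inr 0))).not ⊓ (fLt 1 tZero (tSmul (-1 : C) (.var (Sum.inr 0)))).not)
        ⊓ (fLt 0 tZero (tAdd (.var (Sum.inr 0)) (tSmul (-1 : C) (.var (Sum.inl 0)))) ⊓
          fLt 0 tZero (tAdd (.var (Sum.inl 1)) (tSmul (-1 : C) (.var (Sum.inr 0)))))))
      (fun G _ _ K hK N _ c a => by
        -- The hypothesis of density stands inside the existential quantifier, so an arbitrary
        -- witness serves when it fails.
        by_cases h0 : K.pos 0 (a 1 - a 0)
        · obtain ⟨z, hz⟩ := hK.dense _ _ h0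
          exact ⟨z, by simpa [c.smul, c.add, c.lt_zero, ← sub_eq_add_neg, h0] using hz⟩
        · exact ⟨0, by simp [c.smul, c.add, c.lt_zero, ← sub_eq_add_neg, h0]⟩) ![x, y]
    simp at hz
    refine ⟨z, ?_⟩
    rw [sub_eq_add_neg] at hxy
    rw [sub_eq_add_neg, sub_eq_add_neg]
    exact hz hxy

-- All clauses are first-order. Those on `val` are transferred for nonzero arguments, where `val`
-- agrees with the symbol `v`; at `0` they hold by the convention `val 0 = 0`.
omit h in
theorem IsModelOf.isHamel (h : IsModelOf (HamelClass C) b M) :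
    let := h.addCommGroup; letI := h.module; h.space.IsHamel := by
  let := h.addCommGroup
  let := h.module
  have hval_pos : ∀ x : FiniteElements C b M, x ≠ 0 → sLt C 1 (sZero C) (h.val x).1 := by
    intro x hx
    have := h.forall_imp ((Term.var 0).equal tZero).not (fLt 1 tZero (tVal (.var 0)))
      (fun G _ _ K hK N _ c a => by
        simp only [Formula.realize_not, Formula.realize_equal, Term.realize_var, realize_tZero,
          c.eq_zero_iff, realize_tVal, realize_fLt]
        intro h0
        rw [c.val _ h0, c.lt_zero]
        exact hK.val_pos _ h0) ![x]
    simp at this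
    rw [h.coe_val hx]
    exact this fun h0 => hx (Subtype.ext h0)
  constructor
  case total =>
    intro x hx
    have := h.forall_imp ((Term.var 0).equal tZero).not
      (fLt 1 tZero (.var 0) ⊔ fLt 1 tZero (tSmul (-1 : C) (.var 0)))
      (fun G _ _ K hK N _ c a => by
        simpa [c.smul, c.lt_zero, c.eq_zero_iff] using hK.total (a 0)) ![x]
    simp at this
    exact this fun h0 => hx (Subtype.ext h0)
  case val_pos => exact hval_pos
  case val_val =>
    intro x
    by_cases hx : x = 0
    · subst hx
      exact congrArg h.val h.val_zero
    · have hvx : h.val x ≠ 0 := fun h0 => by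
        have := hval_pos x hx
        rw [h0] at this
        exact h.space.not_pos_zero 1 this
      have := h.forall_imp ((Term.var 0).equal tZero).not
        ((tVal (tVal (.var 0))).equal (tVal (.var 0)))
        (fun G _ _ K hK N _ c a => by
          simp only [Formula.realize_not, Formula.realize_equal, Term.realize_var, realize_tZero,
            c.eq_zero_iff, realize_tVal]
          intro h0
          rw [c.val _ h0, c.val _ (hK.val_ne_zero h0), hK.val_val]) ![x]
      simp at this
      apply Subtype.ext
      refine (h.coe_val hvx).trans ?_
      rw [h.coe_val hx]
      exact this fun h0 => hx (Subtype.ext h0)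
  case val_add =>
    intro x y hx hy hxy
    have := h.forall_imp ((((Term.var 0).equal tZero).not ⊓ ((Term.var 1).equal tZero).not) ⊓
        ((tAdd (.var 0) (.var 1)).equal tZero).not)
      ((fLt 0 (tVal (tAdd (.var 0) (.var 1))) (tVal (.var 0))).not ⊔
        (fLt 0 (tVal (tAdd (.var 0) (.var 1))) (tVal (.var 1))).not)
      (fun G _ _ K hK N _ c a => by
        simp only [Formula.realize_not, Formula.realize_equal, Term.realize_var, realize_tZero,
          c.eq_zero_iff, realize_tVal, realize_fLt, Formula.realize_inf, Formula.realize_sup,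
          realize_tAdd, c.add]
        rintro ⟨⟨h1, h2⟩, h3⟩
        rw [c.val _ h1, c.val _ h2, c.val _ h3, c.lt, c.lt]
        exact hK.val_add _ _ h1 h2 h3) ![x, y]
    simp at this
    have := this (fun h0 => hx (Subtype.ext h0)) (fun h0 => hy (Subtype.ext h0))
      (fun h0 => hxy (Subtype.ext h0))
    rw [← h.carrier.lt, ← h.carrier.lt]
    change ¬ sLt C 0 (h.val (x + y)).1 (h.val x).1 ∨ ¬ sLt C 0 (h.val (x + y)).1 (h.val y).1
    rw [h.coe_val hx, h.coe_val hy, h.coe_val hxy]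
    exact this
  case convex =>
    intro x y hx hxy
    have hy : y ≠ 0 := by
      have := h.space.pos_add 1 _ _ hx hxy
      rw [add_sub_cancel] at this
      exact BiorderedSpace.ne_zero_of_pos this
    have := h.forall_imp (fLt 1 tZero (.var 0) ⊓ fLt 1 (.var 0) (.var 1))
      (fLt 0 (tVal (.var 0)) (tVal (.var 1))).not
      (fun G _ _ K hK N _ c a => by
        simp only [Formula.realize_not, Term.realize_var, realize_tZero,
          c.lt_zero, c.lt, realize_tVal, realize_fLt, Formula.realize_inf]
        rintro ⟨h1, h2⟩
        have h3 := K.pos_add 1 _ _ h1 h2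
        rw [add_sub_cancel] at h3
        rw [c.val _ (BiorderedSpace.ne_zero_of_pos h1), c.val _ (BiorderedSpace.ne_zero_of_pos h3),
          c.lt]
        exact hK.convex _ _ h1 h2) ![x, y]
    simp at this
    rw [← h.carrier.lt] at hxy ⊢
    change ¬ sLt C 0 (h.val x).1 (h.val y).1
    rw [h.coe_val (BiorderedSpace.ne_zero_of_pos hx), h.coe_val hy]
    exact this hx hxy
  case independent =>
    intro a₀ b₀ a₁ b₁ h₀ h₁
    obtain ⟨z, hz⟩ := h.forall_exists_finite ((fLt 0 (.var (Sum.inl 0)) (.var (Sum.inl 1)) ⊓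
        fLt 1 (.var (Sum.inl 2)) (.var (Sum.inl 3))).imp
      ((fLt 0 (.var (Sum.inl 0)) (.var (Sum.inr 0)) ⊓ fLt 0 (.var (Sum.inr 0)) (.var (Sum.inl 1))) ⊓
      (fLt 1 (.var (Sum.inl 2)) (.var (Sum.inr 0)) ⊓ fLt 1 (.var (Sum.inr 0)) (.var (Sum.inl 3)))))
      (fun G _ _ K hK N _ c a => by
        by_cases h0 : K.pos 0 (a 1 - a 0) ∧ K.pos 1 (a 3 - a 2)
        · obtain ⟨z, hz⟩ := hK.independent _ _ _ _ h0.1 h0.2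
          exact ⟨z, by simpa [c.lt, h0] using hz⟩
        · exact ⟨0, by
            simp only [Formula.realize_imp, Formula.realize_inf, realize_fLt, Term.realize_var,
              Sum.elim_inl, c.lt]
            exact fun h1 => absurd h1 h0⟩) ![a₀, b₀, a₁, b₁]
    simp at hz
    refine ⟨z, ?_⟩
    rw [← h.carrier.lt] at h₀ h₁
    rw [← h.carrier.lt, ← h.carrier.lt, ← h.carrier.lt, ← h.carrier.lt]
    exact hz h₀ h₁
  case dense =>
    intro x y hxy
    obtain ⟨z, hz⟩ := h.forall_exists_finite ((fLt 0 (.var (Sum.inl 0)) (.var (Sum.inl 1))).imp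
      (((Term.var (Sum.inr 0)).equal tZero).not ⊓ (fLt 0 (.var (Sum.inl 0)) (tVal (.var (Sum.inr 0)))
        ⊓ fLt 0 (tVal (.var (Sum.inr 0))) (.var (Sum.inl 1)))))
      (fun G _ _ K hK N _ c a => by
        by_cases h0 : K.pos 0 (a 1 - a 0)
        · obtain ⟨z, hz0, hz⟩ := hK.dense _ _ h0
          exact ⟨z, by simpa [c.lt, h0, c.eq_zero_iff, hz0, c.val z hz0] using hz⟩
        · exact ⟨0, by simp [c.lt, h0]⟩) ![x, y]
    simp at hz
    rw [← h.carrier.lt] at hxy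
    obtain ⟨h1, h2⟩ := hz hxy
    have hz0 : z ≠ 0 := fun h0 => h1 (congrArg Subtype.val h0)
    refine ⟨z, hz0, ?_⟩
    rw [← h.carrier.lt, ← h.carrier.lt]
    change sLt C 0 x.1 (h.val z).1 ∧ sLt C 0 (h.val z).1 y.1
    rw [h.coe_val hz0]
    exact h2

end Elementarity
end Hamel

namespace Hamel

/-! ### Hamel spaces as biordered spaces, and distality of their theory -/

section HamelSpaces

open FirstOrder.Language

namespace IsVectorSpaceOrder

variable {C : Type*} [Field C] [LinearOrder C]
variable {G : Type*} [AddCommGroup G] [Module C G] {lt : G → G → Prop}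
  (h : IsVectorSpaceOrder C lt)

include h

theorem lt_iff (x y : G) : lt x y ↔ lt 0 (y - x) := by
  constructor
  · intro h1
    have := h.add_left _ _ (-x) h1
    rwa [neg_add_cancel, neg_add_eq_sub] at this
  · intro h1
    have := h.add_left _ _ x h1
    rwa [add_zero, add_sub_cancel] at this

theorem not_lt_neg {x : G} (hx : lt 0 x) : ¬ lt 0 (-x) := fun h1 => by
  have := h.add_left _ _ x h1
  rw [add_zero, add_neg_cancel] at this
  exact h.irrefl _ (h.trans _ _ _ hx this)

theorem pos_add {x y : G} (hx : lt 0 x) (hy : lt 0 y) : lt 0 (x + y) := by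
  have := h.add_left _ _ x hy
  rw [add_zero] at this
  exact h.trans _ _ _ hx this

theorem pos_or (x : G) : x = 0 ∨ lt 0 x ∨ lt 0 (-x) := by
  by_cases h0 : x = 0
  · exact Or.inl h0
  · refine Or.inr ((h.total 0 x (Ne.symm h0)).imp_right fun h1 => ?_)
    rwa [h.lt_iff, zero_sub] at h1

theorem not_pos_add {x y : G} (hx : ¬ lt 0 x) (hy : ¬ lt 0 y) : ¬ lt 0 (x + y) := by
  intro hxy
  rcases h.pos_or x with rfl | h1 | h1
  · rw [zero_add] at hxy
    exact hy hxy
  · exact hx h1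
  · have := h.pos_add h1 hxy
    rw [neg_add_cancel_left] at this
    exact hy this

theorem not_lt_of_leTop {a b : G} (hab : leTop lt (a : WithTop G) b) : ¬ lt 0 (a - b) := by
  intro h1
  rw [← h.lt_iff] at h1
  rcases hab with hab | hab
  · rw [WithTop.coe_injective hab] at h1
    exact h.irrefl _ h1
  · exact h.irrefl _ (h.trans _ _ _ hab h1)

end IsVectorSpaceOrder

variable {C : Type u} [Field C] [LinearOrder C] [IsStrictOrderedRing C]
variable {G : Type w} [AddCommGroup G] [Module C G]

namespace HamelSpace

variable (S : HamelSpace C G)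

theorem coe_untopD {x : G} (hx : x ≠ 0) : ((S.v x).untopD 0 : G) = S.v x := by
  have : S.v x ≠ ⊤ := fun h => hx ((S.v_eq_top_iff x).1 h)
  obtain ⟨y, hy⟩ := WithTop.ne_top_iff_exists.1 this
  rw [← hy, WithTop.untopD_coe]

theorem exists_pos (hS : S.Independent) (i : Fin 2) : ∃ x, S.lt i 0 x := by
  -- Independence for the single interval `(0, ∞)`; in particular the zero space is not independent.
  obtain ⟨z, hz⟩ := hS {i} (fun _ => (((0 : G) : WithTop G) : WithBot (WithTop G)))
    (fun _ => ((⊤ : WithTop G) : WithBot (WithTop G))) fun _ _ => trivial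
  exact ⟨z, (hz i (Finset.mem_singleton_self i)).1⟩

/-- The biordered space underlying an independent Hamel space. -/
def toBiorderedSpace (hS : S.Independent) : BiorderedSpace C G where
  pos i x := S.lt i 0 x
  val x := (S.v x).untopD 0
  pos_neg i _ := (S.isOrder i).not_lt_neg
  pos_add i _ _ := (S.isOrder i).pos_add
  not_pos_add i _ _ := (S.isOrder i).not_pos_add
  pos_smul i := (S.isOrder i).smul_pos
  pos_total x hx := ((S.isOrder 0).pos_or x).resolve_left hx
  pos_nontrivial i := S.exists_pos hS i
  val_zero := by rw [(S.v_eq_top_iff 0).2 rfl, WithTop.untopD_top]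
  val_smul c x hc := by rw [S.v_smul c x hc]

theorem isHamel (hS : S.Independent) (hS' : S.Dense) : (S.toBiorderedSpace hS).IsHamel where
  total x hx := ((S.isOrder 1).pos_or x).resolve_left hx
  val_pos x hx := by
    have := S.positive x
    rw [← S.coe_untopD hx] at this
    exact this
  val_val x := by
    by_cases hx : x = 0
    · have := (S.toBiorderedSpace hS).val_zero
      rw [hx, this, this]
    · have := S.idempotent x
      rw [← S.coe_untopD hx] at this
      have e : S.v ((S.v x).untopD 0) = (((S.v x).untopD 0 : G) : WithTop G) := this.symm
      change (S.v ((S.v x).untopD 0)).untopD 0 = (S.v x).untopD 0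
      rw [e, WithTop.untopD_coe]
  val_add x y hx hy hxy := by
    have h := S.min_le_v_add x y
    rw [← S.coe_untopD hx, ← S.coe_untopD hy, ← S.coe_untopD hxy] at h
    exact h.imp (S.isOrder 0).not_lt_of_leTop (S.isOrder 0).not_lt_of_leTop
  convex x y hx hxy := by
    have h1 := S.convex x y hx (((S.isOrder 1).lt_iff _ _).2 hxy)
    have hx0 : x ≠ 0 := fun h => (S.isOrder 1).irrefl 0 (by rwa [h] at hx)
    have hy0 : y ≠ 0 := by
      have := (S.isOrder 1).pos_add hx hxy
      rw [add_sub_cancel] at this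
      rintro rfl
      exact (S.isOrder 1).irrefl 0 this
    rw [← S.coe_untopD hx0, ← S.coe_untopD hy0] at h1
    exact (S.isOrder 0).not_lt_of_leTop h1
  independent a₀ b₀ a₁ b₁ h₀ h₁ := by
    obtain ⟨z, hz⟩ := hS Finset.univ
      (fun i => (((![a₀, a₁] i : G) : WithTop G) : WithBot (WithTop G)))
      (fun i => (((![b₀, b₁] i : G) : WithTop G) : WithBot (WithTop G))) (by
        intro i _
        fin_cases i
        · exact ((S.isOrder 0).lt_iff _ _).2 h₀
        · exact ((S.isOrder 1).lt_iff _ _).2 h₁)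
    have h0 := hz 0 (Finset.mem_univ _)
    have h1 := hz 1 (Finset.mem_univ _)
    exact ⟨z, ⟨((S.isOrder 0).lt_iff _ _).1 h0.1, ((S.isOrder 0).lt_iff _ _).1 h0.2⟩,
      ((S.isOrder 1).lt_iff _ _).1 h1.1, ((S.isOrder 1).lt_iff _ _).1 h1.2⟩
  dense a b hab := by
    obtain ⟨c, hc⟩ := hS' a b (((S.isOrder 0).lt_iff _ _).2 hab)
    have hc0 : c ≠ 0 := by
      rintro rfl
      rw [(S.v_eq_top_iff 0).2 rfl] at hc
      exact hc.2
    rw [← S.coe_untopD hc0] at hc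
    exact ⟨c, hc0, ((S.isOrder 0).lt_iff _ _).1 hc.1, ((S.isOrder 0).lt_iff _ _).1 hc.2⟩

/-- The structure of a Hamel space is given by its underlying biordered space. -/
def carrier (hS : S.Independent) : letI := S.toStructure
    Carrier (S.toBiorderedSpace hS) (WithTop G) true :=
  letI := S.toStructure
  { emb := fun x => (x : WithTop G)
    injective := WithTop.coe_injective
    cover := fun x => by
      cases x with
      | top => exact Or.inl rfl
      | coe x => exact Or.inr ⟨x, rfl⟩
    ne_infty := fun _ x => WithTop.coe_ne_top
    infty_eq := fun h => nomatch h
    zero := rfl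
    add := fun _ _ => rfl
    smul := fun _ _ => rfl
    infty_add := fun _ x => WithTop.top_add x
    add_infty := fun _ x => WithTop.add_top x
    smul_infty := fun _ _ => rfl
    val := fun x hx => (S.coe_untopD hx).symm
    val_zero := (S.v_eq_top_iff 0).2 rfl
    val_infty := rfl
    lt := fun i x y => (S.isOrder i).lt_iff x y
    lt_infty := fun _ _ _ => trivial
    not_infty_lt := fun _ _ _ h => h }

end HamelSpace

theorem isModelOf_of_model_tham {M : Type u} [(hamelLang C).Structure M] (hM : M ⊨ THam C) :
    IsModelOf (HamelClass C) true M := by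
  intro σ hσ
  refine hM.realize_of_mem σ fun G _ _ S hS hS' => ?_
  let := S.toStructure
  exact hσ G (S.toBiorderedSpace hS) (S.isHamel hS hS') (WithTop G) (S.carrier hS)

/-- Theories all of whose models are of the form considered eliminate quantifiers and are distal. -/
theorem backAndForth_of_isModelOf {T : (hamelLang C).Theory}
    {P : ∀ (G : Type u) [AddCommGroup G] [Module C G], BiorderedSpace C G → Prop} {b : Bool}
    (hT : ∀ (M : Type u) [(hamelLang C).Structure M] [M ⊨ T], IsModelOf P b M)
    (hP : ∀ (M N : Type u) [(hamelLang C).Structure M] [(hamelLang C).Structure N]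
      (h : IsModelOf P b M) (h' : IsModelOf P b N),
      letI := h.addCommGroup; letI := h.module; letI := h'.addCommGroup; letI := h'.module
      h.space.HasExtension h'.space) :
    BackAndForth.{u, 0, u} T := by
  intro M N _ _ _ _ _ _ β a a' haa' x ψ hψ hx
  let h := hT M
  let h' := hT N
  let := h.addCommGroup
  let := h.module
  let := h'.addCommGroup
  let := h'.module
  exact h.carrier.back_and_forth h'.carrier (hP M N h h') haa' x hψ hx

theorem locallyDistal_of_isModelOf {T : (hamelLang C).Theory}
    {P : ∀ (G : Type u) [AddCommGroup G] [Module C G], BiorderedSpace C G → Prop} {b : Bool}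
    (hT : ∀ (M : Type u) [(hamelLang C).Structure M] [M ⊨ T], IsModelOf P b M)
    (hT' : BackAndForth.{u, 0, u} T)
    (hP : ∀ (M : Type u) [(hamelLang C).Structure M] (h : IsModelOf P b M),
      letI := h.addCommGroup; letI := h.module; h.space.HasValueDichotomy)
    (M : Type u) [(hamelLang C).Structure M] [Nonempty M] [M ⊨ T] :
    LocallyDistal (hamelLang C) M := by
  let h := hT M
  let := h.addCommGroup
  let := h.module
  exact h.carrier.locallyDistal hT' (hP M h)

theorem backAndForth_tham : BackAndForth.{u, 0, u} (THam C) :=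
  backAndForth_of_isModelOf (fun M _ hM => isModelOf_of_model_tham hM)
    fun M N _ _ h h' => by
      let := h.addCommGroup
      let := h.module
      let := h'.addCommGroup
      let := h'.module
      exact h.isHamel.hasExtension h'.isHamel

theorem isDistal_tham : IsDistal (THam C) :=
  isDistal_of_locallyDistal fun M _ _ _ =>
    locallyDistal_of_isModelOf (fun M _ hM => isModelOf_of_model_tham hM) backAndForth_tham
      (fun M _ h => by
        let := h.addCommGroup
        let := h.module
        exact h.isHamel.hasValueDichotomy) M

end HamelSpaces
end Hamel

namespace Hamel

/-! ### Lexicographic orders -/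

section Lexicographic

variable {C : Type*} [Field C] {H : Type*} [LinearOrder H]

/-- The lexicographic order; the smallest index dominates. -/
def LexLT [LinearOrder C] (x y : H →₀ C) : Prop := ∃ i, (∀ j < i, x j = y j) ∧ x i < y i

/-- The smallest index in the support of `x` is `i`. -/
def LeadsAt (x : H →₀ C) (i : H) : Prop := (∀ j < i, x j = 0) ∧ x i ≠ 0

theorem exists_leadsAt {x : H →₀ C} (hx : x ≠ 0) : ∃ i, LeadsAt x i := by
  have h : x.support.Nonempty := Finsupp.support_nonempty_iff.2 hx
  refine ⟨x.support.min' h, fun j hj => ?_, Finsupp.mem_support_iff.1 (x.support.min'_mem h)⟩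
  by_contra h0
  exact absurd (x.support.min'_le j (Finsupp.mem_support_iff.2 h0)) (not_le.2 hj)

theorem LeadsAt.le {x : H →₀ C} {i j : H} (h : LeadsAt x i) (hj : x j ≠ 0) : i ≤ j :=
  not_lt.1 fun h1 => hj (h.1 j h1)

theorem LeadsAt.unique {x : H →₀ C} {i j : H} (h : LeadsAt x i) (h' : LeadsAt x j) : i = j :=
  le_antisymm (h.le h'.2) (h'.le h.2)

theorem LeadsAt.ne_zero {x : H →₀ C} {i : H} (h : LeadsAt x i) : x ≠ 0 := fun h0 =>
  h.2 (by rw [h0, Finsupp.zero_apply])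

variable [LinearOrder C]

theorem LeadsAt.lexLT_iff {x : H →₀ C} {i : H} (h : LeadsAt x i) : LexLT 0 x ↔ 0 < x i := by
  constructor
  · rintro ⟨j, h1, h2⟩
    rw [h.unique ⟨fun k hk => (h1 k hk).symm, (ne_of_lt h2).symm⟩]
    exact h2
  · exact fun h1 => ⟨i, fun j hj => (h.1 j hj).symm, h1⟩

theorem exists_leadsAt_of_lexLT {x : H →₀ C} (h : LexLT 0 x) : ∃ i, LeadsAt x i ∧ 0 < x i := by
  obtain ⟨i, h1, h2⟩ := h
  exact ⟨i, ⟨fun j hj => (h1 j hj).symm, (ne_of_lt h2).symm⟩, h2⟩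

theorem isVectorSpaceOrder_lexLT [IsStrictOrderedRing C] : IsVectorSpaceOrder C (LexLT : (H →₀ C) → (H →₀ C) → Prop) where
  irrefl x := fun ⟨i, _, h⟩ => lt_irrefl _ h
  trans x y z := by
    rintro ⟨i, hi, hi'⟩ ⟨j, hj, hj'⟩
    rcases lt_trichotomy i j with h | rfl | h
    · exact ⟨i, fun k hk => (hi k hk).trans (hj k (hk.trans h)), (hj i h) ▸ hi'⟩
    · exact ⟨i, fun k hk => (hi k hk).trans (hj k hk), hi'.trans hj'⟩
    · exact ⟨j, fun k hk => (hi k (hk.trans h)).trans (hj k hk), (hi j h) ▸ hj'⟩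
  total x y hxy := by
    obtain ⟨i, h1, h2⟩ := exists_leadsAt (sub_ne_zero.2 hxy)
    have h3 : ∀ j < i, x j = y j := fun j hj => sub_eq_zero.1 (h1 j hj)
    rcases lt_or_gt_of_ne (sub_ne_zero.1 h2 : x i ≠ y i) with h | h
    · exact Or.inl ⟨i, h3, h⟩
    · exact Or.inr ⟨i, fun j hj => (h3 j hj).symm, h⟩
  add_left x y z := by
    rintro ⟨i, h1, h2⟩
    refine ⟨i, fun j hj => ?_, ?_⟩
    · rw [Finsupp.add_apply, Finsupp.add_apply, h1 j hj]
    · rw [Finsupp.add_apply, Finsupp.add_apply]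
      exact add_lt_add_right h2 _
  smul_pos r x := by
    rintro hr ⟨i, h1, h2⟩
    refine ⟨i, fun j hj => ?_, ?_⟩
    · rw [Finsupp.smul_apply, ← h1 j hj, Finsupp.zero_apply, smul_zero]
    · rw [Finsupp.smul_apply]
      exact smul_pos hr h2

theorem IsVectorSpaceOrder.comap {G G' : Type*} [AddCommGroup G] [Module C G] [AddCommGroup G']
    [Module C G'] {lt : G' → G' → Prop} (h : IsVectorSpaceOrder C lt) (f : G ≃ₗ[C] G') :
    IsVectorSpaceOrder C fun x y => lt (f x) (f y) where
  irrefl x := h.irrefl _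
  trans x y z := h.trans _ _ _
  total x y hxy := h.total _ _ fun h1 => hxy (f.injective h1)
  add_left x y z hxy := by
    rw [map_add, map_add]
    exact h.add_left _ _ _ hxy
  smul_pos r x hr hx := by
    rw [map_zero] at hx ⊢
    rw [map_smul]
    exact h.smul_pos r _ hr hx

end Lexicographic

/-! ### The Hamel space of a basis -/

section BasisValuation

variable {C : Type*} [Field C]
variable {G : Type*} [AddCommGroup G] [Module C G] {H : Type*} [LinearOrder H]

open Classical in
/-- The least basis vector with nonzero coefficient. -/
noncomputable def basisVal (e : Module.Basis H C G) (x : G) : WithTop G :=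
  if h : e.repr x = 0 then ⊤ else ↑(e (exists_leadsAt h).choose)

theorem basisVal_of_leadsAt {e : Module.Basis H C G} {x : G} {i : H} (h : LeadsAt (e.repr x) i) :
    basisVal e x = e i := by
  rw [basisVal, dif_neg h.ne_zero, (exists_leadsAt h.ne_zero).choose_spec.unique h]

theorem basisVal_zero (e : Module.Basis H C G) : basisVal e 0 = ⊤ := by
  rw [basisVal, dif_pos (map_zero _)]

theorem exists_leadsAt_repr (e : Module.Basis H C G) {x : G} (hx : x ≠ 0) :
    ∃ i, LeadsAt (e.repr x) i :=
  exists_leadsAt fun h => hx ((LinearEquiv.map_eq_zero_iff _).1 h)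

theorem leadsAt_basis (e : Module.Basis H C G) (i : H) : LeadsAt (e.repr (e i)) i := by
  rw [e.repr_self]
  exact ⟨fun j hj => Finsupp.single_eq_of_ne hj.ne, by simp⟩

variable [LinearOrder C] [IsStrictOrderedRing C]

/-- The Hamel space given by a basis of an ordered vector space. -/
noncomputable def HamelSpace.ofBasis (e : Module.Basis H C G) {lt : G → G → Prop}
    (hlt : IsVectorSpaceOrder C lt) (hmono : ∀ i j, i < j → lt (e i) (e j)) : HamelSpace C G where
  lt := ![lt, fun x y => LexLT (e.repr x) (e.repr y)]
  isOrder i := by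
    fin_cases i
    exacts [hlt, isVectorSpaceOrder_lexLT.comap e.repr]
  v := basisVal e
  v_eq_top_iff x := by
    refine ⟨fun h => ?_, fun h => h ▸ basisVal_zero e⟩
    by_contra hx
    obtain ⟨i, hi⟩ := exists_leadsAt_repr e hx
    rw [basisVal_of_leadsAt hi] at h
    exact WithTop.coe_ne_top h
  min_le_v_add x y := by
    have key : ∀ {i j : H}, i ≤ j → leTop lt (e i : WithTop G) (e j) := fun {i j} hij => by
      rcases hij.eq_or_lt with rfl | h
      exacts [Or.inl rfl, Or.inr (hmono i j h)]
    by_cases hx : x = 0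
    · subst hx
      rw [zero_add]
      exact Or.inr (Or.inl rfl)
    by_cases hy : y = 0
    · subst hy
      rw [add_zero]
      exact Or.inl (Or.inl rfl)
    obtain ⟨i, hi⟩ := exists_leadsAt_repr e hx
    obtain ⟨j, hj⟩ := exists_leadsAt_repr e hy
    by_cases hxy : x + y = 0
    · rw [hxy, basisVal_zero, basisVal_of_leadsAt hi]
      exact Or.inl (Or.inr trivial)
    obtain ⟨k, hk⟩ := exists_leadsAt_repr e hxy
    rw [basisVal_of_leadsAt hi, basisVal_of_leadsAt hj, basisVal_of_leadsAt hk]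
    have : i ≤ k ∨ j ≤ k := by
      by_contra! h
      apply hk.2
      rw [map_add, Finsupp.add_apply, hi.1 k h.1, hj.1 k h.2, add_zero]
    exact this.imp key key
  v_smul r x hr := by
    by_cases hx : x = 0
    · rw [hx, smul_zero]
    obtain ⟨i, hi⟩ := exists_leadsAt_repr e hx
    have : LeadsAt (e.repr (r • x)) i := by
      rw [map_smul]
      exact ⟨fun j hj => by rw [Finsupp.smul_apply, hi.1 j hj, smul_zero],
        by rw [Finsupp.smul_apply]; exact smul_ne_zero hr hi.2⟩
    rw [basisVal_of_leadsAt hi, basisVal_of_leadsAt this]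
  convex x y hx hxy := by
    have hx : LexLT (e.repr 0) (e.repr x) := hx
    have hxy : LexLT (e.repr x) (e.repr y) := hxy
    have hy := isVectorSpaceOrder_lexLT.trans _ _ _ hx hxy
    rw [map_zero] at hx hy
    obtain ⟨i, hi, hi0⟩ := exists_leadsAt_of_lexLT hx
    obtain ⟨j, hj, hj0⟩ := exists_leadsAt_of_lexLT hy
    rw [basisVal_of_leadsAt hi, basisVal_of_leadsAt hj]
    have : j ≤ i := by
      by_contra! h
      have h1 : LexLT (e.repr y) (e.repr x) := ⟨i, fun k hk => by
        rw [hi.1 k hk, hj.1 k (hk.trans h)], by rwa [hj.1 i h]⟩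
      exact isVectorSpaceOrder_lexLT.irrefl _ (isVectorSpaceOrder_lexLT.trans _ _ _ hxy h1)
    rcases this.eq_or_lt with rfl | h
    exacts [Or.inl rfl, Or.inr (hmono j i h)]
  idempotent x := by
    by_cases hx : x = 0
    · rw [hx, basisVal_zero]
      rfl
    obtain ⟨i, hi⟩ := exists_leadsAt_repr e hx
    rw [basisVal_of_leadsAt hi]
    exact (basisVal_of_leadsAt (leadsAt_basis e i)).symm
  positive x := by
    by_cases hx : x = 0
    · rw [hx, basisVal_zero]
      trivial
    obtain ⟨i, hi⟩ := exists_leadsAt_repr e hx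
    rw [basisVal_of_leadsAt hi]
    change LexLT (e.repr 0) (e.repr (e i))
    rw [map_zero, (leadsAt_basis e i).lexLT_iff, e.repr_self, Finsupp.single_eq_same]
    exact one_pos

omit [IsStrictOrderedRing C] in
/-- In an order without endpoints, intervals contain intervals with finite endpoints. -/
theorem IsVectorSpaceOrder.exists_finite_interval {lt : G → G → Prop} (h : IsVectorSpaceOrder C lt)
    {p : G} (hp : lt 0 p) {a b : WithBot (WithTop G)} (hab : ltExt lt a b) :
    ∃ a' b' : G, lt a' b' ∧
      ∀ z : G, lt a' z → lt z b' → ltExt lt a (z : WithTop G) ∧ ltExt lt (z : WithTop G) b := by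
  have h1 : ∀ x, lt x (x + p) := fun x => by
    have := h.add_left _ _ x hp
    rwa [add_zero] at this
  have h2 : ∀ x, lt (x - p) x := fun x => by
    have := h1 (x - p)
    rwa [sub_add_cancel] at this
  induction a using WithBot.recBotCoe with
  | bot =>
    induction b using WithBot.recBotCoe with
    | bot => exact absurd hab id
    | coe b =>
      induction b using WithTop.recTopCoe with
      | top => exact ⟨0, p, hp, fun z _ _ => ⟨trivial, trivial⟩⟩
      | coe b => exact ⟨b - p, b, h2 b, fun z _ hz => ⟨trivial, hz⟩⟩
  | coe a =>
    induction b using WithBot.recBotCoe with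
    | bot => cases a <;> exact absurd hab id
    | coe b =>
      induction a using WithTop.recTopCoe with
      | top => exact absurd hab id
      | coe a =>
        induction b using WithTop.recTopCoe with
        | top => exact ⟨a, a + p, h1 a, fun z hz _ => ⟨hz, trivial⟩⟩
        | coe b => exact ⟨a, b, hab, fun z hz hz' => ⟨hz, hz'⟩⟩

omit [IsStrictOrderedRing C] in
theorem OrderedSpace.independent_of_finite (S : OrderedSpace C (Fin 2) G)
    (hpos : ∀ i, ∃ p, S.lt i 0 p)
    (hS : ∀ a b : Fin 2 → G, (∀ i, S.lt i (a i) (b i)) →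
      ∃ z, ∀ i, S.lt i (a i) z ∧ S.lt i z (b i)) : S.Independent := by
  intro s a b hab
  choose p hp using hpos
  have : ∀ i, ∃ a' b' : G, S.lt i a' b' ∧ (i ∈ s → ∀ z : G, S.lt i a' z → S.lt i z b' →
      ltExt (S.lt i) (a i) (z : WithTop G) ∧ ltExt (S.lt i) (z : WithTop G) (b i)) := by
    intro i
    by_cases hi : i ∈ s
    · obtain ⟨a', b', h1, h2⟩ := (S.isOrder i).exists_finite_interval (hp i) (hab i hi)
      exact ⟨a', b', h1, fun _ => h2⟩
    · exact ⟨0, p i, hp i, fun h => absurd h hi⟩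
  choose a' b' h1 h2 using this
  obtain ⟨z, hz⟩ := hS a' b' h1
  exact ⟨z, fun i hi => h2 i hi z (hz i).1 (hz i).2⟩

theorem HamelSpace.ofBasis_dense (e : Module.Basis H C G) {lt : G → G → Prop}
    (hlt : IsVectorSpaceOrder C lt) (hmono : ∀ i j, i < j → lt (e i) (e j))
    (hdense : ∀ a b, lt a b → ∃ i, lt a (e i) ∧ lt (e i) b) :
    (HamelSpace.ofBasis e hlt hmono).Dense := by
  intro a b hab
  obtain ⟨i, hi⟩ := hdense a b hab
  refine ⟨e i, ?_⟩
  have : (HamelSpace.ofBasis e hlt hmono).v (e i) = e i := basisVal_of_leadsAt (leadsAt_basis e i)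
  rw [this]
  exact hi

/-- Let `m` be the midpoint of the `<₁`-interval and `h` the leading index of its half-length `d`.
Adding to `m` a vector whose coordinates vanish up to `h` does not leave the interval. Differences
`e l - e k` with `k, l > h` are such vectors, and for fixed `k` density of the basis lets them reach
any `<₀`-interval. -/
theorem HamelSpace.ofBasis_independent [Nontrivial G] (e : Module.Basis H C G)
    {lt : G → G → Prop} (hlt : IsVectorSpaceOrder C lt) (hmono : ∀ i j, i < j → lt (e i) (e j))
    (hdense : ∀ a b, lt a b → ∃ i, lt a (e i) ∧ lt (e i) b) :
    (HamelSpace.ofBasis e hlt hmono).Independent := by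
  obtain ⟨q, hq⟩ : ∃ q, lt 0 q := by
    obtain ⟨x, hx⟩ := exists_ne (0 : G)
    rcases (hlt.pos_or x).resolve_left hx with h | h
    exacts [⟨_, h⟩, ⟨_, h⟩]
  have hlex : IsVectorSpaceOrder C fun x y => LexLT (e.repr x) (e.repr y) :=
    isVectorSpaceOrder_lexLT.comap e.repr
  have hlt_add : ∀ {x y z}, lt x y → lt (x + z) (y + z) := fun {x y z} h => by
    rw [add_comm x, add_comm y]
    exact hlt.add_left _ _ _ h
  have hof : ∀ i j, lt (e i) (e j) → i < j := by
    intro i j hij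
    by_contra! h
    rcases h.eq_or_lt with rfl | h
    · exact hlt.irrefl _ hij
    · exact hlt.irrefl _ (hlt.trans _ _ _ hij (hmono _ _ h))
  -- The basis vectors are unbounded for `<₀`.
  have hgt : ∀ x y : G, ∃ i, lt x (e i) ∧ lt y (e i) := by
    intro x y
    have key : ∀ x y, ¬ lt x y → ∃ i, lt x (e i) ∧ lt y (e i) := by
      intro x y h
      have h1 := hlt.add_left _ _ x hq
      rw [add_zero] at h1
      obtain ⟨i, hi, -⟩ := hdense _ _ h1
      refine ⟨i, hi, ?_⟩
      by_cases hxy : y = x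
      · rwa [hxy]
      · exact hlt.trans _ _ _ ((hlt.total _ _ hxy).resolve_right h) hi
    by_cases h : lt x y
    · obtain ⟨i, h1, h2⟩ := key y x fun h1 => hlt.irrefl _ (hlt.trans _ _ _ h h1)
      exact ⟨i, h2, h1⟩
    · exact key x y h
  refine OrderedSpace.independent_of_finite _ ?_ ?_
  · intro i
    fin_cases i
    · exact ⟨q, hq⟩
    · obtain ⟨i, -⟩ := hdense 0 q hq
      refine ⟨e i, ?_⟩
      change LexLT (e.repr 0) (e.repr (e i))
      rw [map_zero, (leadsAt_basis e i).lexLT_iff, e.repr_self, Finsupp.single_eq_same]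
      exact one_pos
  · intro a b hab
    have h0 : lt (a 0) (b 0) := hab 0
    have h1 : LexLT (e.repr (a 1)) (e.repr (b 1)) := hab 1
    set m : G := (2⁻¹ : C) • (a 1 + b 1) with hm
    set d : G := (2⁻¹ : C) • (b 1 - a 1) with hd
    have half : ∀ x : G, x = (2⁻¹ : C) • (x + x) := fun x => by
      rw [← two_smul C, smul_smul, inv_mul_cancel₀ two_ne_zero, one_smul]
    have ham : a 1 = m - d := by
      rw [hm, hd, ← smul_sub, show a 1 + b 1 - (b 1 - a 1) = a 1 + a 1 by abel, ← half]
    have hbm : b 1 = m + d := by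
      rw [hm, hd, ← smul_add, show a 1 + b 1 + (b 1 - a 1) = b 1 + b 1 by abel, ← half]
    have hdpos : LexLT 0 (e.repr d) := by
      have h2 := (hlex.lt_iff _ _).1 h1
      have h3 := hlex.smul_pos 2⁻¹ _ (by positivity) h2
      rwa [map_zero] at h3
    obtain ⟨h, hh, hh0⟩ := exists_leadsAt_of_lexLT hdpos
    -- The second lower bound on `e k` puts the interval for `e l` above `e h`, which forces `h <
    -- l`.
    obtain ⟨k, hk, hk'⟩ := hgt (e h) (e h - (a 0 - m))
    obtain ⟨l, hl, hl'⟩ := hdense (a 0 - m + e k) (b 0 - m + e k) (by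
      rw [sub_eq_add_neg, sub_eq_add_neg]
      exact hlt_add (hlt_add h0))
    have hkh := hof _ _ hk
    have hlh : h < l := by
      apply hof
      have h4 := hlt_add (z := a 0 - m) hk'
      rw [sub_add_cancel, add_comm (e k)] at h4
      exact hlt.trans _ _ _ h4 hl
    have hu : ∀ j ≤ h, e.repr (e l - e k) j = 0 := by
      intro j hj
      rw [map_sub, Finsupp.sub_apply, (leadsAt_basis e l).1 j (hj.trans_lt hlh),
        (leadsAt_basis e k).1 j (hj.trans_lt hkh), sub_zero]
    refine ⟨m + (e l - e k), fun i => ?_⟩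
    fin_cases i
    · constructor
      · change lt (a 0) _
        have h4 := hlt_add (z := m - e k) hl
        convert h4 using 1 <;> abel
      · change lt _ (b 0)
        have h4 := hlt_add (z := m - e k) hl'
        convert h4 using 1 <;> abel
    · constructor
      · change LexLT (e.repr (a 1)) (e.repr (m + (e l - e k)))
        rw [ham]
        refine ⟨h, fun j hj => ?_, ?_⟩
        · rw [map_sub, map_add, Finsupp.sub_apply, Finsupp.add_apply, hh.1 j hj, hu j hj.le,
            sub_zero, add_zero]
        · rw [map_sub, map_add, Finsupp.sub_apply, Finsupp.add_apply, hu h le_rfl, add_zero]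
          exact sub_lt_self _ hh0
      · change LexLT (e.repr (m + (e l - e k))) (e.repr (b 1))
        rw [hbm]
        refine ⟨h, fun j hj => ?_, ?_⟩
        · rw [map_add, map_add, Finsupp.add_apply, Finsupp.add_apply, hh.1 j hj, hu j hj.le]
        · rw [map_add, map_add, Finsupp.add_apply, Finsupp.add_apply, hu h le_rfl, add_zero]
          exact lt_add_of_pos_right _ hh0

end BasisValuation

/-! ### Existence of independent, dense Hamel spaces -/

section Existence

open Cardinal

/-- There are functions from a suitable cardinal to the finitely supported functions on it that
are triangular and attain each value cofinally. -/
theorem exists_cofinal_enumeration (C : Type u) [Field C] :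
    ∃ (Γ : Type u) (_ : LinearOrder Γ) (_ : WellFoundedLT Γ) (_ : Nonempty Γ)
      (g : Γ → Γ →₀ C), (∀ γ δ, g γ δ ≠ 0 → δ < γ) ∧ ∀ x δ, ∃ γ, δ < γ ∧ g γ = x := by
  -- With this choice there are exactly `κ` finitely supported functions, so each can be listed `κ`
  -- times, while proper initial segments of `κ.ord` are smaller than `κ`.
  let κ : Cardinal.{u} := max #C ℵ₀
  have hκ : ℵ₀ ≤ κ := le_max_right _ _
  have hΓ : #κ.ord.ToType = κ := mk_ord_toType κ
  have : Infinite κ.ord.ToType := by rwa [infinite_iff, hΓ]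
  have hG : #(κ.ord.ToType →₀ C) = κ := by
    rw [mk_finsupp_of_infinite, hΓ]
    exact max_eq_left (le_max_left _ _)
  obtain ⟨f⟩ : Nonempty (κ.ord.ToType ≃ (κ.ord.ToType →₀ C) × κ.ord.ToType) := by
    rw [← Cardinal.eq, mk_prod, lift_id, lift_id, hG, hΓ, mul_eq_self hκ]
  classical
  -- Entries that are not supported below their own index are replaced by `0`, which makes the list
  -- triangular. Every `x` is still listed beyond any given bound, at indices above its support.
  refine ⟨κ.ord.ToType, inferInstance, inferInstance, inferInstance,
    fun γ => if ∀ δ, (f γ).1 δ ≠ 0 → δ < γ then (f γ).1 else 0, fun γ δ h => ?_, fun x δ => ?_⟩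
  · beta_reduce at h
    by_cases h1 : ∀ δ, (f γ).1 δ ≠ 0 → δ < γ
    · rw [if_pos h1] at h
      exact h1 δ h
    · rw [if_neg h1] at h
      exact absurd rfl h
  · obtain ⟨ε, hε⟩ := (insert δ x.support).exists_le
    have hcard : #{γ // (f γ).1 = x} = κ := by
      refine (mk_congr (β := κ.ord.ToType) ⟨fun γ => (f γ.1).2, fun γ => ⟨f.symm (x, γ), by simp⟩, ?_, ?_⟩).trans hΓ
      · rintro ⟨γ, rfl⟩
        simp
      · intro γ
        simp
    obtain ⟨γ, hγ, hεγ⟩ : ∃ γ, (f γ).1 = x ∧ ε < γ := by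
      by_contra! h
      have h1 : κ ≤ #(Set.Iic ε) := hcard.symm.le.trans <| mk_le_of_injective
        (f := fun γ : {γ // (f γ).1 = x} => (⟨γ.1, h γ.1 γ.2⟩ : Set.Iic ε))
          fun a b hab => Subtype.ext (congrArg (fun z : Set.Iic ε => (z : κ.ord.ToType)) hab)
      refine absurd h1 (not_le.2 ?_)
      rw [← Set.Iio_insert]
      refine (mk_insert_le).trans_lt (add_lt_of_lt hκ ((mk_Iio_lt ε (by simp)).trans_eq hΓ) ?_)
      exact one_lt_aleph0.trans_le hκ
    refine ⟨γ, (hε δ (Finset.mem_insert_self _ _)).trans_lt hεγ, ?_⟩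
    beta_reduce
    rw [if_pos, hγ]
    intro δ hδ
    rw [hγ] at hδ
    exact (hε δ (Finset.mem_insert_of_mem (Finsupp.mem_support_iff.2 hδ))).trans_lt hεγ

/-- A triangular perturbation of the standard basis is a basis. -/
theorem exists_triangular_basis {C : Type*} [Field C] {Γ : Type*} [LinearOrder Γ] [WellFoundedLT Γ]
    (g : Γ → Γ →₀ C) (hg : ∀ γ δ, g γ δ ≠ 0 → δ < γ) :
    ∃ e : Module.Basis Γ C (Γ →₀ C), ∀ γ, e γ = g γ + Finsupp.single γ 1 := by
  let e : Γ → Γ →₀ C := fun γ => g γ + Finsupp.single γ 1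
  have hli : LinearIndependent C e := by
    rw [linearIndependent_iff]
    intro l hl
    by_contra h0
    have hs : l.support.Nonempty := Finsupp.support_nonempty_iff.2 h0
    set γ := l.support.max' hs with hγ
    -- At the largest index of the support only `e γ` contributes to the coordinate `γ`.
    have h1 : (Finsupp.linearCombination C e l) γ = l γ := by
      rw [Finsupp.linearCombination_apply, Finsupp.sum, Finsupp.finsetSum_apply,
        Finset.sum_eq_single γ]
      · have h2 : g γ γ = 0 := by
          by_contra h
          exact lt_irrefl _ (hg γ γ h)
        simp [e, h2]
      · intro δ hδ hδγ
        have h2 : δ ≤ γ := l.support.le_max' δ hδ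
        have h3 : g δ γ = 0 := by
          by_contra h
          exact absurd (hg δ γ h) (not_lt.2 h2)
        simp [e, h3, Finsupp.single_eq_of_ne hδγ.symm]
      · intro h
        exact absurd (l.support.max'_mem hs) h
    rw [hl, Finsupp.zero_apply] at h1
    exact Finsupp.mem_support_iff.1 (l.support.max'_mem hs) h1.symm
  have hsingle : ∀ γ, Finsupp.single γ (1 : C) ∈ Submodule.span C (Set.range e) := by
    intro γ
    induction γ using WellFoundedLT.induction with
    | ind γ ih =>
      have h1 : Finsupp.single γ (1 : C) = e γ - g γ := by simp [e]
      rw [h1]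
      refine Submodule.sub_mem _ (Submodule.subset_span ⟨γ, rfl⟩) ?_
      rw [← (g γ).sum_single]
      refine Submodule.sum_mem _ fun δ hδ => ?_
      rw [← mul_one (g γ δ), ← smul_eq_mul, ← Finsupp.smul_single]
      exact Submodule.smul_mem _ _ (ih δ (hg γ δ (Finsupp.mem_support_iff.1 hδ)))
  refine ⟨Module.Basis.mk hli ?_, fun γ => Module.Basis.mk_apply _ _ _⟩
  rw [← Finsupp.basisSingleOne.span_eq, Submodule.span_le]
  rintro _ ⟨γ, rfl⟩
  rw [Finsupp.coe_basisSingleOne]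
  exact hsingle γ

/-- In the lexicographic order a perturbation at an index beyond the leading one of `b - a` is
negligible. Every vector, in particular the midpoint of `a` and `b`, is `g γ` for arbitrarily large
`γ`, so the basis `g γ + single γ 1` is dense and the construction from a basis applies. -/
theorem exists_hamelSpace (C : Type u) [Field C] [LinearOrder C] [IsStrictOrderedRing C] :
    ∃ (G : Type u) (_ : AddCommGroup G) (_ : Module C G) (S : HamelSpace C G),
      S.Independent ∧ S.Dense := by
  obtain ⟨Γ, _, _, _, g, hg, hg'⟩ := exists_cofinal_enumeration C
  obtain ⟨e, he⟩ := exists_triangular_basis g hg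
  have hlt := isVectorSpaceOrder_lexLT (C := C) (H := Γ)
  have hdense : ∀ a b : Γ →₀ C, LexLT a b → ∃ γ, LexLT a (e γ) ∧ LexLT (e γ) b := by
    intro a b hab
    have hd := hlt.smul_pos 2⁻¹ _ (by positivity) ((hlt.lt_iff _ _).1 hab)
    obtain ⟨δ, hδ, hδ0⟩ := exists_leadsAt_of_lexLT hd
    obtain ⟨γ, hγ, hγm⟩ := hg' ((2⁻¹ : C) • (a + b)) δ
    have hsmall : ∀ j ≤ δ, Finsupp.single γ (1 : C) j = 0 := fun j hj =>
      Finsupp.single_eq_of_ne (hj.trans_lt hγ).ne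
    have half : ∀ x : Γ →₀ C, x = (2⁻¹ : C) • (x + x) := fun x => by
      rw [← two_smul C, smul_smul, inv_mul_cancel₀ two_ne_zero, one_smul]
    refine ⟨γ, ?_, ?_⟩ <;> rw [he, hγm, hlt.lt_iff]
    · have h1 : (2⁻¹ : C) • (a + b) + Finsupp.single γ 1 - a =
          (2⁻¹ : C) • (b - a) + Finsupp.single γ 1 := by
        conv_lhs => rw [half a]
        rw [add_sub_right_comm, ← smul_sub, ← half]
        congr 2
        abel
      rw [h1]
      refine ⟨δ, fun j hj => ?_, ?_⟩
      · rw [Finsupp.add_apply, hδ.1 j hj, hsmall j hj.le, add_zero, Finsupp.zero_apply]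
      · rw [Finsupp.add_apply, hsmall δ le_rfl, add_zero, Finsupp.zero_apply]
        exact hδ0
    · have h1 : b - ((2⁻¹ : C) • (a + b) + Finsupp.single γ 1) =
          (2⁻¹ : C) • (b - a) - Finsupp.single γ 1 := by
        conv_lhs => rw [half b]
        rw [← sub_sub, ← smul_sub, ← half]
        congr 2
        abel
      rw [h1]
      refine ⟨δ, fun j hj => ?_, ?_⟩
      · rw [Finsupp.sub_apply, hδ.1 j hj, hsmall j hj.le, sub_zero, Finsupp.zero_apply]
      · rw [Finsupp.sub_apply, hsmall δ le_rfl, sub_zero, Finsupp.zero_apply]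
        exact hδ0
  have hinj := e.injective
  -- The index set is now reordered by the sizes of the basis vectors. This differs from the
  -- well-order used for the lexicographic order, hence the explicit instances below.
  let ltΓ : Γ → Γ → Prop := fun i j => LexLT (e i) (e j)
  have : IsStrictTotalOrder Γ ltΓ :=
    { irrefl := fun i => hlt.irrefl _
      trans := fun i j k => hlt.trans _ _ _
      trichotomous := fun i j h1 h2 => by
        by_contra h
        exact (hlt.total _ _ fun h3 => h (hinj h3)).elim h1 h2 }
  classical
  exact ⟨Γ →₀ C, inferInstance, inferInstance,
    @HamelSpace.ofBasis C _ (Γ →₀ C) _ _ Γ (linearOrderOfSTO ltΓ) _ _ e LexLT hlt fun _ _ h => h,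
    @HamelSpace.ofBasis_independent C _ (Γ →₀ C) _ _ Γ (linearOrderOfSTO ltΓ) _ _ _ e LexLT hlt
      (fun _ _ h => h) hdense,
    @HamelSpace.ofBasis_dense C _ (Γ →₀ C) _ _ Γ (linearOrderOfSTO ltΓ) _ _ e LexLT hlt
      (fun _ _ h => h) hdense⟩

end Existence

end Hamel

namespace Hamel

/-! ### Completeness -/

section Completeness

open FirstOrder.Language

variable {C : Type u} [Field C] [LinearOrder C] [IsStrictOrderedRing C]

/-- The zero subspace embeds trivially, so the extension property gives a linear map respecting the
finite set of elements that `ψ` involves. -/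
theorem Carrier.realize_iff_of_isEmpty {G G' : Type*} [AddCommGroup G] [Module C G]
    [AddCommGroup G'] [Module C G'] {K : BiorderedSpace C G} {K' : BiorderedSpace C G'}
    {X X' : Type*} [(hamelLang C).Structure X] [(hamelLang C).Structure X'] {b : Bool}
    (c : Carrier K X b) (c' : Carrier K' X' b) (hKK' : K.HasExtension K') {β : Type*} [IsEmpty β]
    {ψ : (hamelLang C).Formula β} (hψ : BoundedFormula.IsQF ψ) (a : β → X) (a' : β → X') :
    ψ.Realize a ↔ ψ.Realize a' := by
  obtain ⟨F, hF, h⟩ := c.exists_admissible_formula c' (A := ⊥) (d := 0) (v := a) (xs := default)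
    (by
      rintro (z | z) e he
      exacts [isEmptyElim z, z.elim0]) hψ
  obtain ⟨g, -, hg⟩ := hKK' ⊥ 0 0 F
    (fun x hx => by
      rw [(Submodule.mem_bot C).1 hx, K.val_zero]
      exact Submodule.zero_mem _)
    (fun x hx => by
      rw [(Submodule.mem_bot C).1 hx]
      refine ⟨fun i => ?_, ?_⟩
      · rw [_root_.map_zero, neg_zero, neg_zero]
        exact ⟨iff_of_false (K'.not_pos_zero i) (K.not_pos_zero i),
          iff_of_false (K'.not_pos_zero i) (K.not_pos_zero i)⟩
      · rw [K.val_zero, _root_.map_zero, K'.val_zero]) hF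
  rw [Formula.Realize, ← h g hg, Formula.Realize, Subsingleton.elim (c.map c' g ∘ a) a',
    Subsingleton.elim (c.map c' g ∘ default) default]

theorem isComplete_tham : (THam C).IsComplete := by
  rw [Theory.IsComplete.isComplete_iff_models_elementarily_equivalent]
  constructor
  · obtain ⟨G, _, _, S, hS, hS'⟩ := exists_hamelSpace C
    let := S.toStructure
    have : WithTop G ⊨ THam C := ⟨fun σ hσ => hσ G S hS hS'⟩
    exact Theory.Model.isSatisfiable (WithTop G)
  · intro M N
    rw [elementarilyEquivalent_iff]
    intro σ
    -- The empty type of variables is moved to the universe in which quantifiers have been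
    -- eliminated.
    obtain ⟨ψ, hψ, h⟩ := (backAndForth_tham (C := C)).quantifierElimination
      (σ.relabel (Empty.elim : Empty → PEmpty.{u + 1}) : (hamelLang C).Formula PEmpty.{u + 1})
    have key : ∀ (M : Type u) [(hamelLang C).Structure M] [Nonempty M] [M ⊨ THam C],
        M ⊨ σ ↔ Formula.Realize (ψ : (hamelLang C).Formula PEmpty.{u + 1}) (M := M)
          PEmpty.elim := by
      intro M _ _ _
      have h1 := h M PEmpty.elim default
      rw [Formula.Realize, ← h1]
      change _ ↔ Formula.Realize (σ.relabel (Empty.elim : Empty → PEmpty.{u + 1}) :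
        (hamelLang C).Formula PEmpty.{u + 1}) PEmpty.elim
      rw [Formula.realize_relabel, Sentence.Realize]
      exact iff_of_eq (congrArg _ (Subsingleton.elim _ _))
    rw [key M, key N]
    let hM := isModelOf_of_model_tham (M := M) M.is_model
    let hN := isModelOf_of_model_tham (M := N) N.is_model
    let := hM.addCommGroup
    let := hM.module
    let := hN.addCommGroup
    let := hN.module
    exact hM.carrier.realize_iff_of_isEmpty hN.carrier (hM.isHamel.hasExtension hN.isHamel) hψ _ _

end Completeness

end Hamel

namespace Hamel

/-! ### Definitional expansions -/

section DefinitionalExpansions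

open FirstOrder.Language

variable {L L' : FirstOrder.Language.{u, v}} (κ : L →ᴸ L') {M : Type w} [L.Structure M]
  [L'.Structure M] [κ.IsExpansionOn M]

include κ in
theorem IndiscernibleOn.of_expansion {A : Set M} {I : Type*} [LinearOrder I] {J : Set I}
    {V : Type*} {d : I → V → M} (h : IndiscernibleOn L' A J d) : IndiscernibleOn L A J d := by
  intro k φ s t hs ht hsJ htJ
  rw [← κ.realize_onFormula, ← κ.realize_onFormula φ]
  exact h k (κ.onFormula φ) s t hs ht hsJ htJ

include κ in
/-- Local distality passes to definitional expansions. -/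
theorem LocallyDistal.expansion (hM : LocallyDistal L M)
    (h : ∀ {α : Type w} (φ : L'.Formula α), ∃ ψ : L.Formula α, ∀ v : α → M,
      φ.Realize v ↔ ψ.Realize v) : LocallyDistal L' M := by
  intro A V _ φ
  obtain ⟨ψ, hψ⟩ := h φ
  obtain ⟨N₀, hN₀⟩ := hM A V ψ
  refine ⟨N₀, fun N hN d hd hA => ?_⟩
  rw [hψ, hψ]
  exact hN₀ N hN d (hd.of_expansion κ) (hA.of_expansion κ)

/-- An expansion by definable symbols: every formula has an equivalent in the smaller language, if
the function symbols are not new and the relation symbols are definable. -/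
theorem exists_formula_of_definable
    (hfun : ∀ {n : ℕ} (f : L'.Functions n), ∃ f' : L.Functions n, κ.onFunction f' = f)
    (hrel : ∀ {n : ℕ} (R : L'.Relations n), ∃ D : L.Formula (Fin n), ∀ x : Fin n → M,
      Structure.RelMap R x ↔ D.Realize x)
    {α : Type*} {n : ℕ} (φ : L'.BoundedFormula α n) :
    ∃ ψ : L.BoundedFormula α n, ∀ (v : α → M) (xs : Fin n → M),
      φ.Realize v xs ↔ ψ.Realize v xs := by
  have term : ∀ {γ : Type _} (t : L'.Term γ), ∃ t' : L.Term γ, ∀ v : γ → M,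
      t.realize v = t'.realize v := by
    intro γ t
    induction t with
    | var x => exact ⟨.var x, fun _ => rfl⟩
    | func f ts ih =>
      choose ts' hts' using ih
      obtain ⟨f', rfl⟩ := hfun f
      refine ⟨.func f' ts', fun v => ?_⟩
      rw [Term.realize_func, Term.realize_func, ← κ.map_onFunction]
      congr 1
      funext i
      exact hts' i v
  induction φ with
  | falsum => exact ⟨.falsum, fun _ _ => Iff.rfl⟩
  | equal s t =>
    obtain ⟨s', hs'⟩ := term s
    obtain ⟨t', ht'⟩ := term t
    refine ⟨.equal s' t', fun v xs => ?_⟩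
    change s.realize _ = t.realize _ ↔ s'.realize _ = t'.realize _
    rw [hs', ht']
  | @rel n l R ts =>
    choose ts' hts' using fun i => term (ts i)
    obtain ⟨D, hD⟩ := hrel R
    refine ⟨BoundedFormula.relabel (n := n) (k := 0) id (BoundedFormula.subst D ts'),
      fun v xs => ?_⟩
    rw [BoundedFormula.realize_relabel, BoundedFormula.realize_subst]
    refine (hD _).trans ?_
    rw [Formula.Realize, iff_eq_eq]
    congr 1
    · funext i
      rw [hts']
      rfl
    · exact Subsingleton.elim _ _
  | imp _ _ h₁ h₂ =>
    obtain ⟨ψ₁, h₁⟩ := h₁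
    obtain ⟨ψ₂, h₂⟩ := h₂
    refine ⟨ψ₁.imp ψ₂, fun v xs => ?_⟩
    rw [BoundedFormula.realize_imp, BoundedFormula.realize_imp, h₁, h₂]
  | all _ h =>
    obtain ⟨ψ, h⟩ := h
    refine ⟨ψ.all, fun v xs => ?_⟩
    rw [BoundedFormula.realize_all, BoundedFormula.realize_all]
    exact forall_congr' fun x => h _ _

end DefinitionalExpansions

/-! ### Distal expansions of the real line with a subset -/

section RealLine

open FirstOrder.Language

/-- The structure of a biordered space, where `∞` is interpreted as `0`. -/
abbrev BiorderedSpace.toStructure {C : Type u} [Field C] [LinearOrder C] [IsStrictOrderedRing C]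
    {G : Type w} [AddCommGroup G] [Module C G] (K : BiorderedSpace C G) :
    (hamelLang C).Structure G where
  funMap := fun {_} f => match f with
    | .zero => fun _ => 0
    | .infty => fun _ => 0
    | .add => fun x => x 0 + x 1
    | .smul c => fun x => c • x 0
    | .val => fun x => K.val (x 0)
  RelMap := fun {_} R => match R with
    | .lt i => fun x => K.pos i (x 1 - x 0)

def BiorderedSpace.carrier {C : Type u} [Field C] [LinearOrder C] [IsStrictOrderedRing C]
    {G : Type w} [AddCommGroup G] [Module C G] (K : BiorderedSpace C G) :
    letI := K.toStructure
    Carrier K G false :=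
  letI := K.toStructure
  { emb := id
    injective := Function.injective_id
    cover := fun x => Or.inr ⟨x, rfl⟩
    ne_infty := fun h => nomatch h
    infty_eq := fun _ => rfl
    zero := rfl
    add := fun _ _ => rfl
    smul := fun _ _ => rfl
    infty_add := fun h => nomatch h
    add_infty := fun h => nomatch h
    smul_infty := fun h => nomatch h
    val := fun _ _ => rfl
    val_zero := K.val_zero
    val_infty := K.val_zero
    lt := fun _ _ _ => Iff.rfl
    lt_infty := fun h => nomatch h
    not_infty_lt := fun h => nomatch h }

/-- The relation symbols `<₀`, `<₁` and a unary relation symbol. -/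
inductive MarkedRel : ℕ → Type
  | lt (i : Fin 2) : MarkedRel 2
  | mem : MarkedRel 1

/-- The language of Hamel spaces over `ℚ` with an additional unary relation symbol. -/
def markedLang : FirstOrder.Language.{0, 0} := ⟨HamelFunc ℚ, MarkedRel⟩

def hamelToMarked : hamelLang ℚ →ᴸ markedLang where
  onFunction := fun {_} f => f
  onRelation := fun {_} R => match R with
    | .lt i => MarkedRel.lt i

def pairToMarked : pairLang →ᴸ markedLang where
  onFunction := fun {_} f => match f with
    | .add => HamelFunc.add
  onRelation := fun {_} R => match R with
    | .lt => MarkedRel.lt 0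
    | .mem => MarkedRel.mem

theorem pairToMarked_injective : pairToMarked.Injective where
  onFunction {n} := by
    rintro ⟨⟩ ⟨⟩ -
    rfl
  onRelation {n} := by
    rintro ⟨⟩ R h <;> cases R
    · rfl
    · rfl

/-- The expansion of the structure of a biordered space by a unary relation. -/
abbrev BiorderedSpace.toMarkedStructure {G : Type w} [AddCommGroup G] [Module ℚ G]
    (K : BiorderedSpace ℚ G) (S : Set G) : markedLang.Structure G where
  funMap := fun {_} f => K.toStructure.funMap f
  RelMap := fun {_} R => match R with
    | .lt i => fun x => K.pos i (x 1 - x 0)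
    | .mem => fun x => x 0 ∈ S

/-- The expansion must keep a symbol for the subset `S`, but this symbol is definable in the
biordered structure. So models of its theory are definitional expansions of models to which the
results on biordered spaces apply. -/
theorem hasDistalExpansion_of_definable
    (P : ∀ (G : Type) [AddCommGroup G] [Module ℚ G], BiorderedSpace ℚ G → Prop)
    (hext : ∀ (M N : Type) [(hamelLang ℚ).Structure M] [(hamelLang ℚ).Structure N]
      (h : IsModelOf P false M) (h' : IsModelOf P false N),
      letI := h.addCommGroup; letI := h.module; letI := h'.addCommGroup; letI := h'.module
      h.space.HasExtension h'.space)
    (hval : ∀ (M : Type) [(hamelLang ℚ).Structure M] (h : IsModelOf P false M),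
      letI := h.addCommGroup; letI := h.module; h.space.HasValueDichotomy)
    (K : BiorderedSpace ℚ ℝ) (hK : P ℝ K) (hpos : ∀ x, K.pos 0 x ↔ 0 < x) (S : Set ℝ)
    (D : (hamelLang ℚ).Formula (Fin 1))
    (hD : letI := K.toStructure; ∀ x : Fin 1 → ℝ, D.Realize x ↔ x 0 ∈ S) :
    @HasDistalExpansion pairLang ℝ (realPair S) := by
  let := realPair S
  let := K.toMarkedStructure S
  let := K.toStructure
  have hexp : hamelToMarked.IsExpansionOn ℝ := by
    refine ⟨fun f x => rfl, fun {n} R x => ?_⟩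
    rcases R with ⟨i⟩
    rfl
  refine ⟨markedLang, pairToMarked, inferInstance, pairToMarked_injective, ?_, ?_⟩
  · refine ⟨fun {n} f x => ?_, fun {n} R x => ?_⟩
    · rcases f with ⟨⟩
      rfl
    · rcases R with _ | _
      · rfl
      · exact propext ((hpos _).trans sub_pos)
  · refine isDistal_of_locallyDistal fun M _ _ hM => ?_
    let := hamelToMarked.reduct M
    have hT : M ⊨ (hamelLang ℚ).completeTheory ℝ := ⟨fun σ hσ => by
      rw [← hamelToMarked.realize_onSentence (M := M)]
      refine hM.realize_of_mem _ ?_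
      rw [mem_completeTheory, hamelToMarked.realize_onSentence (M := ℝ)]
      exact hσ⟩
    have hmodel : ∀ (M : Type) [(hamelLang ℚ).Structure M] [M ⊨ (hamelLang ℚ).completeTheory ℝ],
        IsModelOf P false M := fun M _ hM σ hσ =>
      hM.realize_of_mem σ (hσ ℝ K hK ℝ K.carrier)
    have hbf : BackAndForth.{0, 0, 0} ((hamelLang ℚ).completeTheory ℝ) :=
      backAndForth_of_isModelOf hmodel hext
    have hmem : ∀ x : Fin 1 → M, Structure.RelMap (L := markedLang) MarkedRel.mem x ↔
        D.Realize x := by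
      let R : markedLang.Relations 1 := MarkedRel.mem
      -- The sentence says that `D` defines the marked subset. It is true in ℝ, so `D` defines it in
      -- every model.
      let σ : markedLang.Sentence := (((R.formula Term.var).iff
        (hamelToMarked.onFormula D)).relabel (Sum.inr : Fin 1 → Empty ⊕ Fin 1)).iAlls (Fin 1)
      have hσ : ∀ (N : Type) [markedLang.Structure N] [(hamelLang ℚ).Structure N]
          [hamelToMarked.IsExpansionOn N], N ⊨ σ ↔
            ∀ x : Fin 1 → N, Structure.RelMap R x ↔ D.Realize x := by
        intro N _ _ _
        rw [Sentence.Realize, Formula.realize_iAlls]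
        refine forall_congr' fun x => ?_
        rw [Formula.realize_relabel, Formula.realize_iff, LHom.realize_onFormula]
        exact iff_congr Formula.realize_rel Iff.rfl
      refine (hσ M).1 (hM.realize_of_mem σ ?_)
      rw [mem_completeTheory, hσ ℝ]
      exact fun x => (hD x).symm
    refine (locallyDistal_of_isModelOf hmodel hbf hval M).expansion hamelToMarked fun φ => ?_
    refine (exists_formula_of_definable (M := M) hamelToMarked (fun f => ⟨f, rfl⟩)
      (fun {n} R => ?_) φ).imp fun ψ hψ v => hψ v default
    rcases R with ⟨i⟩ | _
    · exact ⟨fLt i (.var 0) (.var 1), fun x =>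
        (iff_of_eq (hamelToMarked.map_onRelation (HamelRel.lt i : (hamelLang ℚ).Relations 2) x)).trans
          ((relMap_lt i x).trans (realize_fLt i (.var 0) (.var 1) x).symm)⟩
    · exact ⟨D, hmem⟩

theorem isVectorSpaceOrder_real : IsVectorSpaceOrder ℚ ((· < ·) : ℝ → ℝ → Prop) where
  irrefl := lt_irrefl
  trans _ _ _ := lt_trans
  total _ _ := lt_or_gt_of_ne
  add_left _ _ z h := add_lt_add_right h z
  smul_pos r x hr hx := by
    rw [Rat.smul_def]
    exact mul_pos (Rat.cast_pos.2 hr) hx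

/-- The basis `H`, ordered as a subset of ℝ, turns ℝ into an independent, dense Hamel space in which
`H` is definable as the set of nonzero `x` with `val x = x`. Zero must be excluded, since here `val
0 = 0`. -/
theorem hasDistalExpansion_of_isHamelBasis {H : Set ℝ} (hH : IsHamelBasis H) (hH' : Dense H) :
    @HasDistalExpansion pairLang ℝ (realPair H) := by
  let e : Module.Basis H ℚ ℝ := Module.Basis.mk hH.1 (by
    rw [← hH.2]
    exact Submodule.span_mono fun x hx => ⟨⟨x, hx⟩, rfl⟩)
  have he : ∀ i, e i = i := fun i => Module.Basis.mk_apply _ _ _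
  have hmono : ∀ i j : H, i < j → e i < e j := fun i j hij => by
    rw [he, he]
    exact hij
  have hdense : ∀ a b : ℝ, a < b → ∃ i, a < e i ∧ e i < b := fun a b hab => by
    obtain ⟨x, hx, h⟩ := hH'.exists_between hab
    exact ⟨⟨x, hx⟩, by rwa [he]⟩
  have hind := HamelSpace.ofBasis_independent e isVectorSpaceOrder_real hmono hdense
  let S := HamelSpace.ofBasis e isVectorSpaceOrder_real hmono
  refine hasDistalExpansion_of_definable (HamelClass ℚ) (fun M N _ _ h h' => ?_) (fun M _ h => ?_)
    (S.toBiorderedSpace hind) (S.isHamel hind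
      (HamelSpace.ofBasis_dense e isVectorSpaceOrder_real hmono hdense)) (fun x => Iff.rfl) H
    (((Term.var 0).equal tZero).not ⊓ (tVal (.var 0)).equal (.var 0)) fun x => ?_
  · let := h.addCommGroup
    let := h.module
    let := h'.addCommGroup
    let := h'.module
    exact h.isHamel.hasExtension h'.isHamel
  · let := h.addCommGroup
    let := h.module
    exact h.isHamel.hasValueDichotomy
  · let := (S.toBiorderedSpace hind).toStructure
    rw [Formula.realize_inf, Formula.realize_not, Formula.realize_equal, Formula.realize_equal,
      realize_tZero, realize_tVal, Term.realize_var]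
    change ¬ x 0 = 0 ∧ (basisVal e (x 0)).untopD 0 = x 0 ↔ _
    constructor
    · rintro ⟨h0, h1⟩
      obtain ⟨i, hi⟩ := exists_leadsAt_repr e h0
      rw [basisVal_of_leadsAt hi, WithTop.untopD_coe, he] at h1
      exact h1 ▸ i.2
    · intro h
      have h1 : e ⟨x 0, h⟩ = x 0 := he _
      refine ⟨fun h0 => e.ne_zero ⟨x 0, h⟩ (h1.trans h0), ?_⟩
      conv_lhs => rw [← h1, basisVal_of_leadsAt (leadsAt_basis e _), WithTop.untopD_coe]
      exact h1

/-- The biordered space given by an ordered vector space and a linear map to another one. -/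
def BiorderedSpace.ofLinearMap {C : Type*} [Field C] [LinearOrder C] [IsStrictOrderedRing C]
    {G V : Type*} [AddCommGroup G] [Module C G] [AddCommGroup V] [Module C V]
    {lt : G → G → Prop} {lt' : V → V → Prop} (h : IsVectorSpaceOrder C lt)
    (h' : IsVectorSpaceOrder C lt') (f : G →ₗ[C] V) (hG : ∃ x, lt 0 x) (hV : ∃ x, lt' 0 (f x)) :
    BiorderedSpace C G where
  pos := ![lt 0, fun x => lt' 0 (f x)]
  val _ := 0
  pos_neg i x hx := by
    fin_cases i
    · exact h.not_lt_neg hx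
    · change ¬ lt' 0 (f (-x))
      rw [map_neg]
      exact h'.not_lt_neg hx
  pos_add i x y hx hy := by
    fin_cases i
    · exact h.pos_add hx hy
    · change lt' 0 (f (x + y))
      rw [map_add]
      exact h'.pos_add hx hy
  not_pos_add i x y hx hy := by
    fin_cases i
    · exact h.not_pos_add hx hy
    · change ¬ lt' 0 (f (x + y))
      rw [map_add]
      exact h'.not_pos_add hx hy
  pos_smul i r x hr hx := by
    fin_cases i
    · exact h.smul_pos r x hr hx
    · change lt' 0 (f (r • x))
      rw [map_smul]
      exact h'.smul_pos r _ hr hx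
  pos_total x hx := (h.pos_or x).resolve_left hx
  pos_nontrivial i := by
    fin_cases i
    exacts [hG, hV]
  val_zero := rfl
  val_smul _ _ _ := rfl

/-- Any basis can be well-ordered, and the lexicographic order in its coordinates is a vector space
order. -/
theorem exists_isVectorSpaceOrder (C V : Type*) [Field C] [LinearOrder C] [IsStrictOrderedRing C]
    [AddCommGroup V] [Module C V] : ∃ lt : V → V → Prop, IsVectorSpaceOrder C lt := by
  classical
  let := linearOrderOfSTO
    (WellOrderingRel : Module.Basis.ofVectorSpaceIndex C V → Module.Basis.ofVectorSpaceIndex C V → Prop)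
  exact ⟨_, isVectorSpaceOrder_lexLT.comap (Module.Basis.ofVectorSpace C V).repr⟩

/-- Any vector space order on ℝ/ℚ, pulled back to ℝ, is a preorder with kernel ℚ. So ℚ is definable
as the set of `x` with neither `x` nor `-x` positive, and its density in ℝ is the density of the
kernel. -/
theorem hasDistalExpansion_rat :
    @HasDistalExpansion pairLang ℝ (realPair (Set.range ((↑) : ℚ → ℝ))) := by
  let f := (Submodule.span ℚ {(1 : ℝ)}).mkQ
  have hf : ∀ x, f x = 0 ↔ x ∈ Set.range ((↑) : ℚ → ℝ) := fun x => by
    rw [Submodule.mkQ_apply, Submodule.Quotient.mk_eq_zero, Submodule.mem_span_singleton]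
    simp [Rat.smul_def]
  obtain ⟨lt, hlt⟩ := exists_isVectorSpaceOrder ℚ (ℝ ⧸ Submodule.span ℚ {(1 : ℝ)})
  have hV : ∃ x, lt 0 (f x) := by
    -- An irrational number shows that the quotient is nonzero, so that the preorder has positive
    -- elements.
    have h0 : f √2 ≠ 0 := fun h0 => irrational_sqrt_two ((hf _).1 h0)
    rcases (hlt.pos_or _).resolve_left h0 with h | h
    · exact ⟨_, h⟩
    · exact ⟨-√2, by rwa [map_neg]⟩
  have hker : ∀ x, ¬ lt 0 (f x) ∧ ¬ lt 0 (f (-x)) ↔ f x = 0 := fun x => by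
    rw [map_neg]
    constructor
    · rintro ⟨h1, h2⟩
      by_contra h0
      exact ((hlt.pos_or _).resolve_left h0).elim h1 h2
    · intro h0
      rw [h0, neg_zero]
      exact ⟨hlt.irrefl _, hlt.irrefl _⟩
  let K := BiorderedSpace.ofLinearMap isVectorSpaceOrder_real hlt f ⟨1, one_pos⟩ hV
  have hK : K.IsPreordered := by
    refine ⟨fun _ => rfl, fun a b hab => ?_⟩
    obtain ⟨q, h1, h2⟩ := exists_rat_btwn (sub_pos.1 hab)
    exact ⟨q, (hker q).2 ((hf _).2 ⟨q, rfl⟩), sub_pos.2 h1, sub_pos.2 h2⟩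
  refine hasDistalExpansion_of_definable (PreorderedClass ℚ) (fun M N _ _ h h' => ?_)
    (fun M _ h => ?_) K hK (fun x => Iff.rfl) _
    ((fLt 1 tZero (.var 0)).not ⊓ (fLt 1 (.var 0) tZero).not) fun x => ?_
  · let := h.addCommGroup
    let := h.module
    let := h'.addCommGroup
    let := h'.module
    exact h.isPreordered.hasExtension h'.isPreordered
  · let := h.addCommGroup
    let := h.module
    exact h.isPreordered.hasValueDichotomy
  · let := K.toStructure
    rw [Formula.realize_inf, Formula.realize_not, Formula.realize_not, realize_fLt, realize_fLt,
      realize_tZero, Term.realize_var, ← hf, ← hker]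
    change ¬ lt 0 (f (x 0 - 0)) ∧ ¬ lt 0 (f (0 - x 0)) ↔ _
    rw [sub_zero, zero_sub]

end RealLine

end Hamel

theorem theorem4p1 :
    (∀ (C : Type u) [Field C] [LinearOrder C] [IsStrictOrderedRing C],
      (Hamel.THam C).IsComplete ∧ Hamel.IsDistal (Hamel.THam C)) ∧
    (∀ H : Set ℝ, Hamel.IsHamelBasis H → Dense H →
      @Hamel.HasDistalExpansion Hamel.pairLang ℝ (Hamel.realPair H)) ∧
    @Hamel.HasDistalExpansion Hamel.pairLang ℝ
      (Hamel.realPair (Set.range ((↑) : ℚ → ℝ))) :=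
  ⟨fun _ _ _ _ => ⟨Hamel.isComplete_tham, Hamel.isDistal_tham⟩,
    fun _ hH hH' => Hamel.hasDistalExpansion_of_isHamelBasis hH hH', Hamel.hasDistalExpansion_rat⟩
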